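/- Let $n\ge 1$ and let $f(\mathbf z,\bar{\mathbf z})=\sum_{\nu,\mu}c_{\nu,\mu}\mathbf z^\nu\bar{\mathbf z}^\mu$ be a mixed analytic function germ at $O\in\mathbb C^n$ (a power series in $z_1,\dots,z_n,\bar z_1,\dots,\bar z_n$ converging near $O$) with $c_{0,0}=0$; put $V=f^{-1}(0)$. *Newton data.* The Newton polygon $\Gamma_+(f)$ is the convex hull of $\bigcup_{c_{\nu,\mu}\ne0}\big((\nu+\mu)+\mathbb R_{\ge0}^n\big)$, and the Newton boundary $\Gamma(f)$ is the union of its compact faces. For $P\in\mathbb R_{\ge0}^n$ let $\Delta(P)\subset\Gamma(f)$ be the set where $x\mapsto\sum_ip_ix_i$ is minimal on $\Gamma(f)$. For integral $P$ let $d(P;f)=\min\{\sum_ip_i(\nu_i+\mu_i)\mid c_{\nu,\mu}\neq0\}$ and $f_P=\sum_{\nu+\mu\in\Delta(P)}c_{\nu,\mu}\mathbf z^\nu\bar{\mathbf z}^\mu$. The germ $f$ is *convenient* if it does not vanish identically on any coordinate axis, and *non-degenerate* if, for every $P\in\mathbb Z_{>0}^n$, no zero of $f_P:(\mathbb C^*)^n\to\mathbb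 C$ is a critical point of this real analytic map. The *dual Newton diagram* $\Gamma^*(f)$ is the partition of $\mathbb R^n_{\ge0}$ into the classes of $P\sim Q\iff\Delta(P)=\Delta(Q)$. *Toric modification.* Let $\Sigma^*$ be a finite fan of regular simplicial cones subdividing $\mathbb R_{\ge 0}^n$, whose primitive integral generators (vertices) are the $E_i$ (the standard basis of $\mathbb Z^n$) and strictly positive vectors, and such that every relatively open cone of $\Sigma^*$ lies in one class of $\Gamma^*(f)$. Let $\mathcal V^+$ be the set of strictly positive vertices of $\Sigma^*$. Let $\hat\pi:X\to\mathbb C^n$ be the associated toric modification: $X$ is glued from charts $\mathbb C^n_\sigma$, one for each $n$-dimensional cone with vertices $P_1,\dots,P_n$, identified with the unimodular matrix $\sigma$ with columns $P_j$; $\mathbf u_\sigma$ and $\mathbf u_\tau$ are identified if the monomial map with exponent matrix $\tau^{-1}\sigma$ is defined at $\mathbf u_\sigma$ and sends it to $\mathbf u_\tau$; $\hat\pi$ is the monomial map with matrix $\sigma$ on $\mathbb C^n_\sigma$; and $\hat E(P)$ is the divisor given by $u_{\sigma j}=0$ in the charts with $P_j=P$. *Normal real blowing-up.* Let $\omega:\mathcal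 RX\to X$ be the normal real blowing-up along the divisors $\hat E(P)$, $P\in\mathcal V^+$: in each chart every coordinate $u_{\sigma j}$ with $P_j\in\mathcal V^+$ is replaced by a point $(u_{\sigma j},\ell_j)$ of $\{(u,\ell)\in\mathbb C\times\mathbb{RP}^1\mid u\in\ell\}$, where $\mathbb{RP}^1$ is the space of real lines through $0$ in $\mathbb C$, and the lines are glued by the maps that the coordinate changes induce on the normal directions of the divisors. The real analytic structure of $\mathcal RX$ is the one with the coordinates $(\tilde x,t)\mapsto(\tilde x(1+it),[1+it])$ and $(s,\tilde y)\mapsto(\tilde y(s+i),[s+i])$ on these factors, and the real and imaginary parts of the remaining $u_{\sigma j}$. Put $\Phi=\hat\pi\circ\omega:\mathcal RX\to\mathbb C^n$ and $\tilde E(P)=\omega^{-1}(\hat E(P))$. **Theorem.** If $f$ is convenient and non-degenerate, then $\Phi:\mathcal RX\to\mathbb C^n$ is a good resolution of real type of $f$ at the origin with exceptional divisors $\tilde E(P)$, $P\in\mathcal V^+$. That is: 0. every point of $V\setminus\{O\}$ close enough to $O$ is a regular point of $f$, regarded as a real analytic map to $\mathbb C=\mathbb R^2$; 1. the finitely many irreducible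 components of the real analytic set $\Phi^{-1}(O)$ are the $\tilde E(P)$, $P\in\mathcal V^+$, and each of them is a smooth real analytic subvariety of real codimension one; 2. $\mathcal RX$ is a real analytic manifold (Hausdorff, second countable, without boundary) of dimension $2n$, and $\Phi$ is proper and real analytic; 3. $\Phi:\mathcal RX\setminus\Phi^{-1}(O)\to\mathbb C^n\setminus\{O\}$ is a real analytic diffeomorphism; 4. the strict transform $\tilde V$, i.e. the closure of $\Phi^{-1}(V\setminus\{O\})$, is a smooth real analytic submanifold of real codimension two in an open neighbourhood of $\Phi^{-1}(O)$; 5. for every $p\in\tilde V\cap\Phi^{-1}(O)$, if $E_1,\dots,E_t$ are the exceptional divisors through $p$, there are a neighbourhood $U$ of $p$ and real analytic coordinates $(u_1,\dots,u_{2n})$ on $U$, centred at $p$, and $m_1,\dots,m_t\in\mathbb N$ such that $f\circ\Phi=u_1^{m_1}\cdots u_t^{m_t}(u_{t+1}+iu_{t+2})$ on $U$, $E_j\cap U=\{u_j=0\}$ for $1\le j\le t$, and $\tilde V\cap U=\{u_{t+1}+iu_{t+2}=0\}$. Moreover, for each $P\in\mathcal V^+$ the multiplicity of $\Phi^*f=f\circ\Phi$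 along $\tilde E(P)$ is $d(P;f)$: near every point $p$ of $\tilde E(P)$ there are real analytic coordinates with $\tilde E(P)=\{u_1=0\}$ and $f\circ\Phi=u_1^{d(P;f)}G$, where $G$ is real analytic and does not vanish identically on $\tilde E(P)$ near $p$. -/

import Mathlib

open Set Filter Topology
open scoped Manifold ContDiff LinearAlgebra.Projectivization

noncomputable section

namespace Mixed

/-! ## Mixed functions -/

/-- Complex `n`-space, regarded as a real vector space of dimension `2n` when derivatives are
taken. -/
abbrev Cn (n : ℕ) : Type := Fin n → ℂ

/-- The mixed monomial `z^ν * conj(z)^μ`. -/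
def mixedMonomial {n : ℕ} (ν μ : Fin n → ℕ) (z : Cn n) : ℂ :=
  ∏ i, z i ^ ν i * (starRingEnd ℂ (z i)) ^ μ i

/-- `f` is (a representative of) the germ at the origin of the mixed analytic function
`∑ c ν μ z^ν conj(z)^μ`: the series converges to `f` near the origin. -/
def HasMixedExpansion {n : ℕ} (f : Cn n → ℂ) (c : (Fin n → ℕ) → (Fin n → ℕ) → ℂ) : Prop :=
  ∀ᶠ z in 𝓝 (0 : Cn n),
    HasSum (fun p : (Fin n → ℕ) × (Fin n → ℕ) => c p.1 p.2 * mixedMonomial p.1 p.2 z) (f z)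

/-- The coordinate subspaces `ℂ^J` on which the germ of `f` does not vanish identically. -/
def nonvanishingSubspaces {n : ℕ} (f : Cn n → ℂ) : Set (Finset (Fin n)) :=
  {J | ∃ᶠ z in 𝓝 (0 : Cn n), (∀ j, j ∉ J → z j = 0) ∧ f z ≠ 0}

/-- `f` is `k`-convenient: it does not vanish identically on any coordinate subspace of
dimension `n - k`. -/
def IsKConvenient {n : ℕ} (k : ℕ) (f : Cn n → ℂ) : Prop :=
  ∀ J : Finset (Fin n), J.card = n - k → J ∈ nonvanishingSubspaces f

/-- `f` is convenient: it does not vanish identically on any coordinate axis. -/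
def IsConvenient {n : ℕ} (f : Cn n → ℂ) : Prop := IsKConvenient (n - 1) f

/-! ## The Newton boundary -/

/-- The (radial) Newton polygon: the convex hull of the union of the orthants
`(ν + μ) + (ℝ≥0)^n`, `c ν μ ≠ 0`. -/
def newtonPolygon {n : ℕ} (c : (Fin n → ℕ) → (Fin n → ℕ) → ℂ) : Set (Fin n → ℝ) :=
  convexHull ℝ {x | ∃ ν μ, c ν μ ≠ 0 ∧ ∀ i, ((ν i + μ i : ℕ) : ℝ) ≤ x i}

/-- The Newton boundary: the union of the compact faces of the Newton polygon. -/
def newtonBoundary {n : ℕ} (c : (Fin n → ℕ) → (Fin n → ℕ) → ℂ) : Set (Fin n → ℝ) :=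
  ⋃₀ {Δ | IsExposed ℝ (newtonPolygon c) Δ ∧ IsCompact Δ}

/-- The face `Δ(P)` of the Newton boundary on which the linear function `x ↦ ∑ P i * x i` takes
its minimal value. -/
def newtonFace {n : ℕ} (c : (Fin n → ℕ) → (Fin n → ℕ) → ℂ) (P : Fin n → ℝ) :
    Set (Fin n → ℝ) :=
  {x ∈ newtonBoundary c | ∀ y ∈ newtonBoundary c, ∑ i, P i * x i ≤ ∑ i, P i * y i}

/-- A weight vector with natural number entries as a real vector. -/
def realWeight {n : ℕ} (P : Fin n → ℕ) : Fin n → ℝ := fun i => (P i : ℝ)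

/-- A strictly positive weight vector. -/
def StrictlyPositive {n : ℕ} (P : Fin n → ℕ) : Prop := ∀ i, 0 < P i

/-- `d(P; f)`: the minimal radial degree `∑ P i (ν i + μ i)` of a monomial that occurs. -/
def radialDegree {n : ℕ} (c : (Fin n → ℕ) → (Fin n → ℕ) → ℂ) (P : Fin n → ℕ) : ℕ :=
  sInf {d | ∃ ν μ, c ν μ ≠ 0 ∧ d = ∑ i, P i * (ν i + μ i)}

open Classical in
/-- The face function `f_P`, the sum of the terms with `ν + μ ∈ Δ(P)` (finitely many if `P` is
strictly positive). -/
def faceFunction {n : ℕ} (c : (Fin n → ℕ) → (Fin n → ℕ) → ℂ) (P : Fin n → ℕ) (z : Cn n) : ℂ :=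
  ∑ᶠ p : (Fin n → ℕ) × (Fin n → ℕ),
    if realWeight (p.1 + p.2) ∈ newtonFace c (realWeight P) then
      c p.1 p.2 * mixedMonomial p.1 p.2 z else 0

/-- Non-degeneracy: for every strictly positive integer weight vector `P`, no zero of
`f_P : (ℂ^*)^n → ℂ` is a critical point (the real derivative is onto at each zero). -/
def IsNonDegenerate {n : ℕ} (c : (Fin n → ℕ) → (Fin n → ℕ) → ℂ) : Prop :=
  ∀ P : Fin n → ℕ, StrictlyPositive P → ∀ z : Cn n, (∀ i, z i ≠ 0) →
    faceFunction c P z = 0 → Function.Surjective (fderiv ℝ (faceFunction c P) z)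

/-! ## Regular fans and toric modifications -/

/-- The closed cone generated by a finite set of weight vectors. -/
def cone {n : ℕ} (s : Finset (Fin n → ℕ)) : Set (Fin n → ℝ) :=
  {x | ∃ t : (Fin n → ℕ) → ℝ, (∀ P ∈ s, 0 ≤ t P) ∧ x = ∑ P ∈ s, t P • realWeight P}

/-- The open cone generated by a finite set of weight vectors. -/
def openCone {n : ℕ} (s : Finset (Fin n → ℕ)) : Set (Fin n → ℝ) :=
  {x | ∃ t : (Fin n → ℕ) → ℝ, (∀ P ∈ s, 0 < t P) ∧ x = ∑ P ∈ s, t P • realWeight P}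

/-- A regular fan: a finite subdivision of the cone `Cone(E_1, …, E_n)` of non-negative weight
vectors into regular simplicial cones. A cone is given by the set of its vertices. -/
structure RegularFan (n : ℕ) where
  /-- the vertex sets of the cones -/
  cones : Finset (Finset (Fin n → ℕ))
  /-- every cone is regular: its vertices are part of a `ℤ`-basis of `ℤ^n` -/
  regular : ∀ s ∈ cones, ∃ b : Module.Basis (Fin n) ℤ (Fin n → ℤ),
    ∀ P ∈ s, ∃ j, b j = fun i => (P i : ℤ)
  /-- every face of a cone is a cone of the fan -/
  face_mem : ∀ s ∈ cones, ∀ t, t ⊆ s → t ∈ cones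
  /-- two cones intersect in the common face spanned by the common vertices -/
  inter_eq : ∀ s ∈ cones, ∀ t ∈ cones, cone s ∩ cone t = cone (s ∩ t)
  /-- the cones cover the cone of non-negative weight vectors -/
  cover : ∀ x : Fin n → ℝ, (∀ i, 0 ≤ x i) → ∃ s ∈ cones, x ∈ cone s

namespace RegularFan

variable {n : ℕ} (S : RegularFan n)

/-- The vertices of the fan. -/
def vertices : Set (Fin n → ℕ) := {P | {P} ∈ S.cones}

/-- The strictly positive vertices. -/
def positiveVertices : Set (Fin n → ℕ) := {P ∈ S.vertices | StrictlyPositive P}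

/-- The fan subdivides the dual Newton diagram: every open cone of the fan lies in one class of
the equivalence relation `P ∼ Q ↔ Δ(P) = Δ(Q)`. -/
def IsAdmissible (c : (Fin n → ℕ) → (Fin n → ℕ) → ℂ) : Prop :=
  ∀ s ∈ S.cones, ∀ P ∈ openCone s, ∀ Q ∈ openCone s, newtonFace c P = newtonFace c Q

/-- The toric charts: one for each `n`-dimensional cone `σ` of the fan together with an ordering
`P_1, …, P_n` of its vertices (the orderings of one cone give charts that are identified with
each other below). -/
def Chart : Type :=
  {σ : Fin n → (Fin n → ℕ) // Function.Injective σ ∧ Finset.univ.image σ ∈ S.cones}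

variable {S}

/-- The unimodular matrix whose `j`-th column is the `j`-th vertex. -/
def Chart.mat (σ : S.Chart) : Matrix (Fin n) (Fin n) ℤ := Matrix.of fun i j => (σ.1 j i : ℤ)

/-- The monomial map `ψ_A`. -/
def monomialMap (A : Matrix (Fin n) (Fin n) ℤ) (u : Cn n) : Cn n := fun i => ∏ j, u j ^ A i j

/-- `ψ_A` is well defined at `u`: no vanishing coordinate has a negative exponent. -/
def WellDefinedAt (A : Matrix (Fin n) (Fin n) ℤ) (u : Cn n) : Prop :=
  ∀ i j, u j = 0 → 0 ≤ A i j

/-- `u` in the chart `σ` and `v` in the chart `τ` are identified if `ψ_B` with `B = τ⁻¹σ` is well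
defined at `u` and maps it to `v`. -/
def glue (p q : Σ _ : S.Chart, Cn n) : Prop :=
  ∃ B : Matrix (Fin n) (Fin n) ℤ, q.1.mat * B = p.1.mat ∧ WellDefinedAt B p.2 ∧
    q.2 = monomialMap B p.2

variable (S)

/-- The toric variety `X`, with the quotient topology. -/
def ToricVariety : Type := Quot (glue (S := S))

instance : TopologicalSpace S.ToricVariety :=
  inferInstanceAs (TopologicalSpace (Quot (glue (S := S))))

variable {S}

theorem zpow_sum_of_ne_or_nonneg {ι : Type*} (s : Finset ι) (x : ℂ) (e : ι → ℤ)
    (h : x = 0 → ∀ k, 0 ≤ e k) : x ^ (∑ k ∈ s, e k) = ∏ k ∈ s, x ^ e k := by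
  classical
  induction s using Finset.induction_on with
  | empty => simp
  | insert a s ha ih =>
    rw [Finset.sum_insert ha, Finset.prod_insert ha, ← ih]
    by_cases hx : x = 0
    · have h1 := h hx a
      have h2 : 0 ≤ ∑ k ∈ s, e k := Finset.sum_nonneg fun k _ => h hx k
      obtain ⟨m, hm⟩ := Int.eq_ofNat_of_zero_le h1
      obtain ⟨l, hl⟩ := Int.eq_ofNat_of_zero_le h2
      rw [hm, hl, ← Nat.cast_add, zpow_natCast, zpow_natCast, zpow_natCast, pow_add]
    · exact zpow_add₀ hx _ _

theorem monomialMap_glue {p q : Σ _ : S.Chart, Cn n} (h : glue p q) :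
    monomialMap p.1.mat p.2 = monomialMap q.1.mat q.2 := by
  obtain ⟨B, hB, hw, hq⟩ := h
  funext i
  have hexp : ∀ j, p.1.mat i j = ∑ k, B k j * q.1.mat i k := by
    intro j
    rw [← hB, Matrix.mul_apply]
    exact Finset.sum_congr rfl fun k _ => mul_comm _ _
  have hpos : ∀ k, 0 ≤ q.1.mat i k := fun k => by simp [Chart.mat]
  calc monomialMap p.1.mat p.2 i
      = ∏ j, ∏ k, p.2 j ^ (B k j * q.1.mat i k) := by
        refine Finset.prod_congr rfl fun j _ => ?_
        rw [hexp j]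
        exact zpow_sum_of_ne_or_nonneg _ _ _ fun h0 k => mul_nonneg (hw k j h0) (hpos k)
    _ = ∏ k, ∏ j, p.2 j ^ (B k j * q.1.mat i k) := Finset.prod_comm
    _ = ∏ k, (∏ j, p.2 j ^ B k j) ^ q.1.mat i k := by
        refine Finset.prod_congr rfl fun k _ => ?_
        rw [← Finset.prod_zpow]
        exact Finset.prod_congr rfl fun j _ => zpow_mul _ _ _
    _ = monomialMap q.1.mat q.2 i := by rw [hq]; rfl

variable (S)

/-- The toric modification `X → ℂ^n`, given by `ψ_σ` in the chart `σ`. -/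
def toricMap : S.ToricVariety → Cn n :=
  Quot.lift (fun p => monomialMap p.1.mat p.2) fun _ _ h => monomialMap_glue h

/-- The divisor `Ê(P)` of `X`, given by `u_j = 0` in the charts with `P_j = P`. -/
def toricDivisor (P : Fin n → ℕ) : Set S.ToricVariety :=
  {x | ∃ (σ : S.Chart) (u : Cn n) (j : Fin n), σ.1 j = P ∧ u j = 0 ∧ x = Quot.mk _ ⟨σ, u⟩}

/-! ## The normal real blowing-up -/

end RegularFan

/-- The real projective line of real lines through `0` in `ℂ`, with the quotient topology. -/
instance realProjectiveLineTopology : TopologicalSpace (ℙ ℝ ℂ) :=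
  inferInstanceAs (TopologicalSpace (Quotient (projectivizationSetoid ℝ ℂ)))

namespace RegularFan

variable {n : ℕ} (S : RegularFan n)

variable {S} in
/-- The index set of the coordinates of a chart that define exceptional divisors. -/
abbrev Chart.Exc (σ : S.Chart) : Type := {j : Fin n // StrictlyPositive (σ.1 j)}

variable {S} in
/-- The normal real blowing-up of the chart `ℂ^n_σ` along its exceptional divisors: each
coordinate `u_j` that defines an exceptional divisor is replaced by a point of the real
blowing-up `{(u, ℓ) ∈ ℂ × ℝℙ¹ | u ∈ ℓ}` of `ℂ`. -/
def Chart.Blowup (σ : S.Chart) : Type :=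
  {p : Cn n × (σ.Exc → ℙ ℝ ℂ) // ∀ j : σ.Exc, p.1 j ∈ (p.2 j).submodule}

instance (σ : S.Chart) : TopologicalSpace σ.Blowup :=
  inferInstanceAs (TopologicalSpace {p : Cn n × (σ.Exc → ℙ ℝ ℂ) //
    ∀ j : σ.Exc, p.1 j ∈ (p.2 j).submodule})

variable {S} in
/-- The identification of the blown-up charts: the underlying points of `X` are identified by
`v = ψ_B(u)`, `B = τ⁻¹σ`, and along each exceptional divisor that both charts see (as `u_j = 0`
and as `v_k = 0`) the coordinate change `v_k = u_j * ∏_{i ≠ j} u_i ^ B k i` maps the normal real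
line at `u` onto the normal real line at `v`. -/
def glueBlowup (p q : Σ σ : S.Chart, σ.Blowup) : Prop :=
  ∃ B : Matrix (Fin n) (Fin n) ℤ, q.1.mat * B = p.1.mat ∧ WellDefinedAt B p.2.1.1 ∧
    q.2.1.1 = monomialMap B p.2.1.1 ∧
    ∀ (j : p.1.Exc) (k : q.1.Exc), p.1.1 j = q.1.1 k →
      (p.2.1.2 j).submodule.map
          (LinearMap.mulLeft ℝ (∏ i ∈ Finset.univ.erase j.1, p.2.1.1 i ^ B k i)) =
        (q.2.1.2 k).submodule

/-- The normal real blowing-up `RX` of `X` along the exceptional divisors `Ê(P)`, `P` strictly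
positive, with the quotient topology. -/
def RealBlowup : Type := Quot (glueBlowup (S := S))

instance : TopologicalSpace S.RealBlowup :=
  inferInstanceAs (TopologicalSpace (Quot (glueBlowup (S := S))))

/-- The projection `ω : RX → X`. -/
def blowdown : S.RealBlowup → S.ToricVariety :=
  Quot.map (fun p => ⟨p.1, p.2.1.1⟩) fun _ _ ⟨B, h1, h2, h3, _⟩ => ⟨B, h1, h2, h3⟩

/-- The composite `Φ : RX → X → ℂ^n`. -/
def resolutionMap : S.RealBlowup → Cn n := S.toricMap ∘ S.blowdown

/-- The exceptional divisor `Ẽ(P) = ω⁻¹(Ê(P))`. -/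
def exceptionalDivisor (P : S.positiveVertices) : Set S.RealBlowup :=
  S.blowdown ⁻¹' S.toricDivisor P.1

end RegularFan

/-! ## Real analytic manifolds of dimension `2n` -/

/-- The model space `ℝ^{2n}`; its coordinates are indexed by `Fin n × Fin 2`. -/
abbrev RealSpace (n : ℕ) : Type := Fin n × Fin 2 → ℝ

/-- Real analytic coordinate systems on a manifold modelled on `ℝ^{2n}`. -/
abbrev analyticCharts (n : ℕ) (Y : Type*) [TopologicalSpace Y] [ChartedSpace (RealSpace n) Y] :
    Set (OpenPartialHomeomorph Y (RealSpace n)) :=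
  IsManifold.maximalAtlas 𝓘(ℝ, RealSpace n) ω Y

section Manifold

variable {n : ℕ} {Y : Type*} [TopologicalSpace Y] [ChartedSpace (RealSpace n) Y]

/-- Near `p`, the set `Z` is a real analytic submanifold of codimension `k`: it is given by the
vanishing of `k` of the coordinates of a real analytic coordinate system at `p`. -/
def IsSubmanifoldAt (n : ℕ) {Y : Type*} [TopologicalSpace Y] [ChartedSpace (RealSpace n) Y]
    (Z : Set Y) (k : ℕ) (p : Y) : Prop :=
  ∃ χ ∈ analyticCharts n Y, p ∈ χ.source ∧ ∃ J : Finset (Fin n × Fin 2), J.card = k ∧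
    ∀ q ∈ χ.source, q ∈ Z ↔ ∀ j ∈ J, χ q j = 0

/-- `A` is a real analytic subset: near every point of the manifold it is the zero set of a real
analytic function (finitely many equations `g_i = 0` amount to the one equation `∑ g_i² = 0`). -/
def IsAnalyticSubset (n : ℕ) {Y : Type*} [TopologicalSpace Y] [ChartedSpace (RealSpace n) Y]
    (A : Set Y) : Prop :=
  ∀ p : Y, ∃ U : Set Y, IsOpen U ∧ p ∈ U ∧ ∃ g : Y → ℝ,
    ContMDiffOn 𝓘(ℝ, RealSpace n) 𝓘(ℝ, ℝ) ω g U ∧ ∀ q ∈ U, q ∈ A ↔ g q = 0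

/-- An irreducible real analytic subset. -/
def IsIrreducibleSubset (n : ℕ) {Y : Type*} [TopologicalSpace Y] [ChartedSpace (RealSpace n) Y]
    (Z : Set Y) : Prop :=
  Z.Nonempty ∧ IsAnalyticSubset n Z ∧ ∀ A B : Set Y, IsAnalyticSubset n A →
    IsAnalyticSubset n B → Z = A ∪ B → Z = A ∨ Z = B

/-- The function `F` has multiplicity `m` along the hypersurface `D`: at every point of `D` there
are real analytic coordinates in which `D = {x_i = 0}` and `F = x_i ^ m * G` with `G` real
analytic and not identically zero on `D` near the point. -/
def HasMultiplicityAlong (n : ℕ) {Y : Type*} [TopologicalSpace Y] [ChartedSpace (RealSpace n) Y]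
    (F : Y → ℂ) (D : Set Y) (m : ℕ) : Prop :=
  ∀ p ∈ D, ∃ χ ∈ analyticCharts n Y, p ∈ χ.source ∧ ∃ i : Fin n × Fin 2,
    (∀ q ∈ χ.source, q ∈ D ↔ χ q i = 0) ∧ ∃ G : Y → ℂ,
      ContMDiffOn 𝓘(ℝ, RealSpace n) 𝓘(ℝ, ℂ) ω G χ.source ∧
      (∀ q ∈ χ.source, F q = (χ q i : ℂ) ^ m * G q) ∧ ∃ᶠ q in 𝓝[D] p, G q ≠ 0

/-- The strict transform of `V = f⁻¹(0)`: the closure of `Φ⁻¹(V \ {0})`. -/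
def strictTransform (f : Cn n → ℂ) (Φ : Y → Cn n) : Set Y :=
  closure (Φ ⁻¹' ({z | f z = 0} \ {0}))

/-- `Φ : Y → ℂ^n` is a good resolution of real type, at the origin, of the germ `f`, with
exceptional divisors `E k`. -/
structure IsGoodResolutionOfRealType (f : Cn n → ℂ) (Φ : Y → Cn n) {ι : Type*} (E : ι → Set Y) :
    Prop where
  /-- the hypersurface `f = 0` has at most an isolated mixed singularity at the origin, and real
  codimension two elsewhere near the origin -/
  isolated : ∀ᶠ z in 𝓝[≠] (0 : Cn n), f z = 0 → Function.Surjective (fderiv ℝ f z)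
  /-- `Y` is a real analytic manifold (without boundary) of dimension `2n` -/
  isManifold : IsManifold 𝓘(ℝ, RealSpace n) ω Y
  t2 : T2Space Y
  secondCountable : SecondCountableTopology Y
  /-- `Φ` is proper and real analytic -/
  isProper : IsProperMap Φ
  isAnalytic : ContMDiff 𝓘(ℝ, RealSpace n) 𝓘(ℝ, Cn n) ω Φ
  /-- the `E k` are the finitely many irreducible components of `Φ⁻¹(0)` -/
  finite : Finite ι
  iUnion_eq : ⋃ k, E k = Φ ⁻¹' {0}
  irreducible : ∀ k, IsIrreducibleSubset n (E k)
  not_subset : ∀ k l, k ≠ l → ¬ E k ⊆ E l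
  /-- the `E k` are smooth of real codimension one -/
  smooth : ∀ k, ∀ p ∈ E k, IsSubmanifoldAt n (E k) 1 p
  /-- `Φ` is a real analytic diffeomorphism from `Y \ Φ⁻¹(0)` onto `ℂ^n \ {0}` -/
  diffeo : ∃ g : Cn n → Y, InvOn g Φ (Φ ⁻¹' {0})ᶜ {0}ᶜ ∧ MapsTo g {0}ᶜ (Φ ⁻¹' {0})ᶜ ∧
    ContMDiffOn 𝓘(ℝ, Cn n) 𝓘(ℝ, RealSpace n) ω g {0}ᶜ
  /-- the strict transform is smooth of real codimension two in a neighbourhood of `Φ⁻¹(0)` -/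
  strict_smooth : ∃ W : Set Y, IsOpen W ∧ Φ ⁻¹' {0} ⊆ W ∧
    ∀ p ∈ strictTransform f Φ ∩ W, IsSubmanifoldAt n (strictTransform f Φ) 2 p
  /-- normal form of `f ∘ Φ` at a point `p` of the strict transform that lies on exactly the
  divisors `E k`, `k ∈ I`, where `I` is non-empty: in real analytic coordinates centred at `p`,
  with pairwise distinct coordinates `x_{e k}` (`k ∈ I`), `x_a`, `x_b`, one has
  `f ∘ Φ = ∏ x_{e k} ^ m k * (x_a + i x_b)`, `E k = {x_{e k} = 0}`, and the strict transform is
  `{x_a + i x_b = 0}` -/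
  normal_form : ∀ p ∈ strictTransform f Φ, ∀ I : Finset ι, I.Nonempty → (∀ k, k ∈ I ↔ p ∈ E k) →
    ∃ χ ∈ analyticCharts n Y, p ∈ χ.source ∧ χ p = 0 ∧
      ∃ (m : I → ℕ) (e : I ⊕ Fin 2 → Fin n × Fin 2), Function.Injective e ∧
        (∀ q ∈ χ.source, f (Φ q) = (∏ k : I, (χ q (e (.inl k)) : ℂ) ^ m k) *
          ((χ q (e (.inr 0)) : ℂ) + Complex.I * (χ q (e (.inr 1)) : ℂ))) ∧
        (∀ q ∈ χ.source, ∀ k : I, q ∈ E k ↔ χ q (e (.inl k)) = 0) ∧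
        (∀ q ∈ χ.source, q ∈ strictTransform f Φ ↔
          (χ q (e (.inr 0)) : ℂ) + Complex.I * (χ q (e (.inr 1)) : ℂ) = 0)

end Manifold

/-! ## The real analytic charts of the normal real blowing-up -/

namespace RegularFan

variable {n : ℕ} (S : RegularFan n)

/-- The direction vector of the line in the two affine charts of the real blowing-up of `ℂ`:
`1 + i t` in the first chart, with coordinates `(x, t)`, and `s + i` in the second chart, with
coordinates `(s, y)`. -/
def direction (ε : Bool) (a : Fin 2 → ℝ) : ℂ := if ε then ⟨a 0, 1⟩ else ⟨1, a 1⟩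

/-- The real factor: `x` in the first chart and `y` in the second chart. -/
def factor (ε : Bool) (a : Fin 2 → ℝ) : ℝ := if ε then a 1 else a 0

theorem direction_ne_zero (ε : Bool) (a : Fin 2 → ℝ) : direction ε a ≠ 0 := by
  intro h
  cases ε
  · exact one_ne_zero (congrArg Complex.re h)
  · exact one_ne_zero (congrArg Complex.im h)

theorem factor_mem (ε : Bool) (a : Fin 2 → ℝ) :
    (factor ε a : ℂ) * direction ε a ∈
      (Projectivization.mk ℝ (direction ε a) (direction_ne_zero ε a)).submodule := by
  rw [Projectivization.submodule_mk, Submodule.mem_span_singleton]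
  exact ⟨factor ε a, by simp⟩

open Classical in
/-- The point of the blown-up chart `σ` with the real coordinates `x`. The coordinate `u_j` is
`x (j, 0) + i x (j, 1)` if `P_j` is not strictly positive; for strictly positive `P_j` the choice
`ε j` of an affine chart gives `u_j = x̃ (1 + i t)` or `u_j = ỹ (s + i)`, with the line
spanned by `1 + i t` or by `s + i`, where `(x (j, 0), x (j, 1))` is `(x̃, t)` or `(s, ỹ)`. -/
def blowupPoint (σ : S.Chart) (ε : Fin n → Bool) (x : RealSpace n) : σ.Blowup :=
  ⟨(fun j => if StrictlyPositive (σ.1 j) then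
        (factor (ε j) (fun k => x (j, k)) : ℂ) * direction (ε j) (fun k => x (j, k))
      else ⟨x (j, 0), x (j, 1)⟩,
    fun j => Projectivization.mk ℝ (direction (ε j) fun k => x (j, k))
      (direction_ne_zero _ _)),
    fun j => by simpa [j.2] using factor_mem (ε j) fun k => x (j, k)⟩

/-- The parametrization of an open part of `RX` by `ℝ^{2n}`. -/
def parametrization (σ : S.Chart) (ε : Fin n → Bool) (x : RealSpace n) : S.RealBlowup :=
  Quot.mk _ ⟨σ, S.blowupPoint σ ε x⟩

/-- The standard parametrizations of `RX` are the inverses of real analytic coordinate systems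
for the given manifold structure (as they cover `RX`, this determines the real analytic
structure). -/
def IsStandardStructure [ChartedSpace (RealSpace n) S.RealBlowup] : Prop :=
  ∀ (σ : S.Chart) (ε : Fin n → Bool), ∃ χ ∈ analyticCharts n S.RealBlowup,
    χ.target = univ ∧ ∀ x, χ.symm x = S.parametrization σ ε x

end RegularFan

end Mixed

end

/-!
Everything is computed in the charts of the blown-up toric variety. Let `σ` be a chart, let `u_j`
be its coordinates, and write `u_j = r_j w_j` with `r_j` real and `w_j` spanning the real line of
the blowing-up when `P_j` is strictly positive. For two charts the matrix `τ⁻¹σ` has a unit vector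
as its column at each vertex that both cones share, so that the coordinate changes are real
analytic on open sets, and distinct cones are separated by a linear form that is positive on the
vertices of `σ` and negative on those of `τ` which are not in common; the corresponding monomial
in the `|u_j|` makes the gluing relation closed. This gives a Hausdorff real analytic manifold.

Consider a point over the origin and let `J` be the set of the exceptional coordinates that vanish
there. If `c ν μ ≠ 0`, the pullback of `z^ν conj(z)^μ` is divisible by `∏ r_j ^ d(P_j; f)`,
`j ∈ J`. The quotient of `f ∘ Φ` by this product is a power series in the `r_j`, `w_j` and
`conj w_j` which converges near the point, because the weights `P_j`, `j ∈ J`, are strictly positive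
(`analyticAt_quotientSeries`). Let `K ⊇ J` be the set of all coordinates that vanish at the
point. As the open cone on the vertices `P_j`, `j ∈ K`, lies in one class of the dual Newton
diagram, the exponents on the face `Δ(∑ P_j)` are those of minimal weight for every `P_j`,
`j ∈ K`, at once (`mem_newtonFace_faceWeight_iff`). Hence the quotient restricted to the stratum
through the point is the face function of the weight `∑ P_j`, evaluated at a point of the torus that
is obtained from the remaining coordinates. This face function is homogeneous under the torus
directions which the stratum misses: radial scaling for `j ∈ J`, and, as `f` is convenient, all
complex scalings for `j ∈ K \ J`. These directions do not contribute to its derivative at a zero,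
so that non-degeneracy makes the derivative of the quotient onto along the stratum
(`surjective_fderiv_quotientSeries`). The real and imaginary parts of the quotient can therefore
be taken as two coordinates next to the `r_j`, `j ∈ J` (`exists_adapted_chart`). This is the normal
form; the smoothness of the strict transform, the regularity of `f` outside the origin and the
multiplicities follow from it or in the same way.

Outside the exceptional divisors the only vertices whose coordinates can vanish are the `E_i`, and
there the monomial map of a chart that contains the `E_i` with `z_i = 0` is inverted by the monomial
map of the inverse matrix. Properness holds because the points over the torus are dense, and those
over a polydisc have bounded coordinates in the chart whose cone contains
`(log R - log |z_i|)_i`. An exceptional divisor is connected, as its part in each chart is the image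
of a linear subspace under polar coordinates and all charts share a distinguished point of it; by
the identity theorem a connected smooth hypersurface is irreducible.
-/

noncomputable section

namespace Mixed

namespace RegularFan

variable {n : ℕ} {S : RegularFan n}

/-! ### Linear algebra of the cones of a regular fan -/

theorem Chart.injective (σ : S.Chart) : Function.Injective σ.1 := σ.2.1

theorem Chart.exists_basis (σ : S.Chart) :
    ∃ b : Module.Basis (Fin n) ℤ (Fin n → ℤ), ∀ j, b j = fun i => (σ.1 j i : ℤ) := by
  obtain ⟨b, hb⟩ := S.regular _ σ.2.2
  have h : ∀ j, ∃ k, b k = fun i => (σ.1 j i : ℤ) := fun j =>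
    hb _ (Finset.mem_image_of_mem _ (Finset.mem_univ j))
  choose π hπ using h
  have hinj : Function.Injective π := by
    intro j k hjk
    apply σ.injective
    funext i
    have := congrFun ((hπ j).symm.trans ((congrArg b hjk).trans (hπ k))) i
    exact_mod_cast this
  have hbij : Function.Bijective π := Finite.injective_iff_bijective.1 hinj
  exact ⟨b.reindex (Equiv.ofBijective π hbij).symm, fun j => by simp [hπ]⟩

theorem Chart.isUnit_det (σ : S.Chart) : IsUnit σ.mat.det := by
  obtain ⟨b, hb⟩ := σ.exists_basis
  have h : σ.mat = (Pi.basisFun ℤ (Fin n)).toMatrix b := by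
    ext i j
    simp [Chart.mat, Module.Basis.toMatrix_apply, hb]
  rw [h, ← Module.Basis.det_apply]
  exact Module.Basis.isUnit_det _ b

/-- The exponent matrix `τ⁻¹σ` of the coordinate change from the chart `σ` to the chart `τ`. -/
def transition (σ τ : S.Chart) : Matrix (Fin n) (Fin n) ℤ := τ.mat⁻¹ * σ.mat

theorem mat_mul_transition (σ τ : S.Chart) : τ.mat * transition σ τ = σ.mat := by
  rw [transition, Matrix.mul_nonsing_inv_cancel_left _ _ τ.isUnit_det]

theorem eq_transition {σ τ : S.Chart} {B : Matrix (Fin n) (Fin n) ℤ} (h : τ.mat * B = σ.mat) :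
    B = transition σ τ := by
  rw [transition, ← h, Matrix.nonsing_inv_mul_cancel_left _ _ τ.isUnit_det]

theorem transition_self (σ : S.Chart) : transition σ σ = 1 :=
  (eq_transition (by simp)).symm

theorem transition_mul (σ τ ρ : S.Chart) :
    transition τ ρ * transition σ τ = transition σ ρ :=
  eq_transition (by rw [← Matrix.mul_assoc, mat_mul_transition, mat_mul_transition])

/-- If the cones `σ` and `τ` share a vertex, the corresponding column of `τ⁻¹σ` is a standard
basis vector. -/
theorem transition_apply_of_eq {σ τ : S.Chart} {j k : Fin n} (h : σ.1 j = τ.1 k) (i : Fin n) :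
    transition σ τ i j = if i = k then 1 else 0 := by
  have h1 : (transition σ τ).col j = (1 : Matrix (Fin n) (Fin n) ℤ).col k := by
    have h2 : τ.mat.mulVec ((transition σ τ).col j) =
        τ.mat.mulVec ((1 : Matrix (Fin n) (Fin n) ℤ).col k) := by
      funext i
      have h3 := congrFun (congrFun (mat_mul_transition σ τ) i) j
      have h4 := congrFun (congrFun (Matrix.mul_one τ.mat) i) k
      rw [Matrix.mul_apply] at h3 h4
      simp only [Matrix.mulVec, dotProduct, Matrix.col_apply]
      rw [h3, h4]
      simp [Chart.mat, h]
    have hinj : Function.Injective τ.mat.mulVec :=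
      Matrix.mulVec_injective_of_isUnit ((Matrix.isUnit_iff_isUnit_det _).2 τ.isUnit_det)
    exact hinj h2
  have := congrFun h1 i
  simpa [Matrix.col_apply, Matrix.one_apply] using this

theorem Chart.linearIndependent (σ : S.Chart) :
    LinearIndependent ℝ (fun j => realWeight (σ.1 j)) := by
  have h : IsUnit (σ.mat.map (Int.castRingHom ℝ)) := by
    rw [Matrix.isUnit_iff_isUnit_det, ← RingHom.mapMatrix_apply, ← RingHom.map_det]
    exact σ.isUnit_det.map _
  have := Matrix.linearIndependent_cols_iff_isUnit.2 h
  have h2 : (fun j => realWeight (σ.1 j)) = (σ.mat.map (Int.castRingHom ℝ)).col := by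
    funext j i
    simp [Matrix.col, realWeight, Chart.mat]
  rw [h2]
  exact this

theorem Chart.coeff_unique (σ : S.Chart) {a b : Fin n → ℝ}
    (h : ∑ j, a j • realWeight (σ.1 j) = ∑ j, b j • realWeight (σ.1 j)) : a = b := by
  have := Fintype.linearIndependent_iff.1 σ.linearIndependent (fun j => a j - b j)
    (by simp [sub_smul, Finset.sum_sub_distrib, h])
  exact funext fun j => sub_eq_zero.1 (this j)

/-- The real coordinates with respect to the vertices of a chart. -/
def Chart.basis (σ : S.Chart) : Module.Basis (Fin n) ℝ (Fin n → ℝ) :=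
  basisOfLinearIndependentOfCardEqFinrank' _ σ.linearIndependent (by simp)

theorem Chart.basis_apply (σ : S.Chart) (j : Fin n) : σ.basis j = realWeight (σ.1 j) := by
  simp [Chart.basis]

/-- The finite set of vertices of the cone of a chart. -/
abbrev Chart.verts (σ : S.Chart) : Finset (Fin n → ℕ) := Finset.univ.image σ.1

theorem Chart.mem_verts (σ : S.Chart) (j : Fin n) : σ.1 j ∈ σ.verts :=
  Finset.mem_image_of_mem _ (Finset.mem_univ j)

theorem Chart.mem_cone_iff (σ : S.Chart) {s : Finset (Fin n → ℕ)} (hs : s ⊆ σ.verts)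
    {x : Fin n → ℝ} : x ∈ cone s ↔
      ∃ t : Fin n → ℝ, (∀ j, 0 ≤ t j) ∧ (∀ j, σ.1 j ∉ s → t j = 0) ∧
        x = ∑ j, t j • realWeight (σ.1 j) := by
  classical
  constructor
  · rintro ⟨t, ht, rfl⟩
    refine ⟨fun j => if σ.1 j ∈ s then t (σ.1 j) else 0, ?_, ?_, ?_⟩
    · intro j
      dsimp only
      split_ifs with h
      exacts [ht _ h, le_rfl]
    · intro j hj
      simp [hj]
    · have h1 : ∑ P ∈ s, t P • realWeight P =
          ∑ P ∈ σ.verts, if P ∈ s then t P • realWeight P else 0 := by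
        rw [← Finset.sum_filter, Finset.filter_mem_eq_inter, Finset.inter_eq_right.2 hs]
      rw [h1, Finset.sum_image fun a _ b _ h => σ.injective h]
      refine Finset.sum_congr rfl fun j _ => ?_
      by_cases h : σ.1 j ∈ s <;> simp only [h, if_true, if_false, zero_smul]
  · rintro ⟨t, ht, h0, rfl⟩
    have hl : ∀ j, Function.extend σ.1 t 0 (σ.1 j) = t j := fun j => σ.injective.extend_apply _ _ _
    refine ⟨Function.extend σ.1 t 0, ?_, ?_⟩
    · intro P hP
      obtain ⟨j, -, rfl⟩ := Finset.mem_image.1 (hs hP)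
      rw [hl]
      exact ht j
    · have h1 : ∑ P ∈ s, Function.extend σ.1 t 0 P • realWeight P =
          ∑ P ∈ σ.verts, Function.extend σ.1 t 0 P • realWeight P := by
        refine Finset.sum_subset hs fun P hP hPs => ?_
        obtain ⟨j, -, rfl⟩ := Finset.mem_image.1 hP
        rw [hl, h0 j hPs, zero_smul]
      rw [h1, Finset.sum_image fun a _ b _ h => σ.injective h]
      exact Finset.sum_congr rfl fun j _ => by rw [hl]

/-- The fan axiom in coordinates: a common point of two cones is a non-negative combination of
the common vertices. -/
theorem Chart.coeff_eq_zero_of_mem {σ τ : S.Chart} {a b : Fin n → ℝ} (ha : ∀ j, 0 ≤ a j)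
    (hb : ∀ j, 0 ≤ b j)
    (h : ∑ j, a j • realWeight (σ.1 j) = ∑ j, b j • realWeight (τ.1 j)) {j : Fin n}
    (hj : σ.1 j ∉ τ.verts) : a j = 0 := by
  have h1 : ∑ j, a j • realWeight (σ.1 j) ∈ cone σ.verts :=
    (σ.mem_cone_iff subset_rfl).2 ⟨a, ha, fun j hj => absurd (σ.mem_verts j) hj, rfl⟩
  have h2 : ∑ j, a j • realWeight (σ.1 j) ∈ cone τ.verts :=
    (τ.mem_cone_iff subset_rfl).2 ⟨b, hb, fun j hj => absurd (τ.mem_verts j) hj, h⟩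
  have h3 : ∑ j, a j • realWeight (σ.1 j) ∈ cone (σ.verts ∩ τ.verts) := by
    have := S.inter_eq _ σ.2.2 _ τ.2.2
    exact this ▸ ⟨h1, h2⟩
  obtain ⟨t, -, h0, ht⟩ := (σ.mem_cone_iff Finset.inter_subset_left).1 h3
  rw [σ.coeff_unique ht]
  exact h0 j fun hh => hj (Finset.mem_inter.1 hh).2

theorem realWeight_eq_sum_transition (σ τ : S.Chart) (j : Fin n) :
    realWeight (σ.1 j) = ∑ k, (transition σ τ k j : ℝ) • realWeight (τ.1 k) := by
  funext i
  have h := congrFun (congrFun (mat_mul_transition σ τ) i) j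
  rw [Matrix.mul_apply] at h
  have h' : ((∑ k, τ.mat i k * transition σ τ k j : ℤ) : ℝ) = (σ.mat i j : ℝ) := by rw [h]
  push_cast at h'
  simp only [Finset.sum_apply, Pi.smul_apply, smul_eq_mul]
  simp only [Chart.mat, Matrix.of_apply, Int.cast_natCast] at h'
  rw [realWeight, ← h']
  exact Finset.sum_congr rfl fun k _ => by rw [realWeight, mul_comm]

/-- The coordinate change `ψ_B`, `B = τ⁻¹σ`, is defined where `u_j = 0` only if `σ_j` is a vertex
of `τ`. -/
theorem mem_verts_of_transition_nonneg {σ τ : S.Chart} {j : Fin n}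
    (h : ∀ k, 0 ≤ transition σ τ k j) : σ.1 j ∈ τ.verts := by
  classical
  by_contra hj
  have h1 := Chart.coeff_eq_zero_of_mem (σ := σ) (τ := τ) (a := fun i => if i = j then 1 else 0)
    (b := fun k => (transition σ τ k j : ℝ)) (fun i => by split_ifs <;> norm_num)
    (fun k => by exact_mod_cast h k)
    (by rw [← realWeight_eq_sum_transition]; simp) hj
  simp at h1

theorem transition_nonneg_of_mem_verts {σ τ : S.Chart} {j : Fin n} (h : σ.1 j ∈ τ.verts)
    (k : Fin n) : 0 ≤ transition σ τ k j := by
  obtain ⟨l, -, hl⟩ := Finset.mem_image.1 h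
  rw [transition_apply_of_eq hl.symm]
  split_ifs <;> norm_num

/-- Two cones of a fan are separated by a linear form that vanishes exactly on the common face. -/
theorem exists_separating (σ τ : S.Chart) : ∃ m : StrongDual ℝ (Fin n → ℝ),
    (∀ j, σ.1 j ∈ τ.verts → m (realWeight (σ.1 j)) = 0) ∧
    (∀ j, σ.1 j ∉ τ.verts → 0 < m (realWeight (σ.1 j))) ∧
    (∀ k, τ.1 k ∉ σ.verts → m (realWeight (τ.1 k)) < 0) := by
  classical
  -- Hahn-Banach for the convex hull of the vertices `σ_j` and `-τ_k` that are not in common, and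
  -- the subspace `W` spanned by the common vertices
  set W : Submodule ℝ (Fin n → ℝ) :=
    { carrier := {x | ∀ j, σ.1 j ∉ τ.verts → σ.basis.repr x j = 0}
      add_mem' := fun {x y} hx hy j hj => by simp [hx j hj, hy j hj]
      zero_mem' := by simp
      smul_mem' := fun c x hx j hj => by simp [hx j hj] } with hW
  set A : Finset (Fin n → ℝ) :=
    ((Finset.univ.filter fun j => σ.1 j ∉ τ.verts).image fun j => realWeight (σ.1 j)) ∪
    ((Finset.univ.filter fun k => τ.1 k ∉ σ.verts).image fun k => -realWeight (τ.1 k)) with hA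
  have hdisj : Disjoint (convexHull ℝ (A : Set (Fin n → ℝ))) (W : Set (Fin n → ℝ)) := by
    rw [Set.disjoint_left]
    intro x hxA hxW
    -- a point of the hull is `∑ a_j σ_j - ∑ b_k τ_k`, summed over the vertices not in common
    have key : ∃ a b : Fin n → ℝ, (∀ j, 0 ≤ a j) ∧ (∀ j, 0 ≤ b j) ∧
        (∀ j, σ.1 j ∈ τ.verts → a j = 0) ∧ (∀ k, τ.1 k ∈ σ.verts → b k = 0) ∧
        ∑ j, a j + ∑ k, b k = 1 ∧
        x = ∑ j, a j • realWeight (σ.1 j) - ∑ k, b k • realWeight (τ.1 k) := by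
      have hconv : Convex ℝ {x : Fin n → ℝ | ∃ a b : Fin n → ℝ, (∀ j, 0 ≤ a j) ∧ (∀ j, 0 ≤ b j) ∧
        (∀ j, σ.1 j ∈ τ.verts → a j = 0) ∧ (∀ k, τ.1 k ∈ σ.verts → b k = 0) ∧
        ∑ j, a j + ∑ k, b k = 1 ∧
        x = ∑ j, a j • realWeight (σ.1 j) - ∑ k, b k • realWeight (τ.1 k)} := by
        rintro x ⟨a, b, ha, hb, ha0, hb0, h1, rfl⟩ y ⟨a', b', ha', hb', ha0', hb0', h1', rfl⟩
          p q hp hq hpq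
        refine ⟨fun j => p * a j + q * a' j, fun j => p * b j + q * b' j, fun j => ?_, fun j => ?_,
          fun j hj => ?_, fun j hj => ?_, ?_, ?_⟩
        · have := ha j; have := ha' j; positivity
        · have := hb j; have := hb' j; positivity
        · simp [ha0 j hj, ha0' j hj]
        · simp [hb0 j hj, hb0' j hj]
        · simp only [Finset.sum_add_distrib, ← Finset.mul_sum]
          linear_combination p * h1 + q * h1' + hpq
        · simp only [add_smul, mul_smul, Finset.sum_add_distrib, ← Finset.smul_sum, smul_sub]
          abel
      refine convexHull_min ?_ hconv hxA
      intro y hy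
      rw [hA, Finset.coe_union, Set.mem_union] at hy
      rcases hy with hy | hy
      · obtain ⟨j, hj, rfl⟩ := Finset.mem_image.1 hy
        refine ⟨Pi.single j 1, 0, fun i => ?_, fun i => le_rfl, fun i hi => ?_, fun _ _ => rfl,
          ?_, ?_⟩
        · by_cases h : i = j
          · subst h; simp
          · simp [h]
        · have : i ≠ j := fun h => (Finset.mem_filter.1 hj).2 (h ▸ hi)
          simp [this]
        · simp
        · simp [Pi.single_apply]
      · obtain ⟨j, hj, rfl⟩ := Finset.mem_image.1 hy
        refine ⟨0, Pi.single j 1, fun i => le_rfl, fun i => ?_, fun _ _ => rfl, fun i hi => ?_,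
          ?_, ?_⟩
        · by_cases h : i = j
          · subst h; simp
          · simp [h]
        · have : i ≠ j := fun h => (Finset.mem_filter.1 hj).2 (h ▸ hi)
          simp [this]
        · simp
        · simp [Pi.single_apply]
    obtain ⟨a, b, ha, hb, ha0, hb0, hab, hx⟩ := key
    obtain ⟨w, hw0, hxw⟩ : ∃ w : Fin n → ℝ, (∀ j, σ.1 j ∉ τ.verts → w j = 0) ∧
        x = ∑ j, w j • realWeight (σ.1 j) :=
      ⟨fun j => σ.basis.repr x j, fun j hj => hxW j hj, by
        conv_lhs => rw [← σ.basis.sum_repr x]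
        exact Finset.sum_congr rfl fun j _ => by rw [σ.basis_apply]⟩
    set w' : Fin n → ℝ := fun k => ∑ j, if σ.1 j = τ.1 k then max (w j) 0 else 0 with hw'
    have hw'0 : ∀ k, 0 ≤ w' k := fun k => Finset.sum_nonneg fun j _ => by
      split_ifs
      exacts [le_max_right _ _, le_rfl]
    have hww' : ∑ k, w' k • realWeight (τ.1 k) = ∑ j, max (w j) 0 • realWeight (σ.1 j) := by
      simp only [hw', Finset.sum_smul]
      rw [Finset.sum_comm]
      refine Finset.sum_congr rfl fun j _ => ?_
      by_cases hj : σ.1 j ∈ τ.verts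
      · obtain ⟨k, -, hk⟩ := Finset.mem_image.1 hj
        rw [Finset.sum_eq_single k]
        · rw [if_pos hk.symm, hk]
        · intro l _ hl
          rw [if_neg fun h => hl (τ.injective (h.symm.trans hk.symm)), zero_smul]
        · simp
      · rw [hw0 j hj]
        simp
    have heq : ∑ j, (a j + max (-w j) 0) • realWeight (σ.1 j) =
        ∑ k, (b k + w' k) • realWeight (τ.1 k) := by
      have h1 : ∑ j, w j • realWeight (σ.1 j) = ∑ j, max (w j) 0 • realWeight (σ.1 j) -
          ∑ j, max (-w j) 0 • realWeight (σ.1 j) := by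
        rw [← Finset.sum_sub_distrib]
        refine Finset.sum_congr rfl fun j _ => ?_
        rw [← sub_smul]
        congr 1
        rcases le_total (w j) 0 with h | h
        · rw [max_eq_right h, max_eq_left (by linarith)]; ring
        · rw [max_eq_left h, max_eq_right (by linarith)]; ring
      have h2 := hx.symm.trans (hxw.trans h1)
      simp only [add_smul, Finset.sum_add_distrib, hww']
      rw [sub_eq_sub_iff_add_eq_add] at h2
      rw [h2, add_comm]
    have hpa : ∀ j, 0 ≤ a j + max (-w j) 0 := fun j => add_nonneg (ha j) (le_max_right _ _)
    have hpb : ∀ k, 0 ≤ b k + w' k := fun k => add_nonneg (hb k) (hw'0 k)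
    have ha' : ∀ j, a j = 0 := fun j => by
      by_cases hj : σ.1 j ∈ τ.verts
      · exact ha0 j hj
      · have := Chart.coeff_eq_zero_of_mem hpa hpb heq hj
        have h2 := ha j
        have h3 := le_max_right (-w j) 0
        linarith
    have hb' : ∀ k, b k = 0 := fun k => by
      by_cases hk : τ.1 k ∈ σ.verts
      · exact hb0 k hk
      · have := Chart.coeff_eq_zero_of_mem hpb hpa heq.symm hk
        have h2 := hb k
        have h3 := hw'0 k
        linarith
    simp [ha', hb'] at hab
  obtain ⟨m, u, v, hmu, huv, hmv⟩ := geometric_hahn_banach_compact_closed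
    (convex_convexHull ℝ _) (A.finite_toSet.isCompact_convexHull ℝ) W.convex
    W.closed_of_finiteDimensional hdisj
  have hv : v < 0 := by simpa using hmv 0 W.zero_mem
  -- a linear form that is bounded below on a subspace vanishes there
  have hW0 : ∀ x ∈ W, m x = 0 := by
    intro x hx
    by_contra h0
    have := hmv ((v / m x) • x) (W.smul_mem _ hx)
    rw [map_smul, smul_eq_mul, div_mul_cancel₀ _ h0] at this
    exact lt_irrefl _ this
  refine ⟨-m, fun j hj => ?_, fun j hj => ?_, fun k hk => ?_⟩
  · have : m (realWeight (σ.1 j)) = 0 := by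
      refine hW0 _ fun i hi => ?_
      have hij : j ≠ i := fun h => hi (h ▸ hj)
      rw [← σ.basis_apply, Module.Basis.repr_self, Finsupp.single_eq_of_ne' hij]
    simp [this]
  · have h1 := hmu (realWeight (σ.1 j)) (subset_convexHull ℝ _ (by
      rw [hA, Finset.coe_union]
      exact Or.inl (Finset.mem_image_of_mem _ (Finset.mem_filter.2 ⟨Finset.mem_univ _, hj⟩))))
    change 0 < -m _
    linarith
  · have h1 := hmu (-realWeight (τ.1 k)) (subset_convexHull ℝ _ (by
      rw [hA, Finset.coe_union]
      exact Or.inr (Finset.mem_image_of_mem _ (Finset.mem_filter.2 ⟨Finset.mem_univ _, hk⟩))))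
    rw [map_neg] at h1
    change -m _ < 0
    linarith

/-! ### The full-dimensional cones -/

theorem cone_subset_span (s : Finset (Fin n → ℕ)) :
    cone s ⊆ (Submodule.span ℝ (s.image realWeight : Set (Fin n → ℝ)) : Set (Fin n → ℝ)) := by
  classical
  rintro x ⟨t, -, rfl⟩
  refine Submodule.sum_mem _ fun P hP => Submodule.smul_mem _ _ (Submodule.subset_span ?_)
  simpa using ⟨P, hP, rfl⟩

theorem card_le_of_mem_cones {s : Finset (Fin n → ℕ)} (hs : s ∈ S.cones) : s.card ≤ n := by
  obtain ⟨b, hb⟩ := S.regular s hs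
  choose f hf using hb
  have hinj : Function.Injective fun P : s => f P.1 P.2 := by
    intro P Q h
    apply Subtype.ext
    funext i
    have := congrFun ((hf P.1 P.2).symm.trans ((congrArg b h).trans (hf Q.1 Q.2))) i
    exact_mod_cast this
  simpa using Fintype.card_le_of_injective _ hinj

theorem Chart.isClosed_cone (σ : S.Chart) : IsClosed (cone σ.verts) := by
  have : cone σ.verts = ⋂ j, {x | 0 ≤ σ.basis.repr x j} := by
    ext x
    rw [σ.mem_cone_iff subset_rfl]
    simp only [Set.mem_iInter, Set.mem_ofPred_eq]
    constructor
    · rintro ⟨t, ht, -, rfl⟩ j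
      simp only [← σ.basis_apply, σ.basis.repr_sum_self]
      exact ht j
    · intro h
      refine ⟨_, h, fun j hj => absurd (σ.mem_verts j) hj, ?_⟩
      conv_lhs => rw [← σ.basis.sum_repr x]
      exact Finset.sum_congr rfl fun j _ => by rw [σ.basis_apply]
  rw [this]
  refine isClosed_iInter fun j => isClosed_le continuous_const ?_
  exact (σ.basis.coord j).continuous_of_finiteDimensional

theorem finite_chart (S : RegularFan n) : Finite S.Chart := by
  classical
  have h : (S.cones.biUnion id : Set (Fin n → ℕ)).Finite := Finset.finite_toSet _
  have : Finite (Fin n → (S.cones.biUnion id : Set (Fin n → ℕ))) := by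
    have := h.to_subtype
    infer_instance
  refine Finite.of_injective (β := Fin n → (S.cones.biUnion id : Set (Fin n → ℕ)))
    (fun σ j => ⟨σ.1 j, ?_⟩) ?_
  · simp only [Finset.coe_biUnion, Set.mem_iUnion]
    exact ⟨_, σ.2.2, Finset.mem_coe.2 (σ.mem_verts j)⟩
  · intro σ τ h
    apply Subtype.ext
    funext j
    exact congrArg Subtype.val (congrFun h j)

theorem exists_chart_verts_eq {s : Finset (Fin n → ℕ)} (hs : s ∈ S.cones) (hc : s.card = n) :
    ∃ σ : S.Chart, σ.verts = s := by
  have e : Fin n ≃ s := (finCongr hc.symm).trans s.equivFin.symm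
  have h : Finset.univ.image (fun j => (e j).1) = s := by
    ext P
    simp only [Finset.mem_image, Finset.mem_univ, true_and]
    constructor
    · rintro ⟨j, rfl⟩
      exact (e j).2
    · intro hP
      exact ⟨e.symm ⟨P, hP⟩, by simp⟩
  refine ⟨⟨fun j => (e j).1, fun i j hij => e.injective (Subtype.ext hij), ?_⟩, h⟩
  rw [h]
  exact hs

/-- The full-dimensional cones already cover: the other ones lie in finitely many proper
subspaces. -/
theorem exists_chart_mem_cone (S : RegularFan n) {x : Fin n → ℝ} (hx : ∀ i, 0 ≤ x i) :
    ∃ σ : S.Chart, x ∈ cone σ.verts := by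
  classical
  have hfin := S.finite_chart
  set C : Set (Fin n → ℝ) := ⋃ σ : S.Chart, cone σ.verts with hC
  have hclosed : IsClosed C := isClosed_iUnion_of_finite fun σ => σ.isClosed_cone
  set low := S.cones.filter fun s => s.card < n
  have hae : ∀ᵐ y : Fin n → ℝ, ∀ s ∈ low, y ∉ cone s := by
    rw [Filter.eventually_all_finset]
    intro s hs
    have hne : Submodule.span ℝ (s.image realWeight : Set (Fin n → ℝ)) ≠ ⊤ := by
      intro h
      have h1 := finrank_span_finset_le_card (R := ℝ) (s.image realWeight)
      unfold Set.finrank at h1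
      rw [h, finrank_top, Module.finrank_fin_fun] at h1
      have h2 : (s.image realWeight).card ≤ s.card := Finset.card_image_le
      have h3 := (Finset.mem_filter.1 hs).2
      omega
    have h0 := MeasureTheory.Measure.addHaar_submodule MeasureTheory.volume _ hne
    exact MeasureTheory.measure_mono_null (by
      intro y hy
      simp only [Set.mem_compl_iff, Set.mem_ofPred_eq, not_not] at hy
      exact cone_subset_span s hy) h0
  have hdense := MeasureTheory.Measure.dense_of_ae hae
  have hsub : {y : Fin n → ℝ | ∀ i, 0 < y i} ⊆ C := by
    have hopen : IsOpen {y : Fin n → ℝ | ∀ i, 0 < y i} := by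
      simp only [Set.ofPred_forall]
      exact isOpen_iInter_of_finite fun i => isOpen_lt continuous_const (continuous_apply i)
    refine (hdense.open_subset_closure_inter hopen).trans (closure_minimal ?_ hclosed)
    rintro y ⟨hy, hy'⟩
    obtain ⟨s, hs, hys⟩ := S.cover y fun i => (hy i).le
    have hcard : s.card = n := by
      refine le_antisymm (card_le_of_mem_cones hs) (not_lt.1 fun h => ?_)
      exact hy' s (Finset.mem_filter.2 ⟨hs, h⟩) hys
    obtain ⟨σ, rfl⟩ := exists_chart_verts_eq hs hcard
    exact Set.mem_iUnion.2 ⟨σ, hys⟩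
  have hxC : x ∈ C := by
    have ht : Tendsto (fun ε : ℝ => fun i => x i + ε) (𝓝[>] 0) (𝓝 x) := by
      have : Tendsto (fun ε : ℝ => fun i => x i + ε) (𝓝 0) (𝓝 fun i => x i + 0) :=
        Continuous.tendsto (by fun_prop) 0
      simp only [add_zero] at this
      exact this.mono_left nhdsWithin_le_nhds
    refine hclosed.mem_of_tendsto ht ?_
    filter_upwards [self_mem_nhdsWithin] with ε hε
    exact hsub fun i => add_pos_of_nonneg_of_pos (hx i) hε
  exact Set.mem_iUnion.1 hxC

/-- Every non-zero vertex of the fan is a vertex of a full-dimensional cone. -/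
theorem exists_chart_of_mem_vertices {P : Fin n → ℕ} (hP : P ∈ S.vertices) (h0 : P ≠ 0) :
    ∃ (σ : S.Chart) (j : Fin n), σ.1 j = P := by
  obtain ⟨σ, hσ⟩ := S.exists_chart_mem_cone (x := realWeight P) fun i => Nat.cast_nonneg _
  have h1 : realWeight P ∈ cone {P} := ⟨fun _ => 1, fun _ _ => zero_le_one, by simp⟩
  have h2 : realWeight P ∈ cone ({P} ∩ σ.verts) := by
    rw [← S.inter_eq _ hP _ σ.2.2]
    exact ⟨h1, hσ⟩
  by_cases h : P ∈ σ.verts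
  · obtain ⟨j, -, hj⟩ := Finset.mem_image.1 h
    exact ⟨σ, j, hj⟩
  · exfalso
    rw [Finset.singleton_inter_of_notMem h] at h2
    obtain ⟨t, -, ht⟩ := h2
    apply h0
    funext i
    have := congrFun ht i
    simpa [realWeight] using this

/-! ### Monomial maps and the gluing relation -/

theorem monomialMap_mul (A B : Matrix (Fin n) (Fin n) ℤ) (u : Cn n)
    (h : ∀ j, u j = 0 → ∀ i k, 0 ≤ B k j * A i k) :
    monomialMap (A * B) u = monomialMap A (monomialMap B u) := by
  funext i
  calc monomialMap (A * B) u i = ∏ j, ∏ k, u j ^ (B k j * A i k) := by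
        refine Finset.prod_congr rfl fun j _ => ?_
        rw [← zpow_sum_of_ne_or_nonneg _ _ _ fun h0 k => h j h0 i k, Matrix.mul_apply]
        exact congrArg _ (Finset.sum_congr rfl fun k _ => mul_comm _ _)
    _ = ∏ k, ∏ j, u j ^ (B k j * A i k) := Finset.prod_comm
    _ = ∏ k, (∏ j, u j ^ B k j) ^ A i k := by
        refine Finset.prod_congr rfl fun k _ => ?_
        rw [← Finset.prod_zpow]
        exact Finset.prod_congr rfl fun j _ => zpow_mul _ _ _

theorem monomialMap_one (u : Cn n) : monomialMap 1 u = u := by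
  funext i
  unfold monomialMap
  rw [Finset.prod_eq_single i]
  · simp
  · intro j _ hj
    rw [Matrix.one_apply_ne hj.symm, zpow_zero]
  · simp

theorem wellDefinedAt_transition_iff {σ τ : S.Chart} {u : Cn n} :
    WellDefinedAt (transition σ τ) u ↔ ∀ j, u j = 0 → σ.1 j ∈ τ.verts :=
  ⟨fun h j hj => mem_verts_of_transition_nonneg fun k => h k j hj,
    fun h k j hj => transition_nonneg_of_mem_verts (h j hj) k⟩

theorem monomialMap_transition_eq_zero_iff {σ τ : S.Chart} {u : Cn n}
    (h : ∀ j, u j = 0 → σ.1 j ∈ τ.verts) {k : Fin n} :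
    monomialMap (transition σ τ) u k = 0 ↔ ∃ j, σ.1 j = τ.1 k ∧ u j = 0 := by
  unfold monomialMap
  rw [Finset.prod_eq_zero_iff]
  constructor
  · rintro ⟨j, -, hj⟩
    have hu : u j = 0 := by
      by_contra h0
      exact zpow_ne_zero _ h0 hj
    obtain ⟨l, -, hl⟩ := Finset.mem_image.1 (h j hu)
    rw [transition_apply_of_eq hl.symm] at hj
    by_cases hkl : k = l
    · exact ⟨j, by rw [hkl, hl], hu⟩
    · simp [hkl] at hj
  · rintro ⟨j, hj, hu⟩
    exact ⟨j, Finset.mem_univ _, by simp [transition_apply_of_eq hj, hu]⟩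

/-- The cofactor `v_k / u_j` of the coordinate change along a divisor that both charts see. -/
def cofactor (σ τ : S.Chart) (j k : Fin n) (u : Cn n) : ℂ :=
  ∏ i ∈ Finset.univ.erase j, u i ^ transition σ τ k i

theorem monomialMap_eq_mul_cofactor {σ τ : S.Chart} {j k : Fin n} (h : σ.1 j = τ.1 k) (u : Cn n) :
    monomialMap (transition σ τ) u k = u j * cofactor σ τ j k u := by
  unfold monomialMap cofactor
  rw [← Finset.mul_prod_erase _ _ (Finset.mem_univ j), transition_apply_of_eq h, if_pos rfl,
    zpow_one]

theorem monomialMap_of_ne {σ τ : S.Chart} {j k m : Fin n} (h : σ.1 j = τ.1 k) (hm : m ≠ k)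
    (u : Cn n) :
    monomialMap (transition σ τ) u m = ∏ i ∈ Finset.univ.erase j, u i ^ transition σ τ m i := by
  unfold monomialMap
  rw [← Finset.mul_prod_erase _ _ (Finset.mem_univ j), transition_apply_of_eq h, if_neg hm,
    zpow_zero, one_mul]

theorem cofactor_exponent_eq_zero {σ τ : S.Chart} {j k i : Fin n} (h : σ.1 j = τ.1 k)
    (hi : i ≠ j) (hτ : σ.1 i ∈ τ.verts) : transition σ τ k i = 0 := by
  obtain ⟨l, -, hl⟩ := Finset.mem_image.1 hτ
  rw [transition_apply_of_eq hl.symm, if_neg]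
  rintro rfl
  exact hi (σ.injective (hl.symm.trans h.symm))

theorem cofactor_ne_zero {σ τ : S.Chart} {j k : Fin n} (h : σ.1 j = τ.1 k) {u : Cn n}
    (hu : ∀ j, u j = 0 → σ.1 j ∈ τ.verts) : cofactor σ τ j k u ≠ 0 := by
  unfold cofactor
  rw [Finset.prod_ne_zero_iff]
  intro i hi
  by_cases h0 : u i = 0
  · rw [cofactor_exponent_eq_zero h (Finset.ne_of_mem_erase hi) (hu i h0), zpow_zero]
    exact one_ne_zero
  · exact zpow_ne_zero _ h0

theorem transition_comp_nonneg {σ τ : S.Chart} (ρ : S.Chart) {u : Cn n}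
    (hu : ∀ j, u j = 0 → σ.1 j ∈ τ.verts)
    (hv : ∀ k, monomialMap (transition σ τ) u k = 0 → τ.1 k ∈ ρ.verts) :
    ∀ j, u j = 0 → ∀ i k, 0 ≤ transition σ τ k j * transition τ ρ i k := by
  intro j hj i k
  obtain ⟨l, -, hl⟩ := Finset.mem_image.1 (hu j hj)
  rw [transition_apply_of_eq hl.symm]
  split_ifs with hkl
  · subst hkl
    rw [one_mul]
    exact transition_nonneg_of_mem_verts
      (hv k ((monomialMap_transition_eq_zero_iff hu).2 ⟨j, hl.symm, hj⟩)) i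
  · simp

theorem monomialMap_transition_comp {σ τ ρ : S.Chart} {u : Cn n}
    (hu : ∀ j, u j = 0 → σ.1 j ∈ τ.verts)
    (hv : ∀ k, monomialMap (transition σ τ) u k = 0 → τ.1 k ∈ ρ.verts) :
    monomialMap (transition τ ρ) (monomialMap (transition σ τ) u) =
      monomialMap (transition σ ρ) u := by
  rw [← monomialMap_mul _ _ _ (transition_comp_nonneg ρ hu hv), transition_mul]

theorem cofactor_comp {σ τ ρ : S.Chart} {u : Cn n}
    (hu : ∀ j, u j = 0 → σ.1 j ∈ τ.verts)
    (hv : ∀ k, monomialMap (transition σ τ) u k = 0 → τ.1 k ∈ ρ.verts)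
    {j k l : Fin n} (hjk : σ.1 j = τ.1 k) (hkl : τ.1 k = ρ.1 l) :
    cofactor τ ρ k l (monomialMap (transition σ τ) u) * cofactor σ τ j k u =
      cofactor σ ρ j l u := by
  have hnn := transition_comp_nonneg ρ hu hv
  calc cofactor τ ρ k l (monomialMap (transition σ τ) u) * cofactor σ τ j k u
      = ∏ m, ∏ i ∈ Finset.univ.erase j, u i ^ (transition σ τ m i * transition τ ρ l m) := by
        rw [← Finset.mul_prod_erase _ _ (Finset.mem_univ k), mul_comm]
        congr 1
        · refine Finset.prod_congr rfl fun i _ => ?_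
          rw [transition_apply_of_eq hkl, if_pos rfl, mul_one]
        · refine Finset.prod_congr rfl fun m hm => ?_
          rw [monomialMap_of_ne hjk (Finset.ne_of_mem_erase hm), ← Finset.prod_zpow]
          exact Finset.prod_congr rfl fun i _ => (zpow_mul _ _ _).symm
    _ = cofactor σ ρ j l u := by
        rw [Finset.prod_comm]
        refine Finset.prod_congr rfl fun i _ => ?_
        rw [← zpow_sum_of_ne_or_nonneg _ _ _ fun h0 m => hnn i h0 l m, ← transition_mul σ τ ρ,
          Matrix.mul_apply]
        exact congrArg _ (Finset.sum_congr rfl fun k _ => mul_comm _ _)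

theorem cofactor_self (σ : S.Chart) (j : Fin n) (u : Cn n) : cofactor σ σ j j u = 1 := by
  unfold cofactor
  refine Finset.prod_eq_one fun i hi => ?_
  rw [transition_self, Matrix.one_apply_ne (Finset.ne_of_mem_erase hi).symm, zpow_zero]

end RegularFan

/-! ### Real lines in the complex plane -/

theorem submodule_eq_span_of_mem {ℓ : ℙ ℝ ℂ} {u : ℂ} (h : u ∈ ℓ.submodule) (hu : u ≠ 0) :
    ℓ.submodule = Submodule.span ℝ {u} := by
  induction ℓ using Projectivization.ind with
  | h w hw =>
    rw [Projectivization.submodule_mk] at h ⊢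
    obtain ⟨a, rfl⟩ := Submodule.mem_span_singleton.1 h
    have ha : a ≠ 0 := by
      rintro rfl
      simp at hu
    exact (Submodule.span_singleton_smul_eq (IsUnit.mk0 a ha) w).symm

theorem map_mulLeft_span (a u : ℂ) :
    (Submodule.span ℝ {u}).map (LinearMap.mulLeft ℝ a) = Submodule.span ℝ {a * u} := by
  rw [Submodule.map_span, Set.image_singleton, LinearMap.mulLeft_apply]

theorem map_mulLeft_mul (a b : ℂ) (L : Submodule ℝ ℂ) :
    (L.map (LinearMap.mulLeft ℝ a)).map (LinearMap.mulLeft ℝ b) =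
      L.map (LinearMap.mulLeft ℝ (b * a)) := by
  rw [← Submodule.map_comp, LinearMap.mulLeft_mul]

namespace RegularFan

variable {n : ℕ} {S : RegularFan n}

/-- The gluing relation on blown-up charts. The condition on the normal lines needs to be checked
only at points of the divisors: elsewhere the line is spanned by the coordinate itself. -/
theorem glueBlowup_iff {p q : Σ σ : S.Chart, σ.Blowup} :
    glueBlowup p q ↔ (∀ j, p.2.1.1 j = 0 → p.1.1 j ∈ q.1.verts) ∧
      q.2.1.1 = monomialMap (transition p.1 q.1) p.2.1.1 ∧
      ∀ (j : p.1.Exc) (k : q.1.Exc), p.1.1 j = q.1.1 k → p.2.1.1 j = 0 →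
        (p.2.1.2 j).submodule.map (LinearMap.mulLeft ℝ (cofactor p.1 q.1 j k p.2.1.1)) =
          (q.2.1.2 k).submodule := by
  constructor
  · rintro ⟨B, hB, hw, hq, hl⟩
    obtain rfl := eq_transition hB
    exact ⟨wellDefinedAt_transition_iff.1 hw, hq, fun j k h _ => hl j k h⟩
  · rintro ⟨hw, hq, hl⟩
    refine ⟨_, mat_mul_transition _ _, wellDefinedAt_transition_iff.2 hw, hq, fun j k h => ?_⟩
    by_cases h0 : p.2.1.1 j = 0
    · exact hl j k h h0
    · change (p.2.1.2 j).submodule.map (LinearMap.mulLeft ℝ (cofactor p.1 q.1 j k p.2.1.1)) = _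
      have h1 : q.2.1.1 k = p.2.1.1 j * cofactor p.1 q.1 j k p.2.1.1 := by
        rw [hq, monomialMap_eq_mul_cofactor h]
      rw [submodule_eq_span_of_mem (p.2.2 j) h0, map_mulLeft_span,
        submodule_eq_span_of_mem (q.2.2 k) (by
          rw [h1]; exact mul_ne_zero h0 (cofactor_ne_zero h hw)), h1, mul_comm]

theorem glueBlowup_refl (p : Σ σ : S.Chart, σ.Blowup) : glueBlowup p p := by
  refine glueBlowup_iff.2 ⟨fun j _ => p.1.mem_verts j, ?_, fun j k h _ => ?_⟩
  · rw [transition_self, monomialMap_one]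
  · obtain rfl : j = k := Subtype.ext (p.1.injective h)
    rw [cofactor_self, LinearMap.mulLeft_one, Submodule.map_id]

theorem glueBlowup_symm {p q : Σ σ : S.Chart, σ.Blowup} (h : glueBlowup p q) :
    glueBlowup q p := by
  obtain ⟨hw, hq, hl⟩ := glueBlowup_iff.1 h
  have hv : ∀ k, monomialMap (transition p.1 q.1) p.2.1.1 k = 0 → q.1.1 k ∈ p.1.verts := by
    intro k hk
    obtain ⟨j, hj, -⟩ := (monomialMap_transition_eq_zero_iff hw).1 hk
    exact hj ▸ p.1.mem_verts j
  refine glueBlowup_iff.2 ⟨by rwa [hq], ?_, fun k j hkj h0 => ?_⟩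
  · rw [hq, monomialMap_transition_comp hw hv, transition_self, monomialMap_one]
  · rw [hq, monomialMap_transition_eq_zero_iff hw] at h0
    obtain ⟨i, hi, hi0⟩ := h0
    obtain rfl : i = j := p.1.injective (hi.trans hkj)
    rw [← hl j k hkj.symm hi0, map_mulLeft_mul, hq, cofactor_comp hw hv hkj.symm hkj,
      cofactor_self, LinearMap.mulLeft_one, Submodule.map_id]

theorem glueBlowup_trans {p q r : Σ σ : S.Chart, σ.Blowup} (h : glueBlowup p q)
    (h' : glueBlowup q r) : glueBlowup p r := by
  obtain ⟨hw, hq, hl⟩ := glueBlowup_iff.1 h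
  obtain ⟨hw', hr, hl'⟩ := glueBlowup_iff.1 h'
  have hv : ∀ k, monomialMap (transition p.1 q.1) p.2.1.1 k = 0 → q.1.1 k ∈ r.1.verts := by
    rwa [← hq]
  refine glueBlowup_iff.2 ⟨fun j hj => ?_, ?_, fun j l hjl h0 => ?_⟩
  · obtain ⟨k, -, hk⟩ := Finset.mem_image.1 (hw j hj)
    rw [← hk]
    exact hv k ((monomialMap_transition_eq_zero_iff hw).2 ⟨j, hk.symm, hj⟩)
  · rw [hr, hq, monomialMap_transition_comp hw hv]
  · obtain ⟨k, -, hk⟩ := Finset.mem_image.1 (hw j h0)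
    have hkexc : StrictlyPositive (q.1.1 k) := by rw [hk]; exact j.2
    have hk0 : q.2.1.1 k = 0 := by
      rw [hq, monomialMap_transition_eq_zero_iff hw]
      exact ⟨j, hk.symm, h0⟩
    rw [← hl' ⟨k, hkexc⟩ l (hk.trans hjl) hk0, ← hl j ⟨k, hkexc⟩ hk.symm h0, map_mulLeft_mul,
      hq, cofactor_comp hw hv hk.symm (hk.trans hjl)]

theorem equivalence_glueBlowup : Equivalence (glueBlowup (S := S)) :=
  ⟨glueBlowup_refl, glueBlowup_symm, glueBlowup_trans⟩

theorem mk_eq_mk_iff {p q : Σ σ : S.Chart, σ.Blowup} :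
    (Quot.mk _ p : S.RealBlowup) = Quot.mk _ q ↔ glueBlowup p q :=
  equivalence_glueBlowup.quot_mk_eq_iff p q

theorem glue_zero_iff {p q : Σ _ : S.Chart, Cn n} (h : glue p q) (P : Fin n → ℕ) :
    (∃ j, p.1.1 j = P ∧ p.2 j = 0) ↔ ∃ k, q.1.1 k = P ∧ q.2 k = 0 := by
  obtain ⟨B, hB, hw, hq⟩ := h
  obtain rfl := eq_transition hB
  rw [wellDefinedAt_transition_iff] at hw
  constructor
  · rintro ⟨j, rfl, hj⟩
    obtain ⟨k, -, hk⟩ := Finset.mem_image.1 (hw j hj)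
    exact ⟨k, hk, by rw [hq, monomialMap_transition_eq_zero_iff hw]; exact ⟨j, hk.symm, hj⟩⟩
  · rintro ⟨k, rfl, hk⟩
    rw [hq, monomialMap_transition_eq_zero_iff hw] at hk
    exact hk

theorem mk_mem_toricDivisor_iff {σ : S.Chart} {u : Cn n} {P : Fin n → ℕ} :
    (Quot.mk _ ⟨σ, u⟩ : S.ToricVariety) ∈ S.toricDivisor P ↔ ∃ j, σ.1 j = P ∧ u j = 0 := by
  constructor
  · rintro ⟨τ, v, k, hk, hv, h⟩
    have h1 : ∀ x y : Σ _ : S.Chart, Cn n, Relation.EqvGen glue x y →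
        ((∃ j, x.1.1 j = P ∧ x.2 j = 0) ↔ ∃ k, y.1.1 k = P ∧ y.2 k = 0) := by
      intro x y hxy
      induction hxy with
      | rel x y h => exact glue_zero_iff h P
      | refl x => rfl
      | symm x y _ ih => exact ih.symm
      | trans x y z _ _ ih ih' => exact ih.trans ih'
    exact (h1 _ _ (Quot.eqvGen_exact h)).2 ⟨k, hk, hv⟩
  · rintro ⟨j, hj, hu⟩
    exact ⟨σ, u, j, hj, hu, rfl⟩

theorem mk_mem_exceptionalDivisor_iff {σ : S.Chart} {p : σ.Blowup} {P : S.positiveVertices} :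
    (Quot.mk _ ⟨σ, p⟩ : S.RealBlowup) ∈ S.exceptionalDivisor P ↔
      ∃ j, σ.1 j = P.1 ∧ p.1.1 j = 0 :=
  mk_mem_toricDivisor_iff

theorem Chart.mem_vertices (σ : S.Chart) (j : Fin n) : σ.1 j ∈ S.vertices :=
  S.face_mem _ σ.2.2 _ (Finset.singleton_subset_iff.2 (σ.mem_verts j))

end RegularFan

/-! ### Coordinates of the real blowing-up of the complex plane -/

/-- The line spanned by `w` lies in the affine chart `ε` of `ℝℙ¹`. -/
def Visible (ε : Bool) (w : ℂ) : Prop := if ε then w.im ≠ 0 else w.re ≠ 0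

/-- The affine coordinate in the chart `ε` of the line spanned by `w`. -/
def lineCoord (ε : Bool) (w : ℂ) : ℝ := if ε then w.re / w.im else w.im / w.re

/-- The coordinates, in the chart `ε` of the real blowing-up of `ℂ`, of the point `v` with the
line spanned by `w`. -/
def blowupCoord (ε : Bool) (v w : ℂ) (i : Fin 2) : ℝ :=
  if ε then (if i = 0 then lineCoord ε w else v.im) else (if i = 0 then v.re else lineCoord ε w)

theorem visible_smul {ε : Bool} {a : ℝ} (ha : a ≠ 0) (w : ℂ) : Visible ε (a • w) ↔ Visible ε w := by
  cases ε <;> simp [Visible, ha]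

theorem lineCoord_smul {ε : Bool} {a : ℝ} (ha : a ≠ 0) (w : ℂ) :
    lineCoord ε (a • w) = lineCoord ε w := by
  cases ε <;> simp [lineCoord, mul_div_mul_left _ _ ha]

theorem isOpen_visible (ε : Bool) : IsOpen {w | Visible ε w} := by
  cases ε
  · exact isOpen_ne_fun Complex.continuous_re continuous_const
  · exact isOpen_ne_fun Complex.continuous_im continuous_const

theorem continuousOn_lineCoord (ε : Bool) : ContinuousOn (lineCoord ε) {w | Visible ε w} := by
  cases ε
  · exact Complex.continuous_im.continuousOn.div Complex.continuous_re.continuousOn fun _ hw => hw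
  · exact Complex.continuous_re.continuousOn.div Complex.continuous_im.continuousOn fun _ hw => hw

theorem im_conj_mul_eq_zero_iff {a b : ℂ} (ha : a ≠ 0) :
    ((starRingEnd ℂ) b * a).im = 0 ↔ ∃ r : ℝ, b = r * a := by
  constructor
  · intro h
    have hz : ((starRingEnd ℂ) b * a) = (((starRingEnd ℂ) b * a).re : ℂ) :=
      Complex.ext (by simp) (by simpa using h)
    have hz' := congrArg (starRingEnd ℂ) hz
    rw [map_mul, Complex.conj_conj, Complex.conj_ofReal] at hz'
    refine ⟨((starRingEnd ℂ) b * a).re / Complex.normSq a, ?_⟩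
    have hn : (Complex.normSq a : ℂ) ≠ 0 := by
      exact_mod_cast (Complex.normSq_pos.2 ha).ne'
    push_cast
    rw [div_mul_eq_mul_div, eq_div_iff hn, ← hz', Complex.normSq_eq_conj_mul_self]
    ring
  · rintro ⟨r, rfl⟩
    rw [map_mul, Complex.conj_ofReal, mul_assoc, ← Complex.normSq_eq_conj_mul_self,
      ← Complex.ofReal_mul, Complex.ofReal_im]

theorem span_eq_span_iff {a b : ℂ} (ha : a ≠ 0) (hb : b ≠ 0) :
    Submodule.span ℝ {a} = Submodule.span ℝ {b} ↔ ((starRingEnd ℂ) b * a).im = 0 := by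
  rw [im_conj_mul_eq_zero_iff ha]
  constructor
  · intro h
    have : b ∈ Submodule.span ℝ {a} := h ▸ Submodule.mem_span_singleton_self b
    obtain ⟨r, hr⟩ := Submodule.mem_span_singleton.1 this
    exact ⟨r, by rw [← hr, Complex.real_smul]⟩
  · rintro ⟨r, rfl⟩
    have hr : r ≠ 0 := by
      rintro rfl
      simp at hb
    rw [← Complex.real_smul]
    exact (Submodule.span_singleton_smul_eq (IsUnit.mk0 r hr) a).symm

open RegularFan in
theorem direction_blowupCoord {ε : Bool} {w : ℂ} (hw : Visible ε w) (v : ℂ) :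
    ∃ r : ℝ, r ≠ 0 ∧ w = r * direction ε (blowupCoord ε v w) ∧
      (∀ t : ℝ, v = t * w → factor ε (blowupCoord ε v w) = t * r) := by
  cases ε
  · have hw' : w.re ≠ 0 := hw
    refine ⟨w.re, hw', ?_, ?_⟩
    · apply Complex.ext <;> simp [direction, blowupCoord, lineCoord]
      field_simp
    · rintro t rfl
      simp [factor, blowupCoord]
  · have hw' : w.im ≠ 0 := hw
    refine ⟨w.im, hw', ?_, ?_⟩
    · apply Complex.ext <;> simp [direction, blowupCoord, lineCoord]
      field_simp
    · rintro t rfl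
      simp [factor, blowupCoord]

open RegularFan in
theorem blowupCoord_eq {ε : Bool} {a : Fin 2 → ℝ} {w : ℂ} {r : ℝ}
    (h : direction ε a = r * w) :
    Visible ε w ∧ blowupCoord ε (factor ε a * direction ε a) w = a := by
  have hr : r ≠ 0 := by
    rintro rfl
    exact direction_ne_zero ε a (by simpa using h)
  have hw' : w = r⁻¹ • direction ε a := by
    rw [h, Complex.real_smul, Complex.ofReal_inv, inv_mul_cancel_left₀]
    exact_mod_cast hr
  refine ⟨?_, ?_⟩
  · rw [hw', visible_smul (inv_ne_zero hr)]
    cases ε <;> simp [Visible, direction]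
  · funext i
    rw [blowupCoord, hw', lineCoord_smul (inv_ne_zero hr)]
    cases ε <;> fin_cases i <;> simp [lineCoord, direction, factor]

namespace RegularFan

variable {n : ℕ} {S : RegularFan n}

/-! ### The parametrizations of the real blowing-up -/

/-- The coordinates `u_σ` of the point with the real coordinates `x`. -/
def chartCoord (σ : S.Chart) (ε : Fin n → Bool) (x : RealSpace n) : Cn n :=
  (S.blowupPoint σ ε x).1.1

/-- The direction vector of the `j`-th line of the point with the real coordinates `x`. -/
def dirVec (ε : Fin n → Bool) (x : RealSpace n) (j : Fin n) : ℂ :=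
  direction (ε j) fun k => x (j, k)

/-- The real factor of the `j`-th coordinate of the point with the real coordinates `x`. -/
def realFactor (ε : Fin n → Bool) (x : RealSpace n) (j : Fin n) : ℝ :=
  factor (ε j) fun k => x (j, k)

theorem chartCoord_exc {σ : S.Chart} {j : Fin n} (hj : StrictlyPositive (σ.1 j))
    (ε : Fin n → Bool) (x : RealSpace n) :
    chartCoord σ ε x j = realFactor ε x j * dirVec ε x j := by
  simp [chartCoord, blowupPoint, hj, realFactor, dirVec]

theorem chartCoord_nonexc {σ : S.Chart} {j : Fin n} (hj : ¬StrictlyPositive (σ.1 j))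
    (ε : Fin n → Bool) (x : RealSpace n) : chartCoord σ ε x j = ⟨x (j, 0), x (j, 1)⟩ := by
  simp [chartCoord, blowupPoint, hj]

theorem dirVec_ne_zero (ε : Fin n → Bool) (x : RealSpace n) (j : Fin n) : dirVec ε x j ≠ 0 :=
  direction_ne_zero _ _

theorem chartCoord_exc_eq_zero_iff {σ : S.Chart} {j : Fin n} (hj : StrictlyPositive (σ.1 j))
    (ε : Fin n → Bool) (x : RealSpace n) : chartCoord σ ε x j = 0 ↔ realFactor ε x j = 0 := by
  rw [chartCoord_exc hj, mul_eq_zero, or_iff_left (dirVec_ne_zero ε x j), Complex.ofReal_eq_zero]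

/-- A vector that spans the `k`-th line, seen in the chart `τ`, of the point of the chart `σ` with
the real coordinates `x`. -/
def lineVec (σ τ : S.Chart) (ε : Fin n → Bool) (x : RealSpace n) (k : Fin n) : ℂ :=
  ∏ i, if σ.1 i = τ.1 k then dirVec ε x i else chartCoord σ ε x i ^ transition σ τ k i

theorem lineVec_of_eq {σ τ : S.Chart} {j k : Fin n} (h : σ.1 j = τ.1 k) (ε : Fin n → Bool)
    (x : RealSpace n) :
    lineVec σ τ ε x k = cofactor σ τ j k (chartCoord σ ε x) * dirVec ε x j := by
  rw [lineVec, ← Finset.mul_prod_erase _ _ (Finset.mem_univ j), if_pos h, mul_comm]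
  congr 1
  refine Finset.prod_congr rfl fun i hi => if_neg fun h' => ?_
  exact Finset.ne_of_mem_erase hi (σ.injective (h'.trans h.symm))

theorem lineVec_of_notMem {σ τ : S.Chart} {k : Fin n} (h : τ.1 k ∉ σ.verts) (ε : Fin n → Bool)
    (x : RealSpace n) :
    lineVec σ τ ε x k = monomialMap (transition σ τ) (chartCoord σ ε x) k :=
  Finset.prod_congr rfl fun i _ => if_neg fun h' : σ.1 i = τ.1 k => h (h' ▸ σ.mem_verts i)

theorem lineVec_ne_zero {σ τ : S.Chart} {ε : Fin n → Bool} {x : RealSpace n}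
    (hw : ∀ j, chartCoord σ ε x j = 0 → σ.1 j ∈ τ.verts) (k : Fin n) :
    lineVec σ τ ε x k ≠ 0 := by
  by_cases h : τ.1 k ∈ σ.verts
  · obtain ⟨j, -, hj⟩ := Finset.mem_image.1 h
    rw [lineVec_of_eq hj]
    exact mul_ne_zero (cofactor_ne_zero hj hw) (dirVec_ne_zero _ _ _)
  · rw [lineVec_of_notMem h, Ne, monomialMap_transition_eq_zero_iff hw]
    rintro ⟨j, hj, -⟩
    exact h (hj ▸ σ.mem_verts j)

theorem exists_monomialMap_eq_mul_lineVec {σ τ : S.Chart} (ε : Fin n → Bool) (x : RealSpace n)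
    {k : Fin n} (hk : StrictlyPositive (τ.1 k)) :
    ∃ t : ℝ, monomialMap (transition σ τ) (chartCoord σ ε x) k = t * lineVec σ τ ε x k := by
  by_cases h : τ.1 k ∈ σ.verts
  · obtain ⟨j, -, hj⟩ := Finset.mem_image.1 h
    refine ⟨realFactor ε x j, ?_⟩
    rw [lineVec_of_eq hj, monomialMap_eq_mul_cofactor hj, chartCoord_exc (by rwa [hj])]
    ring
  · exact ⟨1, by rw [lineVec_of_notMem h, Complex.ofReal_one, one_mul]⟩

/-- Equality of two parametrized points, by equations that are closed in `(x, y)` apart from the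
condition on the vanishing coordinates. -/
theorem parametrization_eq_iff {σ τ : S.Chart} {ε δ : Fin n → Bool} {x y : RealSpace n} :
    S.parametrization σ ε x = S.parametrization τ δ y ↔
      (∀ j, chartCoord σ ε x j = 0 → σ.1 j ∈ τ.verts) ∧
      chartCoord τ δ y = monomialMap (transition σ τ) (chartCoord σ ε x) ∧
      ∀ k, StrictlyPositive (τ.1 k) →
        ((starRingEnd ℂ) (dirVec δ y k) * lineVec σ τ ε x k).im = 0 := by
  refine (mk_eq_mk_iff (p := ⟨σ, S.blowupPoint σ ε x⟩) (q := ⟨τ, S.blowupPoint τ δ y⟩)).trans ?_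
  constructor
  · rintro ⟨B, hB, hw, hq, hl⟩
    obtain rfl := eq_transition hB
    have hw' := wellDefinedAt_transition_iff.1 hw
    refine ⟨hw', hq, fun k hk => ?_⟩
    by_cases h : τ.1 k ∈ σ.verts
    · obtain ⟨j, -, hj⟩ := Finset.mem_image.1 h
      have h1 : (Submodule.span ℝ {dirVec ε x j}).map
          (LinearMap.mulLeft ℝ (cofactor σ τ j k (chartCoord σ ε x))) =
          Submodule.span ℝ {dirVec δ y k} := by
        have := hl ⟨j, show StrictlyPositive (σ.1 j) by rwa [hj]⟩ ⟨k, hk⟩ hj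
        simp only [blowupPoint, Projectivization.submodule_mk] at this
        exact this
      rw [map_mulLeft_span, ← lineVec_of_eq hj] at h1
      exact (span_eq_span_iff (lineVec_ne_zero hw' k) (dirVec_ne_zero _ _ _)).1 h1
    · rw [lineVec_of_notMem h]
      have h1 : monomialMap (transition σ τ) (chartCoord σ ε x) k =
          realFactor δ y k * dirVec δ y k := by
        rw [← chartCoord_exc hk]
        exact (congrFun hq k).symm
      rw [h1, mul_left_comm, ← Complex.normSq_eq_conj_mul_self, ← Complex.ofReal_mul,
        Complex.ofReal_im]
  · rintro ⟨hw, hq, hl⟩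
    refine glueBlowup_iff.2 ⟨hw, hq, fun j k hjk _ => ?_⟩
    have hjk' : σ.1 j.1 = τ.1 k.1 := hjk
    simp only [blowupPoint, Projectivization.submodule_mk]
    change (Submodule.span ℝ {dirVec ε x j}).map
          (LinearMap.mulLeft ℝ (cofactor σ τ j k (chartCoord σ ε x))) =
          Submodule.span ℝ {dirVec δ y k}
    rw [map_mulLeft_span, ← lineVec_of_eq hjk',
      span_eq_span_iff (lineVec_ne_zero hw _) (dirVec_ne_zero _ _ _)]
    exact hl k k.2

open Classical in
/-- The coordinate change between two parametrizations. -/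
def coordChange (σ τ : S.Chart) (ε δ : Fin n → Bool) (x : RealSpace n) : RealSpace n := fun k =>
  if StrictlyPositive (τ.1 k.1) then
    blowupCoord (δ k.1) (monomialMap (transition σ τ) (chartCoord σ ε x) k.1)
      (lineVec σ τ ε x k.1) k.2
  else if k.2 = 0 then (monomialMap (transition σ τ) (chartCoord σ ε x) k.1).re
  else (monomialMap (transition σ τ) (chartCoord σ ε x) k.1).im

/-- The domain of the coordinate change between two parametrizations: the point lies in the toric
chart `τ`, and its lines lie in the affine charts `δ`. -/
def changeDomain (σ τ : S.Chart) (ε δ : Fin n → Bool) : Set (RealSpace n) :=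
  {x | (∀ j, chartCoord σ ε x j = 0 → σ.1 j ∈ τ.verts) ∧
    ∀ k, StrictlyPositive (τ.1 k) → Visible (δ k) (lineVec σ τ ε x k)}

/-- Two parametrized points are equal if and only if the coordinate change is defined and maps the
coordinates of the first to those of the second. -/
theorem parametrization_eq_iff_coordChange {σ τ : S.Chart} {ε δ : Fin n → Bool}
    {x y : RealSpace n} :
    S.parametrization σ ε x = S.parametrization τ δ y ↔
      x ∈ changeDomain σ τ ε δ ∧ coordChange σ τ ε δ x = y := by
  rw [parametrization_eq_iff]
  constructor
  · rintro ⟨hw, hq, hl⟩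
    have key : ∀ k, StrictlyPositive (τ.1 k) → Visible (δ k) (lineVec σ τ ε x k) ∧
        blowupCoord (δ k) (monomialMap (transition σ τ) (chartCoord σ ε x) k)
          (lineVec σ τ ε x k) = fun i => y (k, i) := by
      intro k hk
      obtain ⟨r, hr⟩ := (im_conj_mul_eq_zero_iff (lineVec_ne_zero hw k)).1 (hl k hk)
      have := blowupCoord_eq (ε := δ k) (a := fun i => y (k, i)) hr
      rw [← hq, chartCoord_exc hk]
      exact this
    refine ⟨⟨hw, fun k hk => (key k hk).1⟩, ?_⟩
    funext ⟨k, i⟩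
    unfold coordChange
    by_cases hk : StrictlyPositive (τ.1 k)
    · rw [if_pos hk]
      exact congrFun (key k hk).2 i
    · rw [if_neg hk, ← hq, chartCoord_nonexc hk]
      fin_cases i <;> simp
  · rintro ⟨⟨hw, hv⟩, rfl⟩
    have key : ∀ k, StrictlyPositive (τ.1 k) → (fun i => coordChange σ τ ε δ x (k, i)) =
        blowupCoord (δ k) (monomialMap (transition σ τ) (chartCoord σ ε x) k)
          (lineVec σ τ ε x k) := by
      intro k hk
      funext i
      simp only [coordChange, if_pos hk]
    refine ⟨hw, ?_, ?_⟩
    · funext k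
      by_cases hk : StrictlyPositive (τ.1 k)
      · obtain ⟨r, hr, h1, h2⟩ := direction_blowupCoord (hv k hk)
          (monomialMap (transition σ τ) (chartCoord σ ε x) k)
        obtain ⟨t, ht⟩ := exists_monomialMap_eq_mul_lineVec (σ := σ) ε x hk
        rw [chartCoord_exc hk, realFactor, dirVec, key k hk, h2 t ht, ht]
        conv_rhs => rw [h1]
        rw [ht]
        push_cast
        ring
      · rw [chartCoord_nonexc hk]
        simp [coordChange, hk]
    · intro k hk
      obtain ⟨r, hr, h1, -⟩ := direction_blowupCoord (hv k hk)
        (monomialMap (transition σ τ) (chartCoord σ ε x) k)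
      rw [dirVec, key k hk, im_conj_mul_eq_zero_iff (lineVec_ne_zero hw k)]
      refine ⟨r⁻¹, ?_⟩
      conv_rhs => rw [h1]
      rw [Complex.ofReal_inv, inv_mul_cancel_left₀]
      exact_mod_cast hr

theorem injective_parametrization (σ : S.Chart) (ε : Fin n → Bool) :
    Function.Injective (S.parametrization σ ε) := fun x _ h =>
  (parametrization_eq_iff_coordChange.1 (rfl : S.parametrization σ ε x = _)).2.symm.trans
    (parametrization_eq_iff_coordChange.1 h).2

/-! ### Analyticity of the coordinate changes -/

theorem analyticAt_complex_mk {E : Type*} [NormedAddCommGroup E] [NormedSpace ℝ E] {a b : E → ℝ}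
    {x : E} (ha : AnalyticAt ℝ a x) (hb : AnalyticAt ℝ b x) :
    AnalyticAt ℝ (fun x => (⟨a x, b x⟩ : ℂ)) x :=
  (Complex.equivRealProdCLM.symm.analyticAt _).comp (ha.prod hb)

theorem analyticAt_coord (k : Fin n × Fin 2) (x : RealSpace n) :
    AnalyticAt ℝ (fun x : RealSpace n => x k) x :=
  (ContinuousLinearMap.proj (R := ℝ) (φ := fun _ : Fin n × Fin 2 => ℝ) k).analyticAt x

theorem analyticAt_dirVec (ε : Fin n → Bool) (j : Fin n) (x : RealSpace n) :
    AnalyticAt ℝ (fun x => dirVec ε x j) x := by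
  unfold dirVec direction
  cases ε j
  · exact analyticAt_complex_mk analyticAt_const (analyticAt_coord _ _)
  · exact analyticAt_complex_mk (analyticAt_coord _ _) analyticAt_const

theorem analyticAt_realFactor (ε : Fin n → Bool) (j : Fin n) (x : RealSpace n) :
    AnalyticAt ℝ (fun x => realFactor ε x j) x := by
  unfold realFactor factor
  cases ε j
  · exact analyticAt_coord _ _
  · exact analyticAt_coord _ _

theorem analyticAt_ofReal_comp {E : Type*} [NormedAddCommGroup E] [NormedSpace ℝ E] {a : E → ℝ}
    {x : E} (ha : AnalyticAt ℝ a x) : AnalyticAt ℝ (fun x => (a x : ℂ)) x :=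
  (Complex.ofRealCLM.analyticAt _).comp ha

theorem analyticAt_chartCoord (σ : S.Chart) (ε : Fin n → Bool) (j : Fin n) (x : RealSpace n) :
    AnalyticAt ℝ (fun x => chartCoord σ ε x j) x := by
  by_cases hj : StrictlyPositive (σ.1 j)
  · simp only [chartCoord_exc hj]
    exact (analyticAt_ofReal_comp (analyticAt_realFactor ε j x)).mul (analyticAt_dirVec ε j x)
  · simp only [chartCoord_nonexc hj]
    exact analyticAt_complex_mk (analyticAt_coord _ _) (analyticAt_coord _ _)

theorem continuous_chartCoord (σ : S.Chart) (ε : Fin n → Bool) :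
    Continuous (chartCoord σ ε) :=
  continuous_pi fun j => continuous_iff_continuousAt.2 fun x =>
    (analyticAt_chartCoord σ ε j x).continuousAt

theorem continuous_dirVec (ε : Fin n → Bool) (j : Fin n) : Continuous fun x => dirVec ε x j :=
  continuous_iff_continuousAt.2 fun x => (analyticAt_dirVec ε j x).continuousAt

theorem analyticAt_prod_zpow {E : Type*} [NormedAddCommGroup E] [NormedSpace ℝ E]
    {ι : Type*} (s : Finset ι) {g : ι → E → ℂ} {e : ι → ℤ} {x : E}
    (hg : ∀ i ∈ s, AnalyticAt ℝ (g i) x) (he : ∀ i ∈ s, g i x = 0 → 0 ≤ e i) :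
    AnalyticAt ℝ (fun y => ∏ i ∈ s, g i y ^ e i) x := by
  refine Finset.analyticAt_fun_prod s fun i hi => ?_
  by_cases h : g i x = 0
  · exact (hg i hi).zpow_nonneg (he i hi h)
  · exact (hg i hi).zpow h

theorem analyticAt_monomialMap_transition {σ τ : S.Chart} {ε : Fin n → Bool} {x : RealSpace n}
    (hw : ∀ j, chartCoord σ ε x j = 0 → σ.1 j ∈ τ.verts) (k : Fin n) :
    AnalyticAt ℝ (fun x => monomialMap (transition σ τ) (chartCoord σ ε x) k) x :=
  analyticAt_prod_zpow _ (fun i _ => analyticAt_chartCoord σ ε i x)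
    fun i _ hi => transition_nonneg_of_mem_verts (hw i hi) k

theorem analyticAt_lineVec {σ τ : S.Chart} {ε : Fin n → Bool} {x : RealSpace n}
    (hw : ∀ j, chartCoord σ ε x j = 0 → σ.1 j ∈ τ.verts) (k : Fin n) :
    AnalyticAt ℝ (fun x => lineVec σ τ ε x k) x := by
  unfold lineVec
  refine Finset.analyticAt_fun_prod _ fun i _ => ?_
  split_ifs with h
  · exact analyticAt_dirVec ε i x
  · by_cases h0 : chartCoord σ ε x i = 0
    · exact (analyticAt_chartCoord σ ε i x).zpow_nonneg (transition_nonneg_of_mem_verts (hw i h0) k)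
    · exact (analyticAt_chartCoord σ ε i x).zpow h0

theorem analyticAt_re {E : Type*} [NormedAddCommGroup E] [NormedSpace ℝ E] {g : E → ℂ}
    {x : E} (hg : AnalyticAt ℝ g x) : AnalyticAt ℝ (fun x => (g x).re) x :=
  (Complex.reCLM.analyticAt _).comp hg

theorem analyticAt_im {E : Type*} [NormedAddCommGroup E] [NormedSpace ℝ E] {g : E → ℂ}
    {x : E} (hg : AnalyticAt ℝ g x) : AnalyticAt ℝ (fun x => (g x).im) x :=
  (Complex.imCLM.analyticAt _).comp hg

theorem analyticAt_blowupCoord {E : Type*} [NormedAddCommGroup E] [NormedSpace ℝ E] {v w : E → ℂ}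
    {x : E} (hv : AnalyticAt ℝ v x) (hw : AnalyticAt ℝ w x) {ε : Bool} (h : Visible ε (w x))
    (i : Fin 2) : AnalyticAt ℝ (fun x => blowupCoord ε (v x) (w x) i) x := by
  unfold blowupCoord lineCoord
  cases ε <;> fin_cases i
  · exact analyticAt_re hv
  · exact (analyticAt_im hw).div (analyticAt_re hw) h
  · exact (analyticAt_re hw).div (analyticAt_im hw) h
  · exact analyticAt_im hv

theorem analyticAt_coordChange {σ τ : S.Chart} {ε δ : Fin n → Bool} {x : RealSpace n}
    (hx : x ∈ changeDomain σ τ ε δ) : AnalyticAt ℝ (coordChange σ τ ε δ) x := by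
  rw [analyticAt_pi_iff]
  rintro ⟨k, i⟩
  unfold coordChange
  by_cases hk : StrictlyPositive (τ.1 k)
  · simp only [if_pos hk]
    exact analyticAt_blowupCoord (analyticAt_monomialMap_transition hx.1 k)
      (analyticAt_lineVec hx.1 k) (hx.2 k hk) i
  · simp only [if_neg hk]
    split_ifs
    · exact analyticAt_re (analyticAt_monomialMap_transition hx.1 k)
    · exact analyticAt_im (analyticAt_monomialMap_transition hx.1 k)

theorem isOpen_changeDomain (σ τ : S.Chart) (ε δ : Fin n → Bool) :
    IsOpen (changeDomain σ τ ε δ) := by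
  rw [isOpen_iff_mem_nhds]
  intro x hx
  have h1 : ∀ᶠ y in 𝓝 x, ∀ j, chartCoord σ ε y j = 0 → σ.1 j ∈ τ.verts := by
    rw [eventually_all]
    intro j
    by_cases h : chartCoord σ ε x j = 0
    · exact Eventually.of_forall fun _ _ => hx.1 j h
    · filter_upwards [(analyticAt_chartCoord σ ε j x).continuousAt.eventually_ne h] with y hy h0
      exact absurd h0 hy
  have h2 : ∀ᶠ y in 𝓝 x, ∀ k, StrictlyPositive (τ.1 k) → Visible (δ k) (lineVec σ τ ε y k) := by
    rw [eventually_all]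
    intro k
    by_cases hk : StrictlyPositive (τ.1 k)
    · filter_upwards [(analyticAt_lineVec hx.1 k).continuousAt.preimage_mem_nhds
        ((isOpen_visible (δ k)).mem_nhds (hx.2 k hk))] with y hy _
      exact hy
    · exact Eventually.of_forall fun _ h => absurd h hk
  filter_upwards [h1, h2] with y h1 h2 using ⟨h1, h2⟩

/-! ### The parametrizations are open embeddings -/

theorem isOpen_projectiveLine_iff {s : Set (ℙ ℝ ℂ)} :
    IsOpen s ↔ IsOpen {w : {w : ℂ // w ≠ 0} | Projectivization.mk ℝ w.1 w.2 ∈ s} := Iff.rfl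

theorem continuous_projectivization_mk {X : Type*} [TopologicalSpace X] {g : X → ℂ}
    (hg : Continuous g) (h0 : ∀ x, g x ≠ 0) :
    Continuous fun x => Projectivization.mk ℝ (g x) (h0 x) := by
  refine continuous_def.2 fun s hs => ?_
  exact (isOpen_projectiveLine_iff.1 hs).preimage (hg.subtype_mk h0)

theorem visible_rep_mk {ε : Bool} {w : ℂ} (hw : w ≠ 0) :
    (Visible ε (Projectivization.mk ℝ w hw).rep ↔ Visible ε w) ∧
      lineCoord ε (Projectivization.mk ℝ w hw).rep = lineCoord ε w := by
  obtain ⟨a, ha⟩ := Projectivization.exists_smul_eq_mk_rep ℝ w hw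
  rw [← ha]
  exact ⟨visible_smul a.ne_zero w, lineCoord_smul a.ne_zero w⟩

theorem isOpen_visible_rep (ε : Bool) : IsOpen {ℓ : ℙ ℝ ℂ | Visible ε ℓ.rep} := by
  rw [isOpen_projectiveLine_iff]
  simp only [Set.mem_ofPred_eq, (visible_rep_mk _).1]
  exact (isOpen_visible ε).preimage continuous_subtype_val

theorem continuousOn_lineCoord_rep (ε : Bool) :
    ContinuousOn (fun ℓ : ℙ ℝ ℂ => lineCoord ε ℓ.rep) {ℓ | Visible ε ℓ.rep} := by
  rw [continuousOn_open_iff (isOpen_visible_rep ε)]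
  intro t ht
  rw [isOpen_projectiveLine_iff]
  have h := (continuousOn_lineCoord ε).isOpen_inter_preimage (isOpen_visible ε) ht
  have h2 : {w : {w : ℂ // w ≠ 0} | Projectivization.mk ℝ w.1 w.2 ∈
      {ℓ : ℙ ℝ ℂ | Visible ε ℓ.rep} ∩ (fun ℓ : ℙ ℝ ℂ => lineCoord ε ℓ.rep) ⁻¹' t} =
      Subtype.val ⁻¹' ({w | Visible ε w} ∩ lineCoord ε ⁻¹' t) := by
    ext w
    simp only [Set.mem_ofPred_eq, Set.mem_inter_iff, Set.mem_preimage, (visible_rep_mk w.2).1,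
      (visible_rep_mk w.2).2]
  rw [h2]
  exact h.preimage continuous_subtype_val

theorem continuous_blowupPoint (σ : S.Chart) (ε : Fin n → Bool) :
    Continuous (S.blowupPoint σ ε) := by
  refine Continuous.subtype_mk ?_ _
  exact (continuous_chartCoord σ ε).prodMk
    (continuous_pi fun j => continuous_projectivization_mk (continuous_dirVec ε j) _)

theorem continuous_parametrization (σ : S.Chart) (ε : Fin n → Bool) :
    Continuous (S.parametrization σ ε) :=
  continuous_quot_mk.comp (continuous_sigmaMk.comp (continuous_blowupPoint σ ε))

open Classical in
/-- The coordinates of a point of a blown-up chart, the inverse of `blowupPoint`. -/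
def pointCoord (σ : S.Chart) (ε : Fin n → Bool) (p : σ.Blowup) : RealSpace n := fun k =>
  if h : StrictlyPositive (σ.1 k.1) then
    blowupCoord (ε k.1) (p.1.1 k.1) (p.1.2 ⟨k.1, h⟩).rep k.2
  else if k.2 = 0 then (p.1.1 k.1).re else (p.1.1 k.1).im

theorem blowupPoint_pointCoord {σ : S.Chart} {ε : Fin n → Bool} {p : σ.Blowup}
    (hp : ∀ j : σ.Exc, Visible (ε j) (p.1.2 j).rep) :
    S.blowupPoint σ ε (pointCoord σ ε p) = p := by
  have key : ∀ j : σ.Exc, (fun i => pointCoord σ ε p (j.1, i)) =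
      blowupCoord (ε j) (p.1.1 j) (p.1.2 j).rep := by
    intro j
    funext i
    simp [pointCoord, j.2]
  have h1 : ∀ j, chartCoord σ ε (pointCoord σ ε p) j = p.1.1 j := by
    intro j
    by_cases hj : StrictlyPositive (σ.1 j)
    · obtain ⟨r, hr, h1, h2⟩ := direction_blowupCoord (hp ⟨j, hj⟩) (p.1.1 j)
      have hm := p.2 ⟨j, hj⟩
      rw [← (p.1.2 ⟨j, hj⟩).mk_rep, Projectivization.submodule_mk,
        Submodule.mem_span_singleton] at hm
      obtain ⟨t, ht⟩ := hm
      rw [Complex.real_smul] at ht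
      rw [chartCoord_exc hj, realFactor, dirVec, key ⟨j, hj⟩, h2 t ht.symm]
      conv_rhs => rw [← ht]; arg 2; rw [h1]
      push_cast
      ring
    · rw [chartCoord_nonexc hj]
      simp [pointCoord, hj]
  refine Subtype.ext (Prod.ext (funext h1) (funext fun j => ?_))
  obtain ⟨r, hr, h2, -⟩ := direction_blowupCoord (hp j) (p.1.1 j)
  rw [← (p.1.2 j).mk_rep]
  simp only [blowupPoint]
  rw [Projectivization.mk_eq_mk_iff']
  refine ⟨r⁻¹, ?_⟩
  conv_lhs => rw [h2]
  rw [key j, Complex.real_smul, Complex.ofReal_inv, inv_mul_cancel_left₀]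
  exact_mod_cast hr

theorem pointCoord_blowupPoint (σ : S.Chart) (ε : Fin n → Bool) (x : RealSpace n) :
    (∀ j : σ.Exc, Visible (ε j) ((S.blowupPoint σ ε x).1.2 j).rep) ∧
      pointCoord σ ε (S.blowupPoint σ ε x) = x := by
  have h0 : ∀ j : σ.Exc, Visible (ε j) ((S.blowupPoint σ ε x).1.2 j).rep := by
    intro j
    simp only [blowupPoint]
    rw [(visible_rep_mk _).1]
    cases h : ε j <;> simp [Visible, direction]
  refine ⟨h0, injective_parametrization σ ε ?_⟩
  rw [parametrization, blowupPoint_pointCoord h0, parametrization]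

theorem isOpenMap_blowupPoint (σ : S.Chart) (ε : Fin n → Bool) :
    IsOpenMap (S.blowupPoint σ ε) := by
  intro U hU
  set V : Set σ.Blowup := {p | ∀ j : σ.Exc, Visible (ε j) (p.1.2 j).rep} with hV
  have hsnd : ∀ j : σ.Exc, Continuous fun p : σ.Blowup => p.1.2 j := fun j =>
    (continuous_apply j).comp (continuous_snd.comp continuous_subtype_val)
  have hfst : ∀ j, Continuous fun p : σ.Blowup => p.1.1 j := fun j =>
    (continuous_apply j).comp (continuous_fst.comp continuous_subtype_val)
  have hVo : IsOpen V := by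
    simp only [hV, Set.ofPred_forall]
    exact isOpen_iInter_of_finite fun j => (isOpen_visible_rep (ε j)).preimage (hsnd j)
  have hc : ContinuousOn (pointCoord σ ε) V := by
    rw [continuousOn_pi]
    rintro ⟨k, i⟩
    unfold pointCoord
    by_cases hk : StrictlyPositive (σ.1 k)
    · simp only [hk, dif_pos]
      have hl : ContinuousOn (fun p : σ.Blowup => lineCoord (ε k) (p.1.2 ⟨k, hk⟩).rep) V :=
        (continuousOn_lineCoord_rep (ε k)).comp (hsnd ⟨k, hk⟩).continuousOn
          fun p hp => hp ⟨k, hk⟩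
      unfold blowupCoord
      split_ifs
      · exact hl
      · exact (Complex.continuous_im.comp (hfst k)).continuousOn
      · exact (Complex.continuous_re.comp (hfst k)).continuousOn
      · exact hl
    · simp only [hk, dif_neg, not_false_eq_true]
      split_ifs
      · exact (Complex.continuous_re.comp (hfst k)).continuousOn
      · exact (Complex.continuous_im.comp (hfst k)).continuousOn
  have himg : S.blowupPoint σ ε '' U = V ∩ pointCoord σ ε ⁻¹' U := by
    ext p
    constructor
    · rintro ⟨x, hx, rfl⟩
      have := pointCoord_blowupPoint σ ε x
      exact ⟨this.1, by rwa [Set.mem_preimage, this.2]⟩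
    · rintro ⟨hp, hpU⟩
      exact ⟨_, hpU, blowupPoint_pointCoord hp⟩
  rw [himg]
  exact hc.isOpen_inter_preimage hVo hU

theorem exists_blowupPoint_eq {σ : S.Chart} (p : σ.Blowup) :
    ∃ ε x, S.blowupPoint σ ε x = p := by
  classical
  refine ⟨fun j => if h : StrictlyPositive (σ.1 j) then
    decide ((p.1.2 ⟨j, h⟩).rep.re = 0) else false, _, blowupPoint_pointCoord fun j => ?_⟩
  simp only [j.2, dif_pos]
  by_cases h : (p.1.2 j).rep.re = 0
  · have h1 : (p.1.2 j).rep.im ≠ 0 := fun h2 => (p.1.2 j).rep_nonzero (Complex.ext h h2)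
    simp [Visible, h, h1]
  · simp [Visible, h]

theorem exists_parametrization_eq (q : S.RealBlowup) :
    ∃ σ ε x, S.parametrization σ ε x = q := by
  induction q using Quot.ind with
  | mk p =>
    obtain ⟨σ, p⟩ := p
    obtain ⟨ε, x, rfl⟩ := exists_blowupPoint_eq p
    exact ⟨σ, ε, x, rfl⟩

/-- In the chart `τ` the image of an open set is the union, over the affine charts, of its preimages
under the coordinate changes. -/
theorem isOpenMap_parametrization (σ : S.Chart) (ε : Fin n → Bool) :
    IsOpenMap (S.parametrization σ ε) := by
  intro U hU
  change IsOpen ((Quot.mk glueBlowup) ⁻¹' (S.parametrization σ ε '' U))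
  rw [isOpen_sigma_iff]
  intro τ
  have h : (Sigma.mk τ ⁻¹' (Quot.mk glueBlowup ⁻¹' (S.parametrization σ ε '' U))) =
      ⋃ δ, S.blowupPoint τ δ ''
        (changeDomain τ σ δ ε ∩ coordChange τ σ δ ε ⁻¹' U) := by
    ext p
    simp only [Set.mem_iUnion]
    constructor
    · rintro ⟨x, hx, hxp⟩
      obtain ⟨δ, y, rfl⟩ := exists_blowupPoint_eq p
      have := parametrization_eq_iff_coordChange.1
        (hxp.symm : S.parametrization τ δ y = S.parametrization σ ε x)
      exact ⟨δ, y, ⟨this.1, by rwa [Set.mem_preimage, this.2]⟩, rfl⟩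
    · rintro ⟨δ, y, ⟨hy, hyU⟩, rfl⟩
      exact ⟨_, hyU, (parametrization_eq_iff_coordChange.2 ⟨hy, rfl⟩).symm⟩
  rw [h]
  refine isOpen_iUnion fun δ => isOpenMap_blowupPoint τ δ _ ?_
  exact ContinuousOn.isOpen_inter_preimage
    (fun y hy => (analyticAt_coordChange hy).continuousAt.continuousWithinAt)
    (isOpen_changeDomain τ σ δ ε) hU

theorem isOpenEmbedding_parametrization (σ : S.Chart) (ε : Fin n → Bool) :
    IsOpenEmbedding (S.parametrization σ ε) :=
  .of_continuous_injective_isOpenMap (continuous_parametrization σ ε)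
    (injective_parametrization σ ε) (isOpenMap_parametrization σ ε)

/-! ### The real analytic structure of the real blowing-up -/

/-- The standard coordinate system, the inverse of the parametrization. -/
def stdChart (σ : S.Chart) (ε : Fin n → Bool) :
    OpenPartialHomeomorph S.RealBlowup (RealSpace n) :=
  ((isOpenEmbedding_parametrization σ ε).toOpenPartialHomeomorph _).symm

theorem stdChart_target (σ : S.Chart) (ε : Fin n → Bool) : (stdChart σ ε).target = univ := rfl

theorem stdChart_source (σ : S.Chart) (ε : Fin n → Bool) :
    (stdChart σ ε).source = range (S.parametrization σ ε) := by
  simp [stdChart]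

theorem stdChart_symm_apply (σ : S.Chart) (ε : Fin n → Bool) (x : RealSpace n) :
    (stdChart σ ε).symm x = S.parametrization σ ε x := rfl

theorem stdChart_parametrization (σ : S.Chart) (ε : Fin n → Bool) (x : RealSpace n) :
    stdChart σ ε (S.parametrization σ ε x) = x :=
  (stdChart σ ε).right_inv (mem_univ x)

theorem parametrization_mem_source (σ : S.Chart) (ε : Fin n → Bool) (x : RealSpace n) :
    S.parametrization σ ε x ∈ (stdChart σ ε).source := by
  rw [stdChart_source]
  exact mem_range_self x

theorem exists_mem_stdChart_source (q : S.RealBlowup) :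
    ∃ i : S.Chart × (Fin n → Bool), q ∈ (stdChart i.1 i.2).source := by
  obtain ⟨σ, ε, x, rfl⟩ := exists_parametrization_eq q
  exact ⟨(σ, ε), parametrization_mem_source σ ε x⟩

instance : ChartedSpace (RealSpace n) S.RealBlowup where
  atlas := range fun i : S.Chart × (Fin n → Bool) => stdChart i.1 i.2
  chartAt q := stdChart (exists_mem_stdChart_source q).choose.1
    (exists_mem_stdChart_source q).choose.2
  mem_chart_source q := (exists_mem_stdChart_source q).choose_spec
  chart_mem_atlas _ := mem_range_self _

theorem isManifold_realBlowup (S : RegularFan n) :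
    IsManifold 𝓘(ℝ, RealSpace n) ω S.RealBlowup := by
  refine isManifold_of_contDiffOn _ _ _ ?_
  rintro _ _ ⟨⟨σ, ε⟩, rfl⟩ ⟨⟨τ, δ⟩, rfl⟩
  simp only [modelWithCornersSelf_coe, modelWithCornersSelf_coe_symm, Function.comp_id,
    Function.id_comp, Set.preimage_id, Set.range_id, Set.inter_univ]
  intro x hx
  have hx' : ∀ y ∈ ((stdChart σ ε).symm.trans (stdChart τ δ)).source,
      y ∈ changeDomain σ τ ε δ ∧
        ((stdChart σ ε).symm.trans (stdChart τ δ)) y = coordChange σ τ ε δ y := by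
    intro y hy
    rw [OpenPartialHomeomorph.trans_source] at hy
    have h2 : (stdChart σ ε).symm y ∈ (stdChart τ δ).source := hy.2
    rw [stdChart_source, stdChart_symm_apply] at h2
    obtain ⟨z, hz⟩ := h2
    have h3 := parametrization_eq_iff_coordChange.1 hz.symm
    refine ⟨h3.1, ?_⟩
    rw [OpenPartialHomeomorph.trans_apply, stdChart_symm_apply, ← hz, stdChart_parametrization,
      h3.2]
  refine ContDiffWithinAt.congr (f := coordChange σ τ ε δ) ?_ (fun y hy => (hx' y hy).2)
    (hx' x hx).2
  exact (analyticAt_coordChange (hx' x hx).1).contDiffAt.contDiffWithinAt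

theorem stdChart_mem_analyticCharts (σ : S.Chart) (ε : Fin n → Bool) :
    stdChart σ ε ∈ analyticCharts n S.RealBlowup :=
  have := isManifold_realBlowup S
  IsManifold.subset_maximalAtlas ⟨(σ, ε), rfl⟩

theorem isStandardStructure_realBlowup (S : RegularFan n) : S.IsStandardStructure := fun σ ε =>
  ⟨stdChart σ ε, stdChart_mem_analyticCharts σ ε, stdChart_target σ ε, stdChart_symm_apply σ ε⟩

theorem secondCountable_realBlowup (S : RegularFan n) :
    SecondCountableTopology S.RealBlowup := by
  have := S.finite_chart
  have : ∀ i : S.Chart × (Fin n → Bool),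
      SecondCountableTopology (range (S.parametrization i.1 i.2)) := fun i =>
    (isOpenEmbedding_parametrization i.1 i.2).isEmbedding.toHomeomorph.symm.secondCountableTopology
  refine TopologicalSpace.secondCountableTopology_of_countable_cover
    (U := fun i : S.Chart × (Fin n → Bool) => range (S.parametrization i.1 i.2))
    (fun i => (isOpenEmbedding_parametrization i.1 i.2).isOpen_range) ?_
  refine eq_univ_of_forall fun q => ?_
  obtain ⟨σ, ε, x, rfl⟩ := exists_parametrization_eq q
  exact mem_iUnion.2 ⟨(σ, ε), mem_range_self x⟩

/-! ### Separation -/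

/-- The absolute value of the "monomial" with real exponents given by a linear form `m` that
vanishes on the common vertices of `σ` and `τ`, computed in both charts. -/
theorem prod_rpow_mul_prod_rpow_eq_one {σ τ : S.Chart} {u : Cn n}
    (hu : ∀ j, u j = 0 → σ.1 j ∈ τ.verts) (m : StrongDual ℝ (Fin n → ℝ))
    (hm : ∀ j, σ.1 j ∈ τ.verts → m (realWeight (σ.1 j)) = 0) :
    (∏ j, ‖u j‖ ^ m (realWeight (σ.1 j))) *
      ∏ k, ‖monomialMap (transition σ τ) u k‖ ^ (-m (realWeight (τ.1 k))) = 1 := by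
  have h1 : ∀ k, ‖monomialMap (transition σ τ) u k‖ ^ (-m (realWeight (τ.1 k))) =
      ∏ j, ‖u j‖ ^ ((transition σ τ k j : ℝ) * (-m (realWeight (τ.1 k)))) := by
    intro k
    rw [monomialMap, norm_prod, ← Real.finsetProd_rpow _ _ fun i _ => norm_nonneg _]
    refine Finset.prod_congr rfl fun j _ => ?_
    rw [Real.rpow_mul (norm_nonneg _), Real.rpow_intCast, norm_zpow]
  simp only [h1]
  rw [Finset.prod_comm, ← Finset.prod_mul_distrib]
  refine Finset.prod_eq_one fun j _ => ?_
  by_cases h0 : u j = 0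
  · have hj := hu j h0
    obtain ⟨l, -, hl⟩ := Finset.mem_image.1 hj
    rw [hm j hj, Real.rpow_zero, one_mul]
    refine Finset.prod_eq_one fun k _ => ?_
    rw [transition_apply_of_eq hl.symm]
    split_ifs with hkl
    · rw [hkl, hl, hm j hj]
      simp
    · simp
  · have hpos : 0 < ‖u j‖ := norm_pos_iff.2 h0
    rw [← Real.rpow_sum_of_pos hpos, ← Real.rpow_add hpos]
    have h2 := congrArg m (realWeight_eq_sum_transition σ τ j)
    rw [map_sum] at h2
    simp only [map_smul, smul_eq_mul] at h2
    rw [h2, ← Finset.sum_add_distrib]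
    simp

theorem isClosed_setOf_parametrization_eq (σ τ : S.Chart) (ε δ : Fin n → Bool) :
    IsClosed {z : RealSpace n × RealSpace n |
      S.parametrization σ ε z.1 = S.parametrization τ δ z.2} := by
  rw [← isSeqClosed_iff_isClosed]
  intro z z₀ hz hlim
  have hx : Tendsto (fun i => (z i).1) atTop (𝓝 z₀.1) := (continuous_fst.tendsto _).comp hlim
  have hy : Tendsto (fun i => (z i).2) atTop (𝓝 z₀.2) := (continuous_snd.tendsto _).comp hlim
  have hz' := fun i => parametrization_eq_iff.1 (hz i)
  have hw : ∀ j, chartCoord σ ε z₀.1 j = 0 → σ.1 j ∈ τ.verts := by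
    intro j hj
    by_contra hjτ
    -- the monomial in the absolute values given by a separating form is identically `1` on the
    -- gluing relation and continuous, but vanishes in the limit
    obtain ⟨m, hm0, hm1, hm2⟩ := exists_separating σ τ
    have ha : ∀ i, 0 ≤ m (realWeight (σ.1 i)) := fun i => by
      by_cases h : σ.1 i ∈ τ.verts
      · exact (hm0 i h).ge
      · exact (hm1 i h).le
    have hb : ∀ k, 0 ≤ -m (realWeight (τ.1 k)) := fun k => by
      by_cases h : τ.1 k ∈ σ.verts
      · obtain ⟨i, -, hi⟩ := Finset.mem_image.1 h
        rw [← hi, hm0 i (by rw [hi]; exact τ.mem_verts k), neg_zero]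
      · exact (neg_pos.2 (hm2 k h)).le
    set g : RealSpace n × RealSpace n → ℝ := fun w =>
      (∏ i, ‖chartCoord σ ε w.1 i‖ ^ m (realWeight (σ.1 i))) *
        ∏ k, ‖chartCoord τ δ w.2 k‖ ^ (-m (realWeight (τ.1 k))) with hg
    have hgc : Continuous g := by
      refine (continuous_finsetProd _ fun i _ => ?_).mul (continuous_finsetProd _ fun k _ => ?_)
      · exact (Real.continuous_rpow_const (ha i)).comp
          (((continuous_apply i).comp ((continuous_chartCoord σ ε).comp continuous_fst)).norm)
      · exact (Real.continuous_rpow_const (hb k)).comp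
          (((continuous_apply k).comp ((continuous_chartCoord τ δ).comp continuous_snd)).norm)
    have hg1 : ∀ i, g (z i) = 1 := fun i => by
      rw [hg]
      dsimp only
      rw [(hz' i).2.1]
      exact prod_rpow_mul_prod_rpow_eq_one (hz' i).1 m hm0
    have h1 : g z₀ = 1 := tendsto_nhds_unique ((hgc.tendsto z₀).comp hlim)
      (by simp only [Function.comp_def, hg1]; exact tendsto_const_nhds)
    have h0 : g z₀ = 0 := by
      refine mul_eq_zero_of_left (Finset.prod_eq_zero (Finset.mem_univ j) ?_) _
      rw [hj, norm_zero, Real.zero_rpow (hm1 j hjτ).ne']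
    exact one_ne_zero (h1.symm.trans h0)
  refine parametrization_eq_iff.2 ⟨hw, ?_, fun k hk => ?_⟩
  · funext k
    refine tendsto_nhds_unique (f := fun i => chartCoord τ δ (z i).2 k) (l := atTop) ?_ ?_
    · exact (((continuous_apply k).comp (continuous_chartCoord τ δ)).tendsto _).comp hy
    · simp only [(hz' _).2.1]
      exact ((analyticAt_monomialMap_transition hw k).continuousAt.tendsto).comp hx
  · refine tendsto_nhds_unique (f := fun i => ((starRingEnd ℂ) (dirVec δ (z i).2 k) *
      lineVec σ τ ε (z i).1 k).im) (l := atTop) ?_ ?_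
    · refine (Complex.continuous_im.tendsto _).comp (Tendsto.mul ?_ ?_)
      · exact (Complex.continuous_conj.tendsto _).comp (((continuous_dirVec δ k).tendsto _).comp hy)
      · exact ((analyticAt_lineVec hw k).continuousAt.tendsto).comp hx
    · simp only [(hz' _).2.2 k hk]
      exact tendsto_const_nhds

theorem t2Space_realBlowup (S : RegularFan n) : T2Space S.RealBlowup := by
  refine ⟨fun p q hpq => ?_⟩
  obtain ⟨σ, ε, x, rfl⟩ := exists_parametrization_eq p
  obtain ⟨τ, δ, y, rfl⟩ := exists_parametrization_eq q
  have h := (isClosed_setOf_parametrization_eq σ τ ε δ).isOpen_compl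
  obtain ⟨U, V, hU, hV, hx, hy, hUV⟩ := isOpen_prod_iff.1 h x y hpq
  refine ⟨_, _, isOpenMap_parametrization σ ε U hU, isOpenMap_parametrization τ δ V hV,
    mem_image_of_mem _ hx, mem_image_of_mem _ hy, ?_⟩
  rw [Set.disjoint_left]
  rintro _ ⟨a, ha, rfl⟩ ⟨b, hb, hab⟩
  exact hUV (Set.mk_mem_prod ha hb) hab.symm

end RegularFan

/-! ### Analyticity of absolutely convergent families of monomials -/

/-- The monomial `y ^ e` as the restriction to the diagonal of a multilinear form of norm at
most `1`. -/
theorem exists_multilinear_monomial {L : Type*} [Fintype L] (e : L → ℕ) {k : ℕ}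
    (h : ∑ l, e l = k) :
    ∃ M : ContinuousMultilinearMap ℂ (fun _ : Fin k => L → ℂ) ℂ, ‖M‖ ≤ 1 ∧
      ∀ y, M (fun _ => y) = ∏ l, y l ^ e l := by
  classical
  have hc : Fintype.card (Σ l, Fin (e l)) = k := by simp [h]
  set φ := (Fintype.equivFinOfCardEq hc).symm
  refine ⟨(ContinuousMultilinearMap.mkPiAlgebra ℂ (Fin k) ℂ).compContinuousLinearMap
    fun i => ContinuousLinearMap.proj (φ i).1, ?_, fun y => ?_⟩
  · refine ContinuousMultilinearMap.opNorm_le_bound zero_le_one fun v => ?_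
    simp only [ContinuousMultilinearMap.compContinuousLinearMap_apply,
      ContinuousMultilinearMap.mkPiAlgebra_apply, ContinuousLinearMap.proj_apply, one_mul,
      norm_prod]
    exact Finset.prod_le_prod (fun _ _ => norm_nonneg _) fun i _ => norm_le_pi_norm (v i) _
  · simp only [ContinuousMultilinearMap.compContinuousLinearMap_apply,
      ContinuousMultilinearMap.mkPiAlgebra_apply, ContinuousLinearMap.proj_apply]
    rw [Equiv.prod_comp φ fun s => y s.1, Fintype.prod_sigma]
    simp

theorem analyticAt_tsum_monomial_of_norm_lt_one {α L : Type*} [Fintype L] {a : α → ℂ}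
    (e : α → L → ℕ) (ha : Summable fun p => ‖a p‖) {y : L → ℂ} (hy : ‖y‖ < 1) :
    AnalyticAt ℂ (fun y : L → ℂ => ∑' p, a p * ∏ l, y l ^ e p l) y := by
  choose M hM hMy using fun (k : ℕ) (p : {p // ∑ l, e p l = k}) =>
    exists_multilinear_monomial (e p.1) p.2
  set q : FormalMultilinearSeries ℂ (L → ℂ) ℂ := fun k => ∑' p, a p.1 • M k p with hq
  have hsub : ∀ k, Summable fun p : {p // ∑ l, e p l = k} => ‖a p.1‖ := fun k =>
    ha.comp_injective Subtype.val_injective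
  have hle : ∀ k p, ‖a p.1 • M k p‖ ≤ ‖a p.1‖ := fun k p => by
    rw [norm_smul]
    exact mul_le_of_le_one_right (norm_nonneg _) (hM k p)
  have hsum : ∀ k, Summable fun p => a p.1 • M k p := fun k =>
    Summable.of_norm_bounded (hsub k) (hle k)
  have hball : HasFPowerSeriesOnBall (fun y : L → ℂ => ∑' p, a p * ∏ l, y l ^ e p l) q 0 1 := by
    refine ⟨?_, one_pos, fun {y} hy => ?_⟩
    · refine q.le_radius_of_bound (r := 1) (∑' p, ‖a p‖) fun k => ?_
      rw [NNReal.coe_one, one_pow, mul_one]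
      refine (norm_tsum_le_tsum_norm (Summable.of_nonneg_of_le (fun _ => norm_nonneg _) (hle k)
        (hsub k))).trans ?_
      refine (Summable.tsum_le_tsum (hle k) (Summable.of_nonneg_of_le (fun _ => norm_nonneg _)
        (hle k) (hsub k)) (hsub k)).trans ?_
      exact Summable.tsum_subtype_le (fun p => ‖a p‖) _ (fun _ => norm_nonneg _) ha
    · rw [zero_add]
      have hy1 : ‖y‖ ≤ 1 := by
        rw [mem_eball_zero_iff] at hy
        have : ENNReal.ofReal ‖y‖ < 1 := by rwa [ofReal_norm]
        exact (ENNReal.ofReal_lt_one.1 this).le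
      have hs : Summable fun p => a p * ∏ l, y l ^ e p l := by
        refine Summable.of_norm_bounded ha fun p => ?_
        rw [norm_mul, norm_prod]
        refine mul_le_of_le_one_right (norm_nonneg _) (Finset.prod_le_one
          (fun _ _ => norm_nonneg _) fun l _ => ?_)
        rw [norm_pow]
        exact pow_le_one₀ (norm_nonneg _) ((norm_le_pi_norm y l).trans hy1)
      have h1 := (Equiv.hasSum_iff (Equiv.sigmaFiberEquiv fun p => ∑ l, e p l)).2 hs.hasSum
      refine h1.sigma fun k => ?_
      have h2 := (ContinuousMultilinearMap.apply ℂ (fun _ : Fin k => L → ℂ) ℂ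
        fun _ => y).hasSum (hsum k).hasSum
      simpa [Function.comp_def, hMy] using h2
  refine hball.analyticAt_of_mem ?_
  rw [mem_eball_zero_iff, ← ofReal_norm]
  exact ENNReal.ofReal_lt_one.2 hy

/-- A family of monomials that converges absolutely at `R` defines an analytic function on the
open polydisc of polyradius `R`. -/
theorem analyticAt_tsum_monomial {α L : Type*} [Fintype L] {a : α → ℂ} (e : α → L → ℕ)
    {R : L → ℝ} (hR : ∀ l, 0 < R l) (ha : Summable fun p => ‖a p‖ * ∏ l, R l ^ e p l)
    {y : L → ℂ} (hy : ∀ l, ‖y l‖ < R l) :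
    AnalyticAt ℂ (fun y : L → ℂ => ∑' p, a p * ∏ l, y l ^ e p l) y := by
  have ha' : Summable fun p => ‖a p * ∏ l, (R l : ℂ) ^ e p l‖ := by
    convert ha using 2 with p
    rw [norm_mul, norm_prod]
    congr 1
    refine Finset.prod_congr rfl fun l _ => ?_
    rw [norm_pow, Complex.norm_real, Real.norm_of_nonneg (hR l).le]
  set T : (L → ℂ) →L[ℂ] (L → ℂ) :=
    ContinuousLinearMap.pi fun l => (R l : ℂ)⁻¹ • ContinuousLinearMap.proj l with hT
  have hTy : ∀ y l, T y l = (R l : ℂ)⁻¹ * y l := fun y l => rfl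
  have h1 : ‖T y‖ < 1 := by
    rw [pi_norm_lt_iff one_pos]
    intro l
    rw [hTy, norm_mul, norm_inv, Complex.norm_real, Real.norm_of_nonneg (hR l).le,
      inv_mul_lt_one₀ (hR l)]
    exact hy l
  have h2 := (analyticAt_tsum_monomial_of_norm_lt_one e ha' h1).comp (T.analyticAt y)
  convert h2 using 2 with y'
  refine tsum_congr fun p => ?_
  rw [mul_assoc, ← Finset.prod_mul_distrib]
  congr 1
  refine Finset.prod_congr rfl fun l _ => ?_
  rw [hTy, ← mul_pow, mul_inv_cancel_left₀]
  exact_mod_cast (hR l).ne'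

/-! ### Mixed power series -/

theorem norm_mixedMonomial {n : ℕ} (ν μ : Fin n → ℕ) (z : Cn n) :
    ‖mixedMonomial ν μ z‖ = ∏ i, ‖z i‖ ^ (ν i + μ i) := by
  simp [mixedMonomial, norm_prod, pow_add]

theorem HasMixedExpansion.exists_radius {n : ℕ} {f : Cn n → ℂ}
    {c : (Fin n → ℕ) → (Fin n → ℕ) → ℂ} (hf : HasMixedExpansion f c) :
    ∃ r : ℝ, 0 < r ∧ Summable (fun p : (Fin n → ℕ) × (Fin n → ℕ) =>
      ‖c p.1 p.2‖ * ∏ i, r ^ (p.1 i + p.2 i)) := by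
  obtain ⟨r, hr, h⟩ := Metric.eventually_nhds_iff.1 hf
  refine ⟨r / 2, half_pos hr, ?_⟩
  have h1 := h (y := fun _ => ((r / 2 : ℝ) : ℂ)) (by
    rw [dist_zero_right]
    refine (pi_norm_lt_iff hr).2 fun i => ?_
    rw [Complex.norm_real, Real.norm_of_nonneg (half_pos hr).le]
    exact half_lt_self hr)
  convert h1.summable.norm using 2 with p
  rw [norm_mul, norm_mixedMonomial]
  simp only [Complex.norm_real, Real.norm_of_nonneg (half_pos hr).le]

/-- A mixed analytic function is real analytic near the origin. -/
theorem HasMixedExpansion.eventually_analyticAt {n : ℕ} {f : Cn n → ℂ}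
    {c : (Fin n → ℕ) → (Fin n → ℕ) → ℂ} (hf : HasMixedExpansion f c) :
    ∀ᶠ z in 𝓝 (0 : Cn n), AnalyticAt ℝ f z := by
  obtain ⟨r, hr, hs⟩ := hf.exists_radius
  have hball : ∀ᶠ z in 𝓝 (0 : Cn n), ‖z‖ < r := by
    have := Metric.ball_mem_nhds (0 : Cn n) hr
    filter_upwards [this] with z hz
    simpa using hz
  filter_upwards [hf.eventually_nhds, hball] with z hz hzr
  have hs' : Summable fun p : (Fin n → ℕ) × (Fin n → ℕ) =>
      ‖c p.1 p.2‖ * ∏ l : Fin n ⊕ Fin n, (fun _ => r) l ^ (Sum.elim p.1 p.2 l) := by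
    convert hs using 3 with p
    simp [Fintype.prod_sum_type, pow_add, Finset.prod_mul_distrib]
  set Y : Cn n → (Fin n ⊕ Fin n → ℂ) := fun z => Sum.elim z fun i => (starRingEnd ℂ) (z i) with hY
  have hYa : AnalyticAt ℝ Y z := by
    rw [analyticAt_pi_iff]
    rintro (i | i)
    · exact (ContinuousLinearMap.proj (R := ℝ) (φ := fun _ : Fin n => ℂ) i).analyticAt z
    · exact (Complex.conjCLE.analyticAt _).comp
        ((ContinuousLinearMap.proj (R := ℝ) (φ := fun _ : Fin n => ℂ) i).analyticAt z)
  have h1 := (analyticAt_tsum_monomial (a := fun p : (Fin n → ℕ) × (Fin n → ℕ) => c p.1 p.2)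
    (fun p => Sum.elim p.1 p.2) (fun _ => hr) hs' (y := Y z) (by
      rintro (i | i)
      · exact (norm_le_pi_norm z i).trans_lt hzr
      · simpa [hY] using (norm_le_pi_norm z i).trans_lt hzr)).restrictScalars (𝕜 := ℝ)
  refine (h1.comp hYa).congr ?_
  filter_upwards [hz] with z' hz'
  rw [← hz'.tsum_eq]
  refine tsum_congr fun p => ?_
  simp [hY, mixedMonomial, Fintype.prod_sum_type, Finset.prod_mul_distrib]

/-! ### Faces of the Newton boundary -/

section Newton

variable {n : ℕ} {c : (Fin n → ℕ) → (Fin n → ℕ) → ℂ}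

/-- The radial support: the exponents `ν + μ` of the monomials that occur. -/
def radialSupport (c : (Fin n → ℕ) → (Fin n → ℕ) → ℂ) : Set (Fin n → ℕ) :=
  {v | ∃ ν μ, c ν μ ≠ 0 ∧ v = ν + μ}

theorem add_mem_radialSupport {ν μ : Fin n → ℕ} (h : c ν μ ≠ 0) : ν + μ ∈ radialSupport c :=
  ⟨ν, μ, h, rfl⟩

theorem radialDegree_le {v : Fin n → ℕ} (hv : v ∈ radialSupport c) (P : Fin n → ℕ) :
    radialDegree c P ≤ ∑ i, P i * v i := by
  obtain ⟨ν, μ, h, rfl⟩ := hv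
  exact Nat.sInf_le ⟨ν, μ, h, rfl⟩

theorem le_radialDegree {P : Fin n → ℕ} {d : ℕ} (hne : (radialSupport c).Nonempty)
    (h : ∀ v ∈ radialSupport c, d ≤ ∑ i, P i * v i) : d ≤ radialDegree c P := by
  refine le_csInf ?_ ?_
  · obtain ⟨_, ν, μ, h, rfl⟩ := hne
    exact ⟨_, ν, μ, h, rfl⟩
  · rintro _ ⟨ν, μ, h', rfl⟩
    exact h _ (add_mem_radialSupport h')

theorem finite_weight_le {Q : Fin n → ℝ} (hQ : ∀ i, 0 < Q i) (C : ℝ) :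
    {v : Fin n → ℕ | ∑ i, Q i * realWeight v i ≤ C}.Finite := by
  refine (Set.finite_Icc (0 : Fin n → ℕ) fun i => ⌊C / Q i⌋₊).subset fun v hv => ⟨?_, fun i => ?_⟩
  · exact fun i => Nat.zero_le _
  · refine Nat.le_floor ?_
    rw [le_div_iff₀ (hQ i), mul_comm]
    refine le_trans ?_ hv
    exact Finset.single_le_sum (f := fun i => Q i * realWeight v i)
      (fun i _ => mul_nonneg (hQ i).le (Nat.cast_nonneg _)) (Finset.mem_univ i)

theorem exists_minimal_weight {Q : Fin n → ℝ} (hQ : ∀ i, 0 < Q i)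
    (hne : (radialSupport c).Nonempty) :
    ∃ v ∈ radialSupport c, ∀ w ∈ radialSupport c,
      ∑ i, Q i * realWeight v i ≤ ∑ i, Q i * realWeight w i := by
  obtain ⟨v₀, hv₀⟩ := hne
  obtain ⟨v, ⟨hv, hvle⟩, hmin⟩ := Set.exists_min_image
    (radialSupport c ∩ {v | ∑ i, Q i * realWeight v i ≤ ∑ i, Q i * realWeight v₀ i})
    (fun v => ∑ i, Q i * realWeight v i) ((finite_weight_le hQ _).subset Set.inter_subset_right)
    ⟨v₀, hv₀, le_refl (∑ i, Q i * realWeight v₀ i)⟩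
  refine ⟨v, hv, fun w hw => ?_⟩
  by_cases h : ∑ i, Q i * realWeight w i ≤ ∑ i, Q i * realWeight v₀ i
  · exact hmin w ⟨hw, h⟩
  · exact le_trans hvle (le_of_not_ge h)

theorem realWeight_mem_newtonPolygon {v : Fin n → ℕ} (hv : v ∈ radialSupport c) :
    realWeight v ∈ newtonPolygon c := by
  obtain ⟨ν, μ, h, rfl⟩ := hv
  exact subset_convexHull ℝ _ ⟨ν, μ, h, fun i => le_rfl⟩

/-- If `v` has minimal positive weight among the exponents that occur, then the face of minimal
weight of the Newton polygon is spanned by the finitely many exponents of that weight. -/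
theorem newtonPolygon_subset {Q : Fin n → ℝ} (hQ : ∀ i, 0 < Q i) {v : Fin n → ℕ}
    (hmin : ∀ w ∈ radialSupport c, ∑ i, Q i * realWeight v i ≤ ∑ i, Q i * realWeight w i) :
    newtonPolygon c ⊆ {x | ∑ i, Q i * realWeight v i < ∑ i, Q i * x i} ∪
      convexHull ℝ (realWeight '' (radialSupport c ∩
        {w | ∑ i, Q i * realWeight w i = ∑ i, Q i * realWeight v i})) := by
  set m := ∑ i, Q i * realWeight v i with hm
  set T := realWeight '' (radialSupport c ∩ {w | ∑ i, Q i * realWeight w i = m}) with hT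
  have hlin : ∀ (a b : ℝ) (x y : Fin n → ℝ),
      ∑ i, Q i * (a • x + b • y) i = a * ∑ i, Q i * x i + b * ∑ i, Q i * y i := by
    intro a b x y
    simp only [Pi.add_apply, Pi.smul_apply, smul_eq_mul, Finset.mul_sum, ← Finset.sum_add_distrib]
    exact Finset.sum_congr rfl fun i _ => by ring
  have hTm : ∀ x ∈ convexHull ℝ T, ∑ i, Q i * x i = m := by
    have hconv : Convex ℝ {x : Fin n → ℝ | ∑ i, Q i * x i = m} := by
      intro x hx y hy a b _ _ hab
      simp only [Set.mem_ofPred_eq] at hx hy ⊢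
      rw [hlin, hx, hy, ← add_mul, hab, one_mul]
    refine fun x hx => convexHull_min ?_ hconv hx
    rintro _ ⟨w, hw, rfl⟩
    exact hw.2
  refine convexHull_min ?_ ?_
  · rintro x ⟨ν, μ, hc, hx⟩
    have h1 := hmin _ (add_mem_radialSupport hc)
    have h2 : ∑ i, Q i * realWeight (ν + μ) i ≤ ∑ i, Q i * x i :=
      Finset.sum_le_sum fun i _ => mul_le_mul_of_nonneg_left (hx i) (hQ i).le
    rcases (h1.trans h2).lt_or_eq with h | h
    · exact Or.inl h
    · right
      have h3 : ∑ i, Q i * realWeight (ν + μ) i = ∑ i, Q i * x i := le_antisymm h2 (h ▸ h1)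
      have h4 : realWeight (ν + μ) = x := by
        funext i
        have := (Finset.sum_eq_sum_iff_of_le fun i _ =>
          mul_le_mul_of_nonneg_left (hx i) (hQ i).le).1 h3 i (Finset.mem_univ i)
        exact mul_left_cancel₀ (hQ i).ne' this
      rw [← h4]
      exact subset_convexHull ℝ _ ⟨_, ⟨add_mem_radialSupport hc, h3.trans h.symm⟩, rfl⟩
  · intro x hx y hy a b ha hb hab
    have hge : ∀ z ∈ {x : Fin n → ℝ | m < ∑ i, Q i * x i} ∪ convexHull ℝ T,
        m ≤ ∑ i, Q i * z i := by
      rintro z (hz | hz)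
      · exact le_of_lt hz
      · exact (hTm z hz).ge
    rcases ha.eq_or_lt with rfl | ha
    · rw [zero_add] at hab
      simpa [hab] using hy
    rcases hb.eq_or_lt with rfl | hb
    · rw [add_zero] at hab
      simpa [hab] using hx
    have hx' := hge x hx
    have hy' := hge y hy
    have hmab : m = a * m + b * m := by rw [← add_mul, hab, one_mul]
    rcases hx with hx | hx
    · left
      simp only [Set.mem_ofPred_eq] at hx ⊢
      rw [hlin, hmab]
      exact add_lt_add_of_lt_of_le (mul_lt_mul_of_pos_left hx ha)
        (mul_le_mul_of_nonneg_left hy' hb.le)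
    · rcases hy with hy | hy
      · left
        simp only [Set.mem_ofPred_eq] at hy ⊢
        rw [hlin, hmab]
        exact add_lt_add_of_le_of_lt (mul_le_mul_of_nonneg_left hx' ha.le)
          (mul_lt_mul_of_pos_left hy hb)
      · exact Or.inr (convex_convexHull ℝ T hx hy ha.le hb.le hab)

theorem weight_le_of_mem_newtonPolygon {Q : Fin n → ℝ} (hQ : ∀ i, 0 < Q i) {v : Fin n → ℕ}
    (hmin : ∀ w ∈ radialSupport c, ∑ i, Q i * realWeight v i ≤ ∑ i, Q i * realWeight w i)
    {x : Fin n → ℝ} (hx : x ∈ newtonPolygon c) :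
    ∑ i, Q i * realWeight v i ≤ ∑ i, Q i * x i := by
  have hconv : Convex ℝ {x : Fin n → ℝ | ∑ i, Q i * realWeight v i ≤ ∑ i, Q i * x i} := by
    refine convex_halfSpace_ge (f := fun x : Fin n → ℝ => ∑ i, Q i * x i) ⟨fun x y => ?_,
      fun a x => ?_⟩ _
    · simp [mul_add, Finset.sum_add_distrib]
    · simp [Finset.mul_sum, mul_left_comm]
  refine convexHull_min ?_ hconv hx
  rintro y ⟨ν, μ, hc, hy⟩
  exact (hmin _ (add_mem_radialSupport hc)).trans
    (Finset.sum_le_sum fun i _ => mul_le_mul_of_nonneg_left (hy i) (hQ i).le)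

theorem realWeight_mem_newtonBoundary {Q : Fin n → ℝ} (hQ : ∀ i, 0 < Q i) {v : Fin n → ℕ}
    (hv : v ∈ radialSupport c)
    (hmin : ∀ w ∈ radialSupport c, ∑ i, Q i * realWeight v i ≤ ∑ i, Q i * realWeight w i) :
    realWeight v ∈ newtonBoundary c := by
  set T := realWeight '' (radialSupport c ∩
    {w | ∑ i, Q i * realWeight w i = ∑ i, Q i * realWeight v i}) with hT
  set l : StrongDual ℝ (Fin n → ℝ) := -∑ i, Q i • ContinuousLinearMap.proj i with hl
  have hlx : ∀ x, l x = -∑ i, Q i * x i := fun x => by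
    simp [hl]
  have hv' := realWeight_mem_newtonPolygon hv
  have hvT : realWeight v ∈ T := ⟨v, ⟨hv, rfl⟩, rfl⟩
  have hF : {x ∈ newtonPolygon c | ∀ y ∈ newtonPolygon c, l y ≤ l x} = convexHull ℝ T := by
    apply Set.Subset.antisymm
    · rintro x ⟨hx, hxm⟩
      have h1 := hxm _ hv'
      rw [hlx, hlx, neg_le_neg_iff] at h1
      rcases newtonPolygon_subset hQ hmin hx with h | h
      · exact absurd h (not_lt.2 h1)
      · exact h
    · have hconv : Convex ℝ {x ∈ newtonPolygon c | ∀ y ∈ newtonPolygon c, l y ≤ l x} := by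
        have : IsExposed ℝ (newtonPolygon c)
          {x ∈ newtonPolygon c | ∀ y ∈ newtonPolygon c, l y ≤ l x} := fun _ => ⟨l, rfl⟩
        exact this.convex (convex_convexHull ℝ _)
      refine convexHull_min ?_ hconv
      rintro _ ⟨w, ⟨hw, hwm⟩, rfl⟩
      refine ⟨realWeight_mem_newtonPolygon hw, fun y hy => ?_⟩
      rw [hlx, hlx, neg_le_neg_iff]
      exact (le_of_eq hwm).trans (weight_le_of_mem_newtonPolygon hQ hmin hy)
  refine Set.mem_sUnion.2 ⟨_, ⟨fun _ => ⟨l, rfl⟩, ?_⟩, hF ▸ subset_convexHull ℝ T hvT⟩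
  rw [hF]
  refine Set.Finite.isCompact_convexHull ℝ (Set.Finite.image _ ?_)
  exact (finite_weight_le hQ _).subset fun w hw => le_of_eq hw.2

/-- For a strictly positive weight, the exponents that lie on the face `Δ(Q)` are those of minimal
weight. -/
theorem realWeight_mem_newtonFace_iff {Q : Fin n → ℝ} (hQ : ∀ i, 0 < Q i) {v : Fin n → ℕ}
    (hv : v ∈ radialSupport c) :
    realWeight v ∈ newtonFace c Q ↔
      ∀ w ∈ radialSupport c, ∑ i, Q i * realWeight v i ≤ ∑ i, Q i * realWeight w i := by
  constructor
  · intro h w hw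
    obtain ⟨v₀, hv₀, hmin⟩ := exists_minimal_weight hQ ⟨v, hv⟩
    exact (h.2 _ (realWeight_mem_newtonBoundary hQ hv₀ hmin)).trans (hmin w hw)
  · intro hmin
    refine ⟨realWeight_mem_newtonBoundary hQ hv hmin, fun y hy => ?_⟩
    obtain ⟨Δ, ⟨hΔ, -⟩, hyΔ⟩ := hy
    exact weight_le_of_mem_newtonPolygon hQ hmin (hΔ.subset hyΔ)

/-- A convenient function has a monomial on every coordinate axis. -/
theorem IsConvenient.exists_coeff_ne_zero (hn : 0 < n) {f : Cn n → ℂ} (hf : HasMixedExpansion f c)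
    (hconv : IsConvenient f) (i : Fin n) :
    ∃ ν μ, c ν μ ≠ 0 ∧ ∀ k, k ≠ i → (ν + μ) k = 0 := by
  have h : ({i} : Finset (Fin n)) ∈ nonvanishingSubspaces f := hconv {i} (by
    rw [Finset.card_singleton]
    omega)
  obtain ⟨z, ⟨hz, hfz⟩, hs⟩ := (h.and_eventually hf).exists
  by_contra! hcon
  refine hfz (hs.unique ?_)
  convert hasSum_zero with p
  by_cases hp : c p.1 p.2 = 0
  · rw [hp, zero_mul]
  · obtain ⟨k, hki, hk⟩ := hcon _ _ hp
    refine mul_eq_zero_of_right _ (Finset.prod_eq_zero (Finset.mem_univ k) ?_)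
    rw [hz k (by simpa using hki), map_zero, ← pow_add]
    exact zero_pow hk

end Newton

namespace RegularFan

variable {n : ℕ} {S : RegularFan n} {c : (Fin n → ℕ) → (Fin n → ℕ) → ℂ}

/-- The weight vector in the relative interior of the face of `σ` spanned by the vertices `σ_j`,
`j ∈ K`. -/
def faceWeight (σ : S.Chart) (K : Finset (Fin n)) : Fin n → ℕ := ∑ j ∈ K, σ.1 j

theorem sum_faceWeight_mul (σ : S.Chart) (K : Finset (Fin n)) (v : Fin n → ℕ) :
    ∑ i, faceWeight σ K i * v i = ∑ j ∈ K, ∑ i, σ.1 j i * v i := by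
  simp only [faceWeight, Finset.sum_apply, Finset.sum_mul]
  exact Finset.sum_comm

theorem sum_realWeight_mul (P v : Fin n → ℕ) :
    ∑ i, realWeight P i * realWeight v i = ((∑ i, P i * v i : ℕ) : ℝ) := by
  simp [realWeight]

/-- Admissibility of the fan makes the weights of all vertices of a face minimal simultaneously:
`Δ(P)`, `P = ∑ σ_j`, is the common face of the `σ_j`. -/
theorem mem_newtonFace_faceWeight_iff (hadm : S.IsAdmissible c) {σ : S.Chart}
    {K : Finset (Fin n)} (hK : StrictlyPositive (faceWeight σ K)) {v : Fin n → ℕ}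
    (hv : v ∈ radialSupport c) :
    realWeight v ∈ newtonFace c (realWeight (faceWeight σ K)) ↔
      ∀ j ∈ K, ∑ i, σ.1 j i * v i = radialDegree c (σ.1 j) := by
  classical
  have hP : ∀ i, 0 < realWeight (faceWeight σ K) i := fun i => Nat.cast_pos.2 (hK i)
  constructor
  · intro h j hj
    refine le_antisymm (le_radialDegree ⟨v, hv⟩ fun w hw => ?_) (radialDegree_le hv _)
    have hs : K.image σ.1 ∈ S.cones :=
      S.face_mem _ σ.2.2 _ (Finset.image_subset_image (Finset.subset_univ _))
    -- the weights `∑ t_k σ_k` with `t_j = 1` and `t_k = ε` otherwise, as `ε → 0`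
    have hmem : ∀ t : Fin n → ℝ, (∀ k, 0 < t k) →
        (∑ k ∈ K, t k • realWeight (σ.1 k)) ∈ openCone (K.image σ.1) := by
      intro t ht
      have hl : ∀ j, Function.extend σ.1 t 0 (σ.1 j) = t j :=
        fun j => σ.injective.extend_apply _ _ _
      refine ⟨Function.extend σ.1 t 0, fun P hP => ?_, ?_⟩
      · obtain ⟨k, -, rfl⟩ := Finset.mem_image.1 hP
        rw [hl]
        exact ht k
      · rw [Finset.sum_image fun a _ b _ h => σ.injective h]
        exact Finset.sum_congr rfl fun k _ => by rw [hl]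
    have hPc : realWeight (faceWeight σ K) = ∑ k ∈ K, (1 : ℝ) • realWeight (σ.1 k) := by
      funext i
      simp [faceWeight, realWeight]
    have hle : ∀ t : Fin n → ℝ, (∀ k, 0 < t k) →
        ∑ k ∈ K, t k * ((∑ i, σ.1 k i * v i : ℕ) : ℝ) ≤
          ∑ k ∈ K, t k * ((∑ i, σ.1 k i * w i : ℕ) : ℝ) := by
      intro t ht
      have h1 : realWeight v ∈ newtonFace c (∑ k ∈ K, t k • realWeight (σ.1 k)) := by
        have h2 := hPc ▸ hmem (fun _ => 1) fun _ => one_pos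
        rw [← hadm _ hs _ h2 _ (hmem t ht)]
        exact h
      have hpos : ∀ i, 0 < (∑ k ∈ K, t k • realWeight (σ.1 k)) i := by
        intro i
        rw [Finset.sum_apply]
        have h3 : ∃ k ∈ K, 0 < σ.1 k i := by
          by_contra! h0
          have := hK i
          rw [faceWeight, Finset.sum_apply] at this
          exact this.ne' (Finset.sum_eq_zero fun k hk => Nat.le_zero.1 (h0 k hk))
        obtain ⟨k, hk, hki⟩ := h3
        refine Finset.sum_pos' (fun l _ => mul_nonneg (ht l).le (Nat.cast_nonneg _)) ⟨k, hk, ?_⟩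
        exact mul_pos (ht k) (Nat.cast_pos.2 hki)
      have h4 := (realWeight_mem_newtonFace_iff hpos hv).1 h1 w hw
      have h5 : ∀ u : Fin n → ℕ, ∑ i, (∑ k ∈ K, t k • realWeight (σ.1 k)) i * realWeight u i =
          ∑ k ∈ K, t k * ((∑ i, σ.1 k i * u i : ℕ) : ℝ) := by
        intro u
        simp only [Finset.sum_apply, Pi.smul_apply, smul_eq_mul, Finset.sum_mul]
        rw [Finset.sum_comm]
        refine Finset.sum_congr rfl fun k _ => ?_
        rw [← sum_realWeight_mul, Finset.mul_sum]
        exact Finset.sum_congr rfl fun i _ => mul_assoc _ _ _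
      rwa [h5, h5] at h4
    have hcont : ∀ u : Fin n → ℕ, Tendsto (fun ε : ℝ => ∑ k ∈ K, (if k = j then 1 else ε) *
        ((∑ i, σ.1 k i * u i : ℕ) : ℝ)) (𝓝[>] 0) (𝓝 ((∑ i, σ.1 j i * u i : ℕ) : ℝ)) := by
      intro u
      have h1 : Continuous fun ε : ℝ => ∑ k ∈ K, (if k = j then 1 else ε) *
          ((∑ i, σ.1 k i * u i : ℕ) : ℝ) := by
        refine continuous_finsetSum _ fun k _ => Continuous.mul ?_ continuous_const
        change Continuous fun ε : ℝ => if k = j then (1 : ℝ) else ε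
        by_cases hk : k = j
        · simp only [hk, if_true]
          exact continuous_const
        · simp only [hk, if_false]
          exact continuous_id
      have h2 := h1.tendsto 0
      simp only [ite_mul, one_mul, zero_mul, Finset.sum_ite_eq', hj, if_true] at h2
      refine (h2.mono_left nhdsWithin_le_nhds).congr fun ε => ?_
      exact Finset.sum_congr rfl fun k _ => by split_ifs <;> simp
    have := le_of_tendsto_of_tendsto (hcont v) (hcont w) (by
      filter_upwards [self_mem_nhdsWithin] with ε hε
      refine hle (fun k => if k = j then 1 else ε) fun k => ?_
      split_ifs
      exacts [one_pos, hε])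
    exact_mod_cast this
  · intro h
    rw [realWeight_mem_newtonFace_iff hP hv]
    intro w hw
    rw [sum_realWeight_mul, sum_realWeight_mul, Nat.cast_le, sum_faceWeight_mul,
      sum_faceWeight_mul]
    exact Finset.sum_le_sum fun j hj => (h j hj).trans_le (radialDegree_le hw _)

/-- `d(E_i; f) = 0` if `E_i` is not strictly positive: a monomial on another coordinate axis occurs
and has weight zero. -/
theorem radialDegree_single_eq_zero
    (hax : ∀ i, ∃ ν μ, c ν μ ≠ 0 ∧ ∀ k, k ≠ i → (ν + μ) k = 0) {P : Fin n → ℕ}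
    (hP : StrictlyPositive P ∨ ∃ i, P = Pi.single i 1) (h : ¬StrictlyPositive P) :
    radialDegree c P = 0 := by
  obtain ⟨i, rfl⟩ := hP.resolve_left h
  have h1 : ∃ k, k ≠ i := by
    by_contra! hcon
    exact h fun k => by rw [hcon k]; simp
  obtain ⟨k, hk⟩ := h1
  obtain ⟨ν, μ, hc, h0⟩ := hax k
  have := radialDegree_le (add_mem_radialSupport hc) (Pi.single i 1)
  rw [Finset.sum_eq_zero] at this
  · omega
  · intro l _
    by_cases hl : l = i
    · rw [hl, h0 i hk.symm, mul_zero]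
    · simp [hl]

/-- A face of the fan that meets the open orthant has a strictly positive vertex. -/
theorem exists_strictlyPositive_of_faceWeight (hc : c 0 0 = 0)
    (hax : ∀ i, ∃ ν μ, c ν μ ≠ 0 ∧ ∀ k, k ≠ i → (ν + μ) k = 0) (hadm : S.IsAdmissible c)
    (hvert : ∀ P ∈ S.vertices, StrictlyPositive P ∨ ∃ i, P = Pi.single i 1) (hn : 0 < n)
    {σ : S.Chart} {K : Finset (Fin n)} (hK : StrictlyPositive (faceWeight σ K)) :
    ∃ j ∈ K, StrictlyPositive (σ.1 j) := by
  by_contra! hcon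
  have hne : (radialSupport c).Nonempty := by
    obtain ⟨ν, μ, h, -⟩ := hax ⟨0, hn⟩
    exact ⟨_, add_mem_radialSupport h⟩
  have hP : ∀ i, 0 < realWeight (faceWeight σ K) i := fun i => Nat.cast_pos.2 (hK i)
  -- otherwise every `d(σ_k; f)`, `k ∈ K`, is zero, so that an exponent of minimal weight is zero
  obtain ⟨v, hv, hmin⟩ := exists_minimal_weight hP hne
  have hface := (mem_newtonFace_faceWeight_iff hadm hK hv).1
    ((realWeight_mem_newtonFace_iff hP hv).2 hmin)
  have hv0 : v = 0 := by
    funext i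
    have h3 : ∃ k ∈ K, 0 < σ.1 k i := by
      by_contra! h0
      have := hK i
      rw [faceWeight, Finset.sum_apply] at this
      exact this.ne' (Finset.sum_eq_zero fun k hk => Nat.le_zero.1 (h0 k hk))
    obtain ⟨k, hk, hki⟩ := h3
    have h4 := hface k hk
    rw [radialDegree_single_eq_zero hax (hvert _ (σ.mem_vertices k)) (hcon k hk),
      Finset.sum_eq_zero_iff] at h4
    exact (mul_eq_zero.1 (h4 i (Finset.mem_univ i))).resolve_left hki.ne'
  obtain ⟨ν, μ, hνμ, rfl⟩ := hv
  have h5 : ∀ i, ν i + μ i = 0 := fun i => congrFun hv0 i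
  have h6 : ν = 0 := funext fun i => (Nat.add_eq_zero_iff.1 (h5 i)).1
  have h7 : μ = 0 := funext fun i => (Nat.add_eq_zero_iff.1 (h5 i)).2
  rw [h6, h7] at hνμ
  exact hνμ hc

end RegularFan

/-! ### The face functions as polynomials -/

section FaceFunction

variable {n : ℕ} {c : (Fin n → ℕ) → (Fin n → ℕ) → ℂ}

/-- The exponents of the face function `f_P`. -/
def faceExponents (c : (Fin n → ℕ) → (Fin n → ℕ) → ℂ) (P : Fin n → ℕ) :
    Set ((Fin n → ℕ) × (Fin n → ℕ)) :=
  {p | c p.1 p.2 ≠ 0 ∧ realWeight (p.1 + p.2) ∈ newtonFace c (realWeight P)}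

theorem finite_faceExponents {P : Fin n → ℕ} (hP : StrictlyPositive P) :
    (faceExponents c P).Finite := by
  by_cases hne : (radialSupport c).Nonempty
  · have hP' : ∀ i, 0 < realWeight P i := fun i => Nat.cast_pos.2 (hP i)
    obtain ⟨v, hv⟩ := hne
    have hfin := finite_weight_le hP' (∑ i, realWeight P i * realWeight v i)
    refine (hfin.prod hfin).subset fun p hp => ?_
    have h1 := (realWeight_mem_newtonFace_iff hP' (add_mem_radialSupport hp.1)).1 hp.2 v hv
    have h2 : ∀ w : Fin n → ℕ, w ≤ p.1 + p.2 →
        ∑ i, realWeight P i * realWeight w i ≤ ∑ i, realWeight P i * realWeight v i :=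
      fun w hw => (Finset.sum_le_sum fun i _ =>
        mul_le_mul_of_nonneg_left (Nat.cast_le.2 (hw i)) (hP' i).le).trans h1
    exact ⟨h2 _ fun i => Nat.le_add_right _ _, h2 _ fun i => Nat.le_add_left _ _⟩
  · convert Set.finite_empty
    refine Set.eq_empty_of_forall_notMem fun p hp => hne ⟨_, add_mem_radialSupport hp.1⟩

theorem faceFunction_eq_sum {P : Fin n → ℕ} (hP : StrictlyPositive P) (z : Cn n) :
    faceFunction c P z =
      ∑ p ∈ (finite_faceExponents (c := c) hP).toFinset,
        c p.1 p.2 * mixedMonomial p.1 p.2 z := by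
  classical
  rw [faceFunction, finsum_eq_sum_of_support_subset (s := (finite_faceExponents hP).toFinset)]
  · refine Finset.sum_congr rfl fun p hp => ?_
    rw [if_pos ((finite_faceExponents hP).mem_toFinset.1 hp).2]
  · intro p hp
    rw [Finset.mem_coe, (finite_faceExponents hP).mem_toFinset]
    rw [Function.mem_support] at hp
    by_cases h : realWeight (p.1 + p.2) ∈ newtonFace c (realWeight P)
    · rw [if_pos h] at hp
      exact ⟨left_ne_zero_of_mul hp, h⟩
    · rw [if_neg h] at hp
      exact absurd rfl hp

end FaceFunction

namespace RegularFan

variable {n : ℕ} {S : RegularFan n} {c : (Fin n → ℕ) → (Fin n → ℕ) → ℂ}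

/-! ### Splitting off the exceptional factors -/

/-- The exponent of the `j`-th coordinate in the pullback of a monomial with exponent `ν`. -/
def pullExp (σ : S.Chart) (ν : Fin n → ℕ) (j : Fin n) : ℕ := ∑ i, σ.1 j i * ν i

theorem pullExp_add (σ : S.Chart) (ν μ : Fin n → ℕ) (j : Fin n) :
    pullExp σ (ν + μ) j = pullExp σ ν j + pullExp σ μ j := by
  simp [pullExp, mul_add, Finset.sum_add_distrib]

theorem prod_monomialMap_pow (σ : S.Chart) (u : Cn n) (ν : Fin n → ℕ) :
    ∏ i, monomialMap σ.mat u i ^ ν i = ∏ j, u j ^ pullExp σ ν j := by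
  have h1 : ∀ i, monomialMap σ.mat u i = ∏ j, u j ^ σ.1 j i := fun i =>
    Finset.prod_congr rfl fun j _ => by simp [Chart.mat]
  simp only [h1, ← Finset.prod_pow, ← pow_mul]
  rw [Finset.prod_comm]
  exact Finset.prod_congr rfl fun j _ => Finset.prod_pow_eq_pow_sum _ _ _

theorem mixedMonomial_monomialMap (σ : S.Chart) (u : Cn n) (ν μ : Fin n → ℕ) :
    mixedMonomial ν μ (monomialMap σ.mat u) =
      ∏ j, u j ^ pullExp σ ν j * (starRingEnd ℂ (u j)) ^ pullExp σ μ j := by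
  unfold mixedMonomial
  rw [Finset.prod_mul_distrib, Finset.prod_mul_distrib, prod_monomialMap_pow]
  congr 1
  simp only [← map_pow, ← map_prod]
  rw [prod_monomialMap_pow]

/-- The real factor of the `j`-th coordinate that is split off, for `j ∈ J`. -/
def locFactor (J : Finset (Fin n)) (ε : Fin n → Bool) (x : RealSpace n) (j : Fin n) : ℝ :=
  if j ∈ J then realFactor ε x j else 1

/-- What remains of the `j`-th coordinate when the real factors with index in `J` are split off. -/
def locVec (σ : S.Chart) (J : Finset (Fin n)) (ε : Fin n → Bool) (x : RealSpace n) (j : Fin n) :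
    ℂ :=
  if j ∈ J then dirVec ε x j else chartCoord σ ε x j

/-- The power of the `j`-th real factor that is split off. -/
def locDegree (c : (Fin n → ℕ) → (Fin n → ℕ) → ℂ) (σ : S.Chart) (J : Finset (Fin n))
    (j : Fin n) : ℕ :=
  if j ∈ J then radialDegree c (σ.1 j) else 0

/-- The quotient of `f ∘ Φ` by `∏ x_j ^ d(P_j; f)`, `j ∈ J`, as a power series. -/
def quotientSeries (c : (Fin n → ℕ) → (Fin n → ℕ) → ℂ) (σ : S.Chart) (J : Finset (Fin n))
    (ε : Fin n → Bool) (x : RealSpace n) : ℂ :=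
  ∑' p : (Fin n → ℕ) × (Fin n → ℕ), c p.1 p.2 * ∏ j,
    ((locFactor J ε x j : ℂ) ^ (pullExp σ p.1 j + pullExp σ p.2 j - locDegree c σ J j) *
      (locVec σ J ε x j ^ pullExp σ p.1 j * (starRingEnd ℂ (locVec σ J ε x j)) ^ pullExp σ p.2 j))

theorem chartCoord_eq_locFactor_mul {σ : S.Chart} {J : Finset (Fin n)}
    (hJ : ∀ j ∈ J, StrictlyPositive (σ.1 j)) (ε : Fin n → Bool) (x : RealSpace n) (j : Fin n) :
    chartCoord σ ε x j = locFactor J ε x j * locVec σ J ε x j := by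
  unfold locFactor locVec
  split_ifs with h
  · exact chartCoord_exc (hJ j h) ε x
  · simp

theorem locDegree_le {σ : S.Chart} {p : (Fin n → ℕ) × (Fin n → ℕ)} (hp : c p.1 p.2 ≠ 0)
    (J : Finset (Fin n)) (j : Fin n) :
    locDegree c σ J j ≤ pullExp σ p.1 j + pullExp σ p.2 j := by
  unfold locDegree
  split_ifs
  · rw [← pullExp_add]
    exact radialDegree_le (add_mem_radialSupport hp) _
  · exact Nat.zero_le _

theorem eq_prod_mul_quotientSeries {f : Cn n → ℂ} {σ : S.Chart} {J : Finset (Fin n)}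
    (hJ : ∀ j ∈ J, StrictlyPositive (σ.1 j)) {ε : Fin n → Bool} {x : RealSpace n}
    (hf : HasSum (fun p : (Fin n → ℕ) × (Fin n → ℕ) => c p.1 p.2 *
      mixedMonomial p.1 p.2 (monomialMap σ.mat (chartCoord σ ε x)))
      (f (monomialMap σ.mat (chartCoord σ ε x)))) :
    f (monomialMap σ.mat (chartCoord σ ε x)) =
      (∏ j ∈ J, (realFactor ε x j : ℂ) ^ radialDegree c (σ.1 j)) *
        quotientSeries c σ J ε x := by
  rw [← hf.tsum_eq, quotientSeries, ← tsum_mul_left]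
  refine tsum_congr fun p => ?_
  by_cases hp : c p.1 p.2 = 0
  · rw [hp, zero_mul, zero_mul, mul_zero]
  have h1 : (∏ j ∈ J, (realFactor ε x j : ℂ) ^ radialDegree c (σ.1 j)) =
      ∏ j, (locFactor J ε x j : ℂ) ^ locDegree c σ J j := by
    rw [← Finset.prod_subset (Finset.subset_univ J)]
    · exact Finset.prod_congr rfl fun j hj => by simp [locFactor, locDegree, hj]
    · intro j _ hj
      simp [locFactor, locDegree, hj]
  rw [h1, mul_left_comm, ← Finset.prod_mul_distrib, mixedMonomial_monomialMap]
  congr 1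
  refine Finset.prod_congr rfl fun j _ => ?_
  rw [← mul_assoc, ← pow_add, Nat.add_sub_cancel' (locDegree_le hp J j),
    chartCoord_eq_locFactor_mul hJ, map_mul, Complex.conj_ofReal, mul_pow, mul_pow, pow_add]
  ring

theorem analyticAt_locFactor (J : Finset (Fin n)) (ε : Fin n → Bool) (j : Fin n)
    (x : RealSpace n) : AnalyticAt ℝ (fun x => locFactor J ε x j) x := by
  unfold locFactor
  split_ifs
  · exact analyticAt_realFactor ε j x
  · exact analyticAt_const

theorem analyticAt_locVec (σ : S.Chart) (J : Finset (Fin n)) (ε : Fin n → Bool) (j : Fin n)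
    (x : RealSpace n) : AnalyticAt ℝ (fun x => locVec σ J ε x j) x := by
  unfold locVec
  split_ifs
  · exact analyticAt_dirVec ε j x
  · exact analyticAt_chartCoord σ ε j x

/-- The quotient series converges near every point at which the factors split off vanish: there
the polyradius in these factors can be taken so small that the image point lies in the polydisc of
convergence of `f`. -/
theorem analyticAt_quotientSeries {f : Cn n → ℂ} (hf : HasMixedExpansion f c) {σ : S.Chart}
    {J : Finset (Fin n)} (hne : J.Nonempty) {ε : Fin n → Bool} {x : RealSpace n}
    (hJ : ∀ j ∈ J, StrictlyPositive (σ.1 j)) (hx : ∀ j ∈ J, realFactor ε x j = 0) :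
    AnalyticAt ℝ (quotientSeries c σ J ε) x := by
  obtain ⟨r, hr, hs⟩ := hf.exists_radius
  set ρ : Fin n → ℝ := fun j => ‖locVec σ J ε x j‖ + 1 with hρ
  have hρ0 : ∀ j, 0 < ρ j := fun j => by positivity
  obtain ⟨j₀, hj₀⟩ := hne
  -- the polyradius: `δ` for the factors split off, `2` in place of the constant factors `1`, and
  -- `ρ` for the remaining vectors; every `z_i` is small since `J` is not empty and `P_j > 0` for
  -- `j ∈ J`
  obtain ⟨δ, hδ, hδr⟩ : ∃ δ : ℝ, 0 < δ ∧
      ∀ i, ∏ j, ((if j ∈ J then δ else 2) * ρ j) ^ σ.1 j i < r := by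
    have h : ∀ᶠ δ : ℝ in 𝓝 0, ∀ i, ∏ j, ((if j ∈ J then δ else 2) * ρ j) ^ σ.1 j i < r := by
      rw [eventually_all]
      intro i
      have hc : Continuous fun δ : ℝ => ∏ j, ((if j ∈ J then δ else 2) * ρ j) ^ σ.1 j i := by
        refine continuous_finsetProd _ fun j _ => Continuous.pow (Continuous.mul ?_
          continuous_const) _
        by_cases h : j ∈ J
        · simp only [h, if_true]
          exact continuous_id
        · simp only [h, if_false]
          exact continuous_const
      refine hc.continuousAt.eventually_lt_const ?_
      have h0 : ∏ j, ((if j ∈ J then (0 : ℝ) else 2) * ρ j) ^ σ.1 j i = 0 := by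
        refine Finset.prod_eq_zero (Finset.mem_univ j₀) ?_
        rw [if_pos hj₀, zero_mul, zero_pow (hJ j₀ hj₀ i).ne']
      exact h0.trans_lt hr
    obtain ⟨δ, h1, h2⟩ := ((h.filter_mono nhdsWithin_le_nhds).and
      (self_mem_nhdsWithin : Ioi (0 : ℝ) ∈ 𝓝[>] 0)).exists
    exact ⟨δ, h2, h1⟩
  set δ' : Fin n → ℝ := fun j => if j ∈ J then δ else 2 with hδ'
  have hδ'0 : ∀ j, 0 < δ' j := fun j => by
    simp only [hδ']
    split_ifs
    exacts [hδ, two_pos]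
  -- the exponents in the variables `r_j`, `w_j`, `conj w_j`
  set e : (Fin n → ℕ) × (Fin n → ℕ) → (Fin n ⊕ Fin n ⊕ Fin n) → ℕ := fun p =>
    Sum.elim (fun j => pullExp σ p.1 j + pullExp σ p.2 j - locDegree c σ J j)
      (Sum.elim (pullExp σ p.1) (pullExp σ p.2)) with he
  set R : Fin n ⊕ Fin n ⊕ Fin n → ℝ := Sum.elim δ' (Sum.elim ρ ρ) with hR
  have hR0 : ∀ l, 0 < R l := by
    rintro (j | j | j)
    exacts [hδ'0 j, hρ0 j, hρ0 j]
  have hsum : Summable fun p : (Fin n → ℕ) × (Fin n → ℕ) =>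
      ‖c p.1 p.2‖ * ∏ l, R l ^ e p l := by
    set C : ℝ := ∏ j, δ' j ^ locDegree c σ J j with hC
    have hC0 : 0 < C := Finset.prod_pos fun j _ => pow_pos (hδ'0 j) _
    refine Summable.of_nonneg_of_le (fun p => mul_nonneg (norm_nonneg _)
      (Finset.prod_nonneg fun l _ => pow_nonneg (hR0 l).le _)) (fun p => ?_) (hs.mul_left C⁻¹)
    by_cases hp : c p.1 p.2 = 0
    · simp [hp]
    rw [← mul_le_mul_iff_right₀ hC0, mul_inv_cancel_left₀ hC0.ne', mul_left_comm]
    refine mul_le_mul_of_nonneg_left ?_ (norm_nonneg _)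
    have h1 : C * ∏ l, R l ^ e p l = ∏ j, (δ' j * ρ j) ^ pullExp σ (p.1 + p.2) j := by
      rw [Fintype.prod_sum_type, Fintype.prod_sum_type]
      simp only [hR, he, Sum.elim_inl, Sum.elim_inr, hC]
      rw [← mul_assoc, ← Finset.prod_mul_distrib, ← Finset.prod_mul_distrib,
        ← Finset.prod_mul_distrib]
      refine Finset.prod_congr rfl fun j _ => ?_
      rw [← pow_add, Nat.add_sub_cancel' (locDegree_le hp J j), ← pow_add, ← mul_pow,
        ← pullExp_add]
    rw [h1]
    have h2 : ∏ j, (δ' j * ρ j) ^ pullExp σ (p.1 + p.2) j =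
        ∏ i, (∏ j, (δ' j * ρ j) ^ σ.1 j i) ^ (p.1 i + p.2 i) := by
      simp only [← Finset.prod_pow, ← pow_mul]
      rw [Finset.prod_comm]
      exact Finset.prod_congr rfl fun j _ => (Finset.prod_pow_eq_pow_sum _ _ _).symm
    rw [h2]
    refine Finset.prod_le_prod (fun i _ => pow_nonneg (Finset.prod_nonneg fun j _ =>
      pow_nonneg (mul_pos (hδ'0 j) (hρ0 j)).le _) _) fun i _ => ?_
    exact pow_le_pow_left₀ (Finset.prod_nonneg fun j _ =>
      pow_nonneg (mul_pos (hδ'0 j) (hρ0 j)).le _) (hδr i).le _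
  set Y : RealSpace n → (Fin n ⊕ Fin n ⊕ Fin n → ℂ) := fun x =>
    Sum.elim (fun j => (locFactor J ε x j : ℂ)) (Sum.elim (locVec σ J ε x)
      fun j => starRingEnd ℂ (locVec σ J ε x j)) with hY
  have hYa : AnalyticAt ℝ Y x := by
    rw [analyticAt_pi_iff]
    rintro (j | j | j)
    · exact analyticAt_ofReal_comp (analyticAt_locFactor J ε j x)
    · exact analyticAt_locVec σ J ε j x
    · exact (Complex.conjCLE.analyticAt _).comp (analyticAt_locVec σ J ε j x)
  have hYR : ∀ l, ‖Y x l‖ < R l := by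
    rintro (j | j | j)
    · simp only [hY, hR, hδ', Sum.elim_inl, Complex.norm_real, locFactor]
      split_ifs with h
      · rw [hx j h, norm_zero]
        exact hδ
      · norm_num
    · exact lt_add_one _
    · simp only [hY, hR, Sum.elim_inr, RCLike.norm_conj]
      exact lt_add_one _
  have h1 := (analyticAt_tsum_monomial (a := fun p : (Fin n → ℕ) × (Fin n → ℕ) => c p.1 p.2)
    e hR0 hsum hYR).restrictScalars (𝕜 := ℝ)
  convert h1.comp hYa using 1
  funext x
  refine tsum_congr fun p => ?_
  rw [Fintype.prod_sum_type, Fintype.prod_sum_type, Finset.prod_mul_distrib,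
    Finset.prod_mul_distrib]
  simp [hY, he]

/-- On the stratum where the coordinates with index in `K` vanish, the quotient series is given by
the face function of the weight `∑ σ_j`, `j ∈ K`. -/
theorem quotientSeries_eq_faceFunction
    (hax : ∀ i, ∃ ν μ, c ν μ ≠ 0 ∧ ∀ k, k ≠ i → (ν + μ) k = 0) (hadm : S.IsAdmissible c)
    (hvert : ∀ P ∈ S.vertices, StrictlyPositive P ∨ ∃ i, P = Pi.single i 1)
    {σ : S.Chart} {J K : Finset (Fin n)} (hJK : J ⊆ K)
    (hK : StrictlyPositive (faceWeight σ K)) (hKJ : ∀ j ∈ K, j ∉ J → ¬StrictlyPositive (σ.1 j))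
    {ε : Fin n → Bool} {x : RealSpace n} (hx : ∀ j ∈ J, realFactor ε x j = 0)
    (hx' : ∀ j ∈ K, j ∉ J → chartCoord σ ε x j = 0) :
    quotientSeries c σ J ε x = faceFunction c (faceWeight σ K)
      (monomialMap σ.mat fun j => if j ∈ K ∧ j ∉ J then 1 else locVec σ J ε x j) := by
  classical
  rw [faceFunction_eq_sum hK, quotientSeries,
    tsum_eq_sum (s := (finite_faceExponents (c := c) hK).toFinset)]
  · refine Finset.sum_congr rfl fun p hp => ?_
    rw [(finite_faceExponents hK).mem_toFinset] at hp
    rw [mixedMonomial_monomialMap]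
    congr 1
    refine Finset.prod_congr rfl fun j _ => ?_
    have hface := (mem_newtonFace_faceWeight_iff hadm hK (add_mem_radialSupport hp.1)).1 hp.2
    have hface' : ∀ j ∈ K, pullExp σ p.1 j + pullExp σ p.2 j = radialDegree c (σ.1 j) :=
      fun j hj => by rw [← pullExp_add]; exact hface j hj
    by_cases hjJ : j ∈ J
    · rw [if_neg fun h => h.2 hjJ, hface' j (hJK hjJ), locDegree, if_pos hjJ, Nat.sub_self,
        pow_zero, one_mul]
    · rw [locFactor, if_neg hjJ, Complex.ofReal_one, one_pow, one_mul]
      by_cases hjK : j ∈ K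
      · have h0 := hface' j hjK
        rw [radialDegree_single_eq_zero hax (hvert _ (σ.mem_vertices j)) (hKJ j hjK hjJ)] at h0
        have h1 : pullExp σ p.1 j = 0 := by omega
        have h2 : pullExp σ p.2 j = 0 := by omega
        rw [h1, h2, pow_zero, pow_zero, pow_zero, pow_zero]
      · rw [if_neg fun h => hjK h.1]
  · intro p hp
    rw [(finite_faceExponents hK).mem_toFinset] at hp
    by_cases hc : c p.1 p.2 = 0
    · rw [hc, zero_mul]
    have hnot : ¬∀ j ∈ K, ∑ i, σ.1 j i * (p.1 + p.2) i = radialDegree c (σ.1 j) := fun h =>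
      hp ⟨hc, (mem_newtonFace_faceWeight_iff hadm hK (add_mem_radialSupport hc)).2 h⟩
    push Not at hnot
    obtain ⟨j, hjK, hj⟩ := hnot
    have hj' : pullExp σ p.1 j + pullExp σ p.2 j ≠ radialDegree c (σ.1 j) := by
      rw [← pullExp_add]
      exact hj
    refine mul_eq_zero_of_right _ (Finset.prod_eq_zero (Finset.mem_univ j) ?_)
    by_cases hjJ : j ∈ J
    · have hle := locDegree_le (σ := σ) hc J j
      rw [locDegree, if_pos hjJ] at hle
      rw [locFactor, locDegree, if_pos hjJ, if_pos hjJ, hx j hjJ, Complex.ofReal_zero,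
        zero_pow (by omega), zero_mul]
    · rw [radialDegree_single_eq_zero hax (hvert _ (σ.mem_vertices j)) (hKJ j hjK hjJ)] at hj'
      rw [locVec, if_neg hjJ, hx' j hjK hjJ, map_zero, ← pow_add, zero_pow hj', mul_zero]

/-! ### Non-degeneracy along the strata of the exceptional divisors -/

/-- The index of the coordinate of the real blowing-up that is the real factor. -/
def factorIndex (ε : Bool) : Fin 2 := if ε then 1 else 0

theorem factor_eq (ε : Bool) (a : Fin 2 → ℝ) : factor ε a = a (factorIndex ε) := by
  cases ε <;> rfl

theorem realFactor_eq (ε : Fin n → Bool) (x : RealSpace n) (j : Fin n) :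
    realFactor ε x j = x (j, factorIndex (ε j)) := factor_eq _ _

/-- The face function pulled back to a chart. -/
def pullFace (c : (Fin n → ℕ) → (Fin n → ℕ) → ℂ) (σ : S.Chart) (K : Finset (Fin n)) (u : Cn n) :
    ℂ :=
  faceFunction c (faceWeight σ K) (monomialMap σ.mat u)

theorem pullFace_eq_sum {σ : S.Chart} {K : Finset (Fin n)} (hK : StrictlyPositive (faceWeight σ K))
    (u : Cn n) : pullFace c σ K u = ∑ p ∈ (finite_faceExponents (c := c) hK).toFinset,
      c p.1 p.2 * ∏ j, u j ^ pullExp σ p.1 j * (starRingEnd ℂ (u j)) ^ pullExp σ p.2 j := by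
  rw [pullFace, faceFunction_eq_sum hK]
  simp only [mixedMonomial_monomialMap]

theorem differentiableAt_pullFace {σ : S.Chart} {K : Finset (Fin n)}
    (hK : StrictlyPositive (faceWeight σ K)) (u : Cn n) :
    DifferentiableAt ℝ (pullFace c σ K) u := by
  have h1 : pullFace c σ K = fun u => ∑ p ∈ (finite_faceExponents (c := c) hK).toFinset,
      c p.1 p.2 * ∏ j, u j ^ pullExp σ p.1 j * (starRingEnd ℂ (u j)) ^ pullExp σ p.2 j :=
    funext fun u => pullFace_eq_sum hK u
  have hj : ∀ j, AnalyticAt ℝ (fun u : Cn n => u j) u := fun j =>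
    (ContinuousLinearMap.proj (R := ℝ) (φ := fun _ : Fin n => ℂ) j).analyticAt u
  rw [h1]
  refine AnalyticAt.differentiableAt (Finset.analyticAt_fun_sum _ fun p _ =>
    analyticAt_const.mul (Finset.analyticAt_fun_prod _ fun j _ => ((hj j).pow _).mul ?_))
  exact AnalyticAt.pow ((Complex.conjCLE.analyticAt _).comp (hj j)) _

/-- The pulled back face function is homogeneous with respect to real multiples of a coordinate
with index in `K`. -/
theorem pullFace_scale (hadm : S.IsAdmissible c) {σ : S.Chart} {K : Finset (Fin n)}
    (hK : StrictlyPositive (faceWeight σ K)) {j : Fin n} (hj : j ∈ K) {u u' : Cn n} {s : ℝ}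
    (h : ∀ k, k ≠ j → u' k = u k) (hs : u' j = s * u j) :
    pullFace c σ K u' = (s : ℂ) ^ radialDegree c (σ.1 j) * pullFace c σ K u := by
  rw [pullFace_eq_sum hK, pullFace_eq_sum hK, Finset.mul_sum]
  refine Finset.sum_congr rfl fun p hp => ?_
  rw [(finite_faceExponents hK).mem_toFinset] at hp
  have h1 : pullExp σ p.1 j + pullExp σ p.2 j = radialDegree c (σ.1 j) := by
    rw [← pullExp_add]
    exact (mem_newtonFace_faceWeight_iff hadm hK (add_mem_radialSupport hp.1)).1 hp.2 j hj
  rw [← Finset.mul_prod_erase _ _ (Finset.mem_univ j),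
    ← Finset.mul_prod_erase (a := j) _ _ (Finset.mem_univ j),
    Finset.prod_congr rfl fun k hk => by rw [h k (Finset.ne_of_mem_erase hk)], hs, ← h1, map_mul,
    Complex.conj_ofReal, mul_pow, mul_pow, pow_add]
  ring

/-- The pulled back face function does not depend on the coordinates of radial degree zero. -/
theorem pullFace_congr (hadm : S.IsAdmissible c) {σ : S.Chart} {K : Finset (Fin n)}
    (hK : StrictlyPositive (faceWeight σ K)) {j : Fin n} (hj : j ∈ K)
    (h0 : radialDegree c (σ.1 j) = 0) {u u' : Cn n} (h : ∀ k, k ≠ j → u' k = u k) :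
    pullFace c σ K u' = pullFace c σ K u := by
  rw [pullFace_eq_sum hK, pullFace_eq_sum hK]
  refine Finset.sum_congr rfl fun p hp => ?_
  rw [(finite_faceExponents hK).mem_toFinset] at hp
  have h1 : pullExp σ p.1 j + pullExp σ p.2 j = 0 := by
    rw [← pullExp_add, ← h0]
    exact (mem_newtonFace_faceWeight_iff hadm hK (add_mem_radialSupport hp.1)).1 hp.2 j hj
  rw [← Finset.mul_prod_erase _ _ (Finset.mem_univ j),
    ← Finset.mul_prod_erase (a := j) _ _ (Finset.mem_univ j),
    Finset.prod_congr rfl fun k hk => by rw [h k (Finset.ne_of_mem_erase hk)],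
    (Nat.add_eq_zero_iff.1 h1).1, (Nat.add_eq_zero_iff.1 h1).2]
  simp only [pow_zero]

theorem monomialMap_ne_zero (A : Matrix (Fin n) (Fin n) ℤ) {u : Cn n} (hu : ∀ j, u j ≠ 0)
    (i : Fin n) : monomialMap A u i ≠ 0 :=
  Finset.prod_ne_zero_iff.2 fun j _ => zpow_ne_zero _ (hu j)

theorem monomialMap_mul_of_ne_zero (A B : Matrix (Fin n) (Fin n) ℤ) {u : Cn n}
    (hu : ∀ j, u j ≠ 0) : monomialMap (A * B) u = monomialMap A (monomialMap B u) :=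
  monomialMap_mul A B u fun j hj => absurd hj (hu j)

/-- On the torus `ψ_σ` is a diffeomorphism, so that non-degeneracy can be read in the chart. -/
theorem surjective_fderiv_pullFace (hnd : IsNonDegenerate c) {σ : S.Chart} {K : Finset (Fin n)}
    (hK : StrictlyPositive (faceWeight σ K)) {u : Cn n} (hu : ∀ j, u j ≠ 0)
    (h0 : pullFace c σ K u = 0) : Function.Surjective (fderiv ℝ (pullFace c σ K) u) := by
  set z := monomialMap σ.mat u with hz
  have hz0 : ∀ i, z i ≠ 0 := monomialMap_ne_zero _ hu
  have hinv : monomialMap σ.mat⁻¹ z = u := by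
    rw [hz, ← monomialMap_mul_of_ne_zero _ _ hu, Matrix.nonsing_inv_mul _ σ.isUnit_det,
      monomialMap_one]
  have hev : faceFunction c (faceWeight σ K) =ᶠ[𝓝 z]
      pullFace c σ K ∘ monomialMap σ.mat⁻¹ := by
    have h1 : ∀ᶠ w in 𝓝 z, ∀ i, w i ≠ 0 := by
      rw [eventually_all]
      exact fun i => (continuous_apply i).continuousAt.eventually_ne (hz0 i)
    filter_upwards [h1] with w hw
    rw [Function.comp_apply, pullFace, ← monomialMap_mul_of_ne_zero _ _ hw,
      Matrix.mul_nonsing_inv _ σ.isUnit_det, monomialMap_one]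
  have hd : DifferentiableAt ℝ (monomialMap σ.mat⁻¹) z := by
    rw [differentiableAt_pi]
    intro i
    exact (analyticAt_prod_zpow _ (fun j _ =>
      (ContinuousLinearMap.proj (R := ℝ) (φ := fun _ : Fin n => ℂ) j).analyticAt z)
      fun j _ hj => absurd hj (hz0 j)).differentiableAt
  have hs := hnd _ hK z hz0 h0
  rw [hev.fderiv_eq, fderiv_comp z (differentiableAt_pullFace hK _) hd, hinv] at hs
  exact Function.Surjective.of_comp hs

theorem hasDerivAt_direction (ε : Bool) (a : Fin 2 → ℝ) (v : ℂ) :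
    ∃ (b : Fin 2 → ℝ) (r : ℝ), b (factorIndex ε) = 0 ∧
      HasDerivAt (fun t : ℝ => direction ε fun k => a k + t * b k)
        (v - r * direction ε a) 0 := by
  cases ε
  · refine ⟨![0, v.im - v.re * a 1], v.re, rfl, ?_⟩
    have h1 : HasDerivAt (fun t : ℝ => direction false a +
        (t : ℂ) * (((v.im - v.re * a 1 : ℝ) : ℂ) * Complex.I))
        (((v.im - v.re * a 1 : ℝ) : ℂ) * Complex.I) 0 := by
      simpa using ((Complex.ofRealCLM.hasDerivAt (x := (0 : ℝ))).mul_const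
        (((v.im - v.re * a 1 : ℝ) : ℂ) * Complex.I)).const_add (direction false a)
    convert h1 using 1
    · funext t
      apply Complex.ext <;> simp [direction]
    · apply Complex.ext <;> simp [direction]
  · refine ⟨![v.re - v.im * a 0, 0], v.im, rfl, ?_⟩
    have h1 : HasDerivAt (fun t : ℝ => direction true a +
        (t : ℂ) * ((v.re - v.im * a 0 : ℝ) : ℂ))
        ((v.re - v.im * a 0 : ℝ) : ℂ) 0 := by
      simpa using ((Complex.ofRealCLM.hasDerivAt (x := (0 : ℝ))).mul_const
        ((v.re - v.im * a 0 : ℝ) : ℂ)).const_add (direction true a)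
    convert h1 using 1
    · funext t
      apply Complex.ext <;> simp [direction]
    · apply Complex.ext <;> simp [direction]

theorem hasDerivAt_complex_mk {a b : ℝ → ℝ} {a' b' t : ℝ} (ha : HasDerivAt a a' t)
    (hb : HasDerivAt b b' t) : HasDerivAt (fun t => (⟨a t, b t⟩ : ℂ)) ⟨a', b'⟩ t := by
  exact (Complex.equivRealProdCLM.symm : ℝ × ℝ →L[ℝ] ℂ).hasFDerivAt.comp_hasDerivAt t
    (ha.prodMk hb)

theorem hasDerivAt_factor_mul_direction (ε : Bool) {a : Fin 2 → ℝ} (ha : factor ε a ≠ 0) (v : ℂ) :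
    ∃ b : Fin 2 → ℝ, HasDerivAt (fun t : ℝ => (factor ε fun k => a k + t * b k : ℂ) *
      direction ε fun k => a k + t * b k) v 0 := by
  have hlin : ∀ p q : ℝ, HasDerivAt (fun t : ℝ => p + t * q) q 0 := fun p q => by
    simpa using ((hasDerivAt_id (0 : ℝ)).mul_const q).const_add p
  cases ε
  · have ha' : a 0 ≠ 0 := ha
    refine ⟨![v.re, (v.im - v.re * a 1) / a 0], ?_⟩
    have h1 := hasDerivAt_complex_mk (hlin (a 0) v.re)
      ((hlin (a 0) v.re).mul (hlin (a 1) ((v.im - v.re * a 1) / a 0)))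
    convert h1 using 1
    · funext t
      apply Complex.ext <;> simp [direction, factor]
    · apply Complex.ext
      · simp
      · simp
        field_simp
        ring
  · have ha' : a 1 ≠ 0 := ha
    refine ⟨![(v.re - v.im * a 0) / a 1, v.im], ?_⟩
    have h1 := hasDerivAt_complex_mk
      ((hlin (a 1) v.im).mul (hlin (a 0) ((v.re - v.im * a 0) / a 1))) (hlin (a 1) v.im)
    convert h1 using 1
    · funext t
      apply Complex.ext <;> simp [direction, factor]
    · apply Complex.ext
      · simp
        field_simp
        ring
      · simp

/-- At a zero of the quotient series on the exceptional locus, its derivative is onto already on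
the tangent space of the stratum: the stratum parametrizes the torus up to directions along which
the face function vanishes by homogeneity. -/
theorem surjective_fderiv_quotientSeries {f : Cn n → ℂ} (hf : HasMixedExpansion f c)
    (hnd : IsNonDegenerate c)
    (hax : ∀ i, ∃ ν μ, c ν μ ≠ 0 ∧ ∀ k, k ≠ i → (ν + μ) k = 0) (hadm : S.IsAdmissible c)
    (hvert : ∀ P ∈ S.vertices, StrictlyPositive P ∨ ∃ i, P = Pi.single i 1)
    {σ : S.Chart} {J : Finset (Fin n)} (hne : J.Nonempty) {ε : Fin n → Bool} {x : RealSpace n}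
    (hJ : ∀ j, j ∈ J ↔ StrictlyPositive (σ.1 j) ∧ chartCoord σ ε x j = 0)
    (h0 : quotientSeries c σ J ε x = 0) (y : ℂ) :
    ∃ b : RealSpace n, (∀ j ∈ J, b (j, factorIndex (ε j)) = 0) ∧
      fderiv ℝ (quotientSeries c σ J ε) x b = y := by
  classical
  set K : Finset (Fin n) := Finset.univ.filter fun j => chartCoord σ ε x j = 0 with hKdef
  have hJK : J ⊆ K := fun j hj => Finset.mem_filter.2 ⟨Finset.mem_univ j, ((hJ j).1 hj).2⟩
  have hKJ : ∀ j ∈ K, j ∉ J → ¬StrictlyPositive (σ.1 j) := fun j hj hjJ h =>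
    hjJ ((hJ j).2 ⟨h, (Finset.mem_filter.1 hj).2⟩)
  have hJs : ∀ j ∈ J, StrictlyPositive (σ.1 j) := fun j hj => ((hJ j).1 hj).1
  have hK : StrictlyPositive (faceWeight σ K) := by
    obtain ⟨j, hj⟩ := hne
    intro i
    rw [faceWeight, Finset.sum_apply]
    exact Finset.sum_pos' (fun _ _ => Nat.zero_le _) ⟨j, hJK hj, hJs j hj i⟩
  have hxJ : ∀ j ∈ J, realFactor ε x j = 0 := fun j hj =>
    (chartCoord_exc_eq_zero_iff (hJs j hj) ε x).1 ((hJ j).1 hj).2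
  set W : RealSpace n → Cn n := fun x j => if j ∈ K ∧ j ∉ J then 1 else locVec σ J ε x j with hW
  have hstrat : ∀ x' : RealSpace n, (∀ j ∈ J, realFactor ε x' j = 0) →
      (∀ j ∈ K, j ∉ J → chartCoord σ ε x' j = 0) →
      quotientSeries c σ J ε x' = pullFace c σ K (W x') := fun x' h1 h2 =>
    quotientSeries_eq_faceFunction hax hadm hvert hJK hK hKJ h1 h2
  have hW0 : ∀ j, W x j ≠ 0 := by
    intro j
    simp only [hW, locVec]
    split_ifs with h1 h2
    · exact one_ne_zero
    · exact dirVec_ne_zero _ _ _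
    · intro h
      exact h1 ⟨Finset.mem_filter.2 ⟨Finset.mem_univ j, h⟩, h2⟩
  have hg0 : pullFace c σ K (W x) = 0 := by
    rw [← hstrat x hxJ fun j hj _ => (Finset.mem_filter.1 hj).2, h0]
  have hgd := (differentiableAt_pullFace (c := c) hK (W x)).hasFDerivAt
  obtain ⟨v, hv⟩ := surjective_fderiv_pullFace hnd hK hW0 hg0 y
  -- directions that do not contribute
  have hzero : ∀ (e : Cn n), (∀ t : ℝ, pullFace c σ K (W x + t • e) = 0) →
      fderiv ℝ (pullFace c σ K) (W x) e = 0 := by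
    intro e he
    have h1 : HasDerivAt (fun t : ℝ => pullFace c σ K (W x + t • e))
      (fderiv ℝ (pullFace c σ K) (W x) e) 0 := hgd.hasLineDerivAt e
    simp only [he] at h1
    exact h1.unique (hasDerivAt_const _ _)
  have hoff : ∀ (j k : Fin n) (a : ℂ) (t : ℝ), k ≠ j →
      (W x + t • (Pi.single j a : Cn n)) k = W x k := by
    intro j k a t hk
    simp [hk]
  -- coordinate by coordinate: a tangent vector `bj` of the stratum that moves `W` in the direction
  -- `v j`, up to a direction `v j - Vj` that does not contribute
  have key : ∀ j, ∃ (bj : Fin 2 → ℝ) (Vj : ℂ), (j ∈ J → bj (factorIndex (ε j)) = 0) ∧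
      (j ∈ K → j ∉ J → bj = 0) ∧
      (∀ b : RealSpace n, (∀ k, b (j, k) = bj k) →
        HasDerivAt (fun t : ℝ => W (x + t • b) j) Vj 0) ∧
      fderiv ℝ (pullFace c σ K) (W x) (Pi.single j (v j - Vj)) = 0 := by
    intro j
    have hb : ∀ {bj : Fin 2 → ℝ} {b : RealSpace n}, (∀ k, b (j, k) = bj k) → ∀ (t : ℝ) (k : Fin 2),
        (x + t • b) (j, k) = x (j, k) + t * bj k := by
      intro bj b h t k
      simp [h k]
    by_cases hjJ : j ∈ J
    · obtain ⟨bj, r, hbj, hd⟩ := hasDerivAt_direction (ε j) (fun k => x (j, k)) (v j)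
      refine ⟨bj, v j - r * direction (ε j) fun k => x (j, k), fun _ => hbj,
        fun _ h => absurd hjJ h, fun b h => ?_, hzero _ fun t => ?_⟩
      · convert hd using 1
        funext t
        simp only [hW, hjJ, not_true_eq_false, and_false, if_false, locVec, if_true, dirVec,
          hb h]
      · rw [sub_sub_cancel]
        refine (pullFace_scale hadm hK (hJK hjJ) (u := W x) (s := 1 + t * r)
          (fun k hk => hoff j k _ t hk) ?_).trans ?_
        · have : W x j = direction (ε j) fun k => x (j, k) := by
            simp only [hW, hjJ, not_true_eq_false, and_false, if_false, locVec, if_true, dirVec]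
          simp only [Pi.add_apply, Pi.smul_apply, Pi.single_eq_same, this, Complex.real_smul]
          push_cast
          ring
        · rw [hg0, mul_zero]
    · by_cases hjK : j ∈ K
      · refine ⟨0, 0, fun h => absurd h hjJ, fun _ _ => rfl, fun b h => ?_, hzero _ fun t => ?_⟩
        · simp only [hW, hjJ, hjK, not_false_eq_true, and_self, if_true]
          exact hasDerivAt_const _ _
        · rw [pullFace_congr hadm hK hjK (radialDegree_single_eq_zero hax
            (hvert _ (σ.mem_vertices j)) (hKJ j hjK hjJ)) (u := W x)
            (fun k hk => hoff j k _ t hk), hg0]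
      · have hWj : ∀ x', W x' j = chartCoord σ ε x' j := fun x' => by
          simp only [hW, hjJ, hjK, false_and, if_false, locVec]
        simp only [hWj]
        suffices h : ∃ bj : Fin 2 → ℝ, ∀ b : RealSpace n, (∀ k, b (j, k) = bj k) →
            HasDerivAt (fun t : ℝ => chartCoord σ ε (x + t • b) j) (v j) 0 by
          obtain ⟨bj, h⟩ := h
          exact ⟨bj, v j, fun h => absurd h hjJ, fun h => absurd h hjK, h, by simp⟩
        by_cases hs : StrictlyPositive (σ.1 j)
        · have hne : factor (ε j) (fun k => x (j, k)) ≠ 0 := by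
            intro h
            exact hjK (Finset.mem_filter.2 ⟨Finset.mem_univ j,
              (chartCoord_exc_eq_zero_iff hs ε x).2 h⟩)
          obtain ⟨bj, hd⟩ := hasDerivAt_factor_mul_direction (ε j) hne (v j)
          refine ⟨bj, fun b h => ?_⟩
          convert hd using 1
          funext t
          rw [chartCoord_exc hs]
          simp only [realFactor, dirVec, hb h]
        · refine ⟨![(v j).re, (v j).im], fun b h => ?_⟩
          have hlin : ∀ p q : ℝ, HasDerivAt (fun t : ℝ => p + t * q) q 0 := fun p q => by
            simpa using ((hasDerivAt_id (0 : ℝ)).mul_const q).const_add p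
          convert hasDerivAt_complex_mk (hlin (x (j, 0)) (v j).re) (hlin (x (j, 1)) (v j).im)
            using 1
          funext t
          rw [chartCoord_nonexc hs, hb h, hb h]
          rfl
  choose bj V hbJ hbK hd hDV using key
  set b : RealSpace n := fun k => bj k.1 k.2 with hbdef
  refine ⟨b, fun j hj => hbJ j hj, ?_⟩
  have hVd : HasDerivAt (fun t : ℝ => W (x + t • b)) V 0 :=
    hasDerivAt_pi.2 fun j => hd j b fun k => rfl
  have hgd' : HasFDerivAt (pullFace c σ K) (fderiv ℝ (pullFace c σ K) (W x))
      (W (x + (0 : ℝ) • b)) := by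
    rw [zero_smul, add_zero]
    exact hgd
  have h1 : HasDerivAt (fun t : ℝ => pullFace c σ K (W (x + t • b)))
      (fderiv ℝ (pullFace c σ K) (W x) V) 0 := by
    have := hgd'.comp_hasDerivAt (0 : ℝ) hVd
    exact this
  have h2 : HasDerivAt (fun t : ℝ => quotientSeries c σ J ε (x + t • b))
      (fderiv ℝ (quotientSeries c σ J ε) x b) 0 :=
    (analyticAt_quotientSeries hf hne hJs hxJ).differentiableAt.hasFDerivAt.hasLineDerivAt b
  have h3 : ∀ t : ℝ, quotientSeries c σ J ε (x + t • b) = pullFace c σ K (W (x + t • b)) := by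
    intro t
    refine hstrat _ (fun j hj => ?_) fun j hj hjJ => ?_
    · have h4 := hxJ j hj
      rw [realFactor_eq] at h4 ⊢
      simp [h4, hbdef, hbJ j hj]
    · have h4 := (Finset.mem_filter.1 hj).2
      rw [chartCoord_nonexc (hKJ j hj hjJ)] at h4 ⊢
      simp only [Pi.add_apply, Pi.smul_apply, hbdef, hbK j hj hjJ, Pi.zero_apply, smul_zero,
        add_zero]
      exact h4
  simp only [h3] at h2
  rw [h2.unique h1, ← hv, ← sub_eq_zero, ← map_sub]
  have h5 : V - v = ∑ j, Pi.single j (V j - v j) := (Finset.univ_sum_single (V - v)).symm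
  rw [h5, map_sum]
  refine Finset.sum_eq_zero fun j _ => ?_
  rw [← neg_sub, Pi.single_neg, map_neg, hDV j, neg_zero]

end RegularFan

/-! ### Coordinates adapted to a complex valued submersion -/

section Coordinates

variable {ι : Type*} [Fintype ι]

/-- Among the coordinates outside `T` there are two whose partial derivatives form a real basis of
`ℂ`, provided the derivative is onto on the vectors supported outside `T`. -/
theorem exists_pair_of_surjective [DecidableEq ι] (L : (ι → ℝ) →L[ℝ] ℂ) (T : Set ι)
    (h : ∀ y : ℂ, ∃ b : ι → ℝ, (∀ k ∈ T, b k = 0) ∧ L b = y) :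
    ∃ a b, a ∉ T ∧ b ∉ T ∧
      ((starRingEnd ℂ) (L (Pi.single a 1)) * L (Pi.single b 1)).im ≠ 0 := by
  by_contra hcon
  have hcon' : ∀ a b, a ∉ T → b ∉ T →
      ((starRingEnd ℂ) (L (Pi.single a 1)) * L (Pi.single b 1)).im = 0 := fun a b ha hb => by
    by_contra h0
    exact hcon ⟨a, b, ha, hb, h0⟩
  have hL : ∀ v : ι → ℝ, L v = ∑ k, (v k : ℂ) * L (Pi.single k 1) := by
    intro v
    conv_lhs => rw [← Finset.univ_sum_single v]
    rw [map_sum]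
    refine Finset.sum_congr rfl fun k _ => ?_
    rw [← Complex.real_smul, ← map_smul, ← Pi.single_smul, smul_eq_mul, mul_one]
  obtain ⟨v, hvT, hv⟩ := h 1
  obtain ⟨w, hwT, hw⟩ := h Complex.I
  have h1 : ((starRingEnd ℂ) (L v) * L w).im = 0 := by
    rw [hL v, hL w, map_sum, Finset.sum_mul_sum, Complex.im_sum]
    refine Finset.sum_eq_zero fun a _ => ?_
    rw [Complex.im_sum]
    refine Finset.sum_eq_zero fun b _ => ?_
    by_cases ha : a ∈ T
    · simp [hvT a ha]
    by_cases hb : b ∈ T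
    · simp [hwT b hb]
    rw [map_mul, Complex.conj_ofReal, mul_mul_mul_comm, ← Complex.ofReal_mul, Complex.im_ofReal_mul,
      hcon' a b ha hb, mul_zero]
  rw [hv, hw] at h1
  simp at h1

/-- The coordinates `x - x₀` with the coordinates `a` and `b` replaced by the real and imaginary
parts of `F`. -/
def adaptedCoord [DecidableEq ι] (F : (ι → ℝ) → ℂ) (x₀ : ι → ℝ) (a b : ι) (x : ι → ℝ) : ι → ℝ :=
  fun k => if k = a then (F x).re else if k = b then (F x).im else x k - x₀ k

theorem analyticAt_adaptedCoord [DecidableEq ι] {F : (ι → ℝ) → ℂ} (x₀ : ι → ℝ) (a b : ι)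
    {x : ι → ℝ} (hF : AnalyticAt ℝ F x) : AnalyticAt ℝ (adaptedCoord F x₀ a b) x := by
  rw [analyticAt_pi_iff]
  intro k
  unfold adaptedCoord
  split_ifs
  · exact (Complex.reCLM.analyticAt _).comp hF
  · exact (Complex.imCLM.analyticAt _).comp hF
  · exact ((ContinuousLinearMap.proj (R := ℝ) (φ := fun _ : ι => ℝ) k).analyticAt x).sub
      analyticAt_const

/-- The adapted coordinates are a local analytic coordinate system: an instance of the inverse
function theorem. -/
theorem exists_openPartialHomeomorph_adaptedCoord [DecidableEq ι] {F : (ι → ℝ) → ℂ} {x₀ : ι → ℝ}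
    (hF : AnalyticAt ℝ F x₀) {a b : ι}
    (hab : ((starRingEnd ℂ) (fderiv ℝ F x₀ (Pi.single a 1)) *
      fderiv ℝ F x₀ (Pi.single b 1)).im ≠ 0) {N : Set (ι → ℝ)} (hN : N ∈ 𝓝 x₀) :
    ∃ h : OpenPartialHomeomorph (ι → ℝ) (ι → ℝ), x₀ ∈ h.source ∧ h.source ⊆ N ∧
      (∀ x ∈ h.source, h x = adaptedCoord F x₀ a b x) ∧ ContDiffOn ℝ ω h h.source ∧
      ContDiffOn ℝ ω h.symm h.target := by
  set L := fderiv ℝ F x₀ with hL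
  have hne : a ≠ b := by
    rintro rfl
    apply hab
    rw [← Complex.normSq_eq_conj_mul_self, Complex.ofReal_im]
  set A : (ι → ℝ) →L[ℝ] (ι → ℝ) := ContinuousLinearMap.pi fun k =>
    if k = a then Complex.reCLM.comp L else if k = b then Complex.imCLM.comp L
      else ContinuousLinearMap.proj k with hA
  have hder : HasFDerivAt (adaptedCoord F x₀ a b) A x₀ := by
    rw [hasFDerivAt_pi]
    intro k
    unfold adaptedCoord
    have hFd : HasFDerivAt F L x₀ := hF.differentiableAt.hasFDerivAt
    split_ifs with h1 h2
    · exact Complex.reCLM.hasFDerivAt.comp x₀ hFd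
    · exact Complex.imCLM.hasFDerivAt.comp x₀ hFd
    · exact (hasFDerivAt_apply k x₀).sub_const _
  have hinj : Function.Injective A := by
    rw [injective_iff_map_eq_zero]
    intro v hv
    have hvk : ∀ k, A v k = 0 := fun k => congrFun hv k
    have hLv : L v = 0 := by
      refine Complex.ext ?_ ?_
      · simpa [hA] using hvk a
      · simpa [hA, hne.symm] using hvk b
    have hv0 : ∀ k, k ≠ a → k ≠ b → v k = 0 := fun k h1 h2 => by
      simpa [hA, h1, h2] using hvk k
    have hsum : v = v a • Pi.single a 1 + v b • Pi.single b 1 := by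
      funext k
      by_cases h1 : k = a
      · subst h1
        simp [hne]
      · by_cases h2 : k = b
        · subst h2
          simp [h1]
        · simp [h1, h2, hv0 k h1 h2]
    rw [hsum, map_add, map_smul, map_smul, Complex.real_smul, Complex.real_smul] at hLv
    have h1 : v b = 0 := by
      have := congrArg (fun z => ((starRingEnd ℂ) (L (Pi.single a 1)) * z).im) hLv
      simp only [mul_add, mul_left_comm _ (Complex.ofReal _), Complex.add_im,
        Complex.im_ofReal_mul, mul_zero, Complex.zero_im] at this
      rw [← Complex.normSq_eq_conj_mul_self, Complex.ofReal_im, mul_zero, zero_add] at this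
      exact (mul_eq_zero.1 this).resolve_right hab
    have h2 : v a = 0 := by
      rw [h1, Complex.ofReal_zero, zero_mul, add_zero] at hLv
      have h3 : L (Pi.single a 1) ≠ 0 := by
        intro h0
        simp [h0] at hab
      exact_mod_cast (mul_eq_zero.1 hLv).resolve_right h3
    rw [hsum, h1, h2, zero_smul, zero_smul, add_zero]
  set A' : (ι → ℝ) ≃L[ℝ] (ι → ℝ) :=
    (LinearEquiv.ofInjectiveEndo (A : (ι → ℝ) →ₗ[ℝ] (ι → ℝ)) hinj).toContinuousLinearEquiv with hA'
  have hder' : HasFDerivAt (adaptedCoord F x₀ a b) (A' : (ι → ℝ) →L[ℝ] (ι → ℝ)) x₀ := by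
    convert hder using 1
    ext v
    rfl
  have hcd : ContDiffAt ℝ ω (adaptedCoord F x₀ a b) x₀ :=
    (analyticAt_adaptedCoord x₀ a b hF).contDiffAt
  set g := hcd.toOpenPartialHomeomorph _ hder' (by simp) with hg
  have hgx : x₀ ∈ g.source := hcd.mem_toOpenPartialHomeomorph_source hder' (by simp)
  have hgc : (g : (ι → ℝ) → (ι → ℝ)) = adaptedCoord F x₀ a b := rfl
  have h1 : ContDiffAt ℝ ω g.symm (g x₀) := hcd.to_localInverse hder' (by simp)
  have h2 : ∀ᶠ x in 𝓝 x₀, ContDiffAt ℝ ω g.symm (g x) :=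
    (g.continuousAt hgx).eventually (h1.eventually (by simp))
  have h3 : ∀ᶠ x in 𝓝 x₀, ContDiffAt ℝ ω g x := hcd.eventually (by simp)
  obtain ⟨M, hM, hMo, hxM⟩ := eventually_nhds_iff.1 ((h2.and h3).and hN)
  refine ⟨g.restrOpen M hMo, ⟨hgx, hxM⟩, fun x hx => (hM x hx.2).2, fun x _ => rfl, ?_, ?_⟩
  · intro x hx
    exact (hM x hx.2).1.2.contDiffWithinAt
  · intro y hy
    have h4 := (g.restrOpen M hMo).map_target hy
    have h5 := (hM _ h4.2).1.1
    have h6 : g ((g.restrOpen M hMo).symm y) = y := (g.restrOpen M hMo).right_inv hy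
    rw [h6] at h5
    exact h5.contDiffWithinAt

end Coordinates

section Charts

variable {n : ℕ} {Y : Type*} [TopologicalSpace Y] [ChartedSpace (RealSpace n) Y]

theorem trans_mem_analyticCharts {χ : OpenPartialHomeomorph Y (RealSpace n)}
    (hχ : χ ∈ analyticCharts n Y) {h : OpenPartialHomeomorph (RealSpace n) (RealSpace n)}
    (h1 : ContDiffOn ℝ ω h h.source) (h2 : ContDiffOn ℝ ω h.symm h.target) :
    χ.trans h ∈ analyticCharts n Y := by
  have hh : h ∈ contDiffGroupoid ω 𝓘(ℝ, RealSpace n) := by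
    rw [contDiffGroupoid, mem_groupoid_of_pregroupoid]
    simp only [contDiffPregroupoid, modelWithCornersSelf_coe,
      modelWithCornersSelf_coe_symm, Function.comp_id, Function.id_comp, Set.preimage_id,
      Set.range_id, Set.inter_univ]
    exact ⟨h1, h2⟩
  intro e he
  obtain ⟨h3, h4⟩ := hχ e he
  constructor
  · rw [OpenPartialHomeomorph.trans_symm_eq_symm_trans_symm, OpenPartialHomeomorph.trans_assoc]
    exact (contDiffGroupoid ω 𝓘(ℝ, RealSpace n)).trans
      ((contDiffGroupoid ω 𝓘(ℝ, RealSpace n)).symm hh) h3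
  · rw [← OpenPartialHomeomorph.trans_assoc]
    exact (contDiffGroupoid ω 𝓘(ℝ, RealSpace n)).trans h4 hh

/-- Coordinates of a real analytic manifold adapted to a complex valued submersion. -/
theorem exists_chart_adaptedCoord {χ : OpenPartialHomeomorph Y (RealSpace n)}
    (hχ : χ ∈ analyticCharts n Y) {p : Y} (hp : p ∈ χ.source) {F : RealSpace n → ℂ}
    (hF : AnalyticAt ℝ F (χ p)) {a b : Fin n × Fin 2}
    (hab : ((starRingEnd ℂ) (fderiv ℝ F (χ p) (Pi.single a 1)) *
      fderiv ℝ F (χ p) (Pi.single b 1)).im ≠ 0) {N : Set (RealSpace n)} (hN : N ∈ 𝓝 (χ p)) :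
    ∃ χ' ∈ analyticCharts n Y, p ∈ χ'.source ∧ χ'.source ⊆ χ.source ∧
      (∀ q ∈ χ'.source, χ q ∈ N) ∧ ∀ q ∈ χ'.source, χ' q = adaptedCoord F (χ p) a b (χ q) := by
  obtain ⟨h, hx, hs, hc, h1, h2⟩ := exists_openPartialHomeomorph_adaptedCoord hF hab hN
  refine ⟨χ.trans h, trans_mem_analyticCharts hχ h1 h2, ⟨hp, hx⟩, fun q hq => hq.1,
    fun q hq => hs hq.2, fun q hq => hc _ hq.2⟩

theorem restrOpen_mem_analyticCharts {χ : OpenPartialHomeomorph Y (RealSpace n)}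
    (hχ : χ ∈ analyticCharts n Y) {N : Set (RealSpace n)} (hN : IsOpen N) :
    χ.trans (OpenPartialHomeomorph.ofSet N hN) ∈ analyticCharts n Y :=
  trans_mem_analyticCharts hχ contDiffOn_id contDiffOn_id

end Charts

namespace RegularFan

variable {n : ℕ} {S : RegularFan n} {c : (Fin n → ℕ) → (Fin n → ℕ) → ℂ} {f : Cn n → ℂ}

/-! ### The resolution map in the standard coordinates -/

theorem resolutionMap_parametrization (σ : S.Chart) (ε : Fin n → Bool) (x : RealSpace n) :
    S.resolutionMap (S.parametrization σ ε x) = monomialMap σ.mat (chartCoord σ ε x) := rfl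

theorem analyticAt_resolutionMap_parametrization (σ : S.Chart) (ε : Fin n → Bool)
    (x : RealSpace n) :
    AnalyticAt ℝ (fun x => S.resolutionMap (S.parametrization σ ε x)) x := by
  rw [analyticAt_pi_iff]
  intro i
  have h : ∀ x, S.resolutionMap (S.parametrization σ ε x) i = ∏ j, chartCoord σ ε x j ^ σ.1 j i :=
    fun x => (Finset.prod_congr rfl fun j _ => by simp [Chart.mat] :
      ∏ j, chartCoord σ ε x j ^ σ.mat i j = _)
  simp only [h]
  exact Finset.analyticAt_fun_prod _ fun j _ => (analyticAt_chartCoord σ ε j x).pow _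

theorem continuous_resolutionMap_parametrization (σ : S.Chart) (ε : Fin n → Bool) :
    Continuous fun x => S.resolutionMap (S.parametrization σ ε x) :=
  continuous_iff_continuousAt.2 fun x =>
    (analyticAt_resolutionMap_parametrization σ ε x).continuousAt

theorem continuous_resolutionMap (S : RegularFan n) : Continuous S.resolutionMap := by
  refine continuous_iff_continuousAt.2 fun q => ?_
  obtain ⟨σ, ε, x, rfl⟩ := exists_parametrization_eq q
  exact (isOpenEmbedding_parametrization σ ε).continuousAt_iff.1
    (continuous_resolutionMap_parametrization σ ε).continuousAt

theorem contMDiff_resolutionMap (S : RegularFan n) :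
    ContMDiff 𝓘(ℝ, RealSpace n) 𝓘(ℝ, Cn n) ω S.resolutionMap := by
  intro q
  obtain ⟨σ, ε, x, rfl⟩ := exists_parametrization_eq q
  have := isManifold_realBlowup S
  have h1 : ContMDiffAt 𝓘(ℝ, RealSpace n) 𝓘(ℝ, RealSpace n) ω (stdChart σ ε)
      (S.parametrization σ ε x) :=
    contMDiffAt_of_mem_maximalAtlas (stdChart_mem_analyticCharts σ ε)
      (parametrization_mem_source σ ε x)
  have h2 : ContMDiffAt 𝓘(ℝ, RealSpace n) 𝓘(ℝ, Cn n) ω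
      (fun x => S.resolutionMap (S.parametrization σ ε x))
      (stdChart σ ε (S.parametrization σ ε x)) :=
    (analyticAt_resolutionMap_parametrization σ ε _).contDiffAt.contMDiffAt
  refine (h2.comp _ h1).congr_of_eventuallyEq ?_
  filter_upwards [(stdChart σ ε).open_source.mem_nhds (parametrization_mem_source σ ε x)] with q hq
  rw [stdChart_source] at hq
  obtain ⟨y, rfl⟩ := hq
  rw [Function.comp_apply, stdChart_parametrization]

theorem monomialMap_mat_eq_zero {σ : S.Chart} {j : Fin n} (hp : StrictlyPositive (σ.1 j))
    {u : Cn n} (hu : u j = 0) : monomialMap σ.mat u = 0 := by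
  funext i
  refine Finset.prod_eq_zero (Finset.mem_univ j) ?_
  rw [hu]
  refine zero_zpow _ ?_
  simpa [Chart.mat] using (hp i).ne'

/-- A point of a chart lies over the origin if and only if it lies on one of the exceptional
divisors, provided the sum of vertices `σ_j`, `j ∈ K`, is strictly positive only if one of them
is. -/
theorem monomialMap_mat_eq_zero_iff {σ : S.Chart}
    (hexc : ∀ K : Finset (Fin n), StrictlyPositive (faceWeight σ K) →
      ∃ j ∈ K, StrictlyPositive (σ.1 j)) {u : Cn n} :
    monomialMap σ.mat u = 0 ↔ ∃ j, StrictlyPositive (σ.1 j) ∧ u j = 0 := by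
  classical
  constructor
  · intro h
    obtain ⟨j, hj, hp⟩ := hexc (Finset.univ.filter fun j => u j = 0) fun i => by
      obtain ⟨j, -, hj⟩ := Finset.prod_eq_zero_iff.1 (congrFun h i)
      have hu : u j = 0 := by
        by_contra h0
        exact zpow_ne_zero _ h0 hj
      have hij : σ.1 j i ≠ 0 := by
        intro h0
        simp [Chart.mat, h0] at hj
      rw [faceWeight, Finset.sum_apply]
      exact (Nat.pos_of_ne_zero hij).trans_le (Finset.single_le_sum (f := fun j => σ.1 j i)
        (fun _ _ => Nat.zero_le _) (Finset.mem_filter.2 ⟨Finset.mem_univ j, hu⟩))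
    exact ⟨j, hp, (Finset.mem_filter.1 hj).2⟩
  · rintro ⟨j, hp, hu⟩
    exact monomialMap_mat_eq_zero hp hu

theorem parametrization_mem_exceptionalDivisor_iff {P : S.positiveVertices} {σ : S.Chart}
    {ε : Fin n → Bool} {x : RealSpace n} :
    S.parametrization σ ε x ∈ S.exceptionalDivisor P ↔
      ∃ j, σ.1 j = P.1 ∧ x (j, factorIndex (ε j)) = 0 := by
  refine mk_mem_exceptionalDivisor_iff.trans (exists_congr fun j => and_congr_right fun hj => ?_)
  have hs : StrictlyPositive (σ.1 j) := hj ▸ P.2.2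
  exact (chartCoord_exc_eq_zero_iff hs ε x).trans (by rw [realFactor_eq])

/-! ### The local structure of `f ∘ Φ` along the exceptional divisors -/

/-- The indices of the exceptional coordinates that vanish at a point. -/
def vanishingExc (σ : S.Chart) (ε : Fin n → Bool) (x : RealSpace n) : Finset (Fin n) :=
  open Classical in
  Finset.univ.filter fun j => StrictlyPositive (σ.1 j) ∧ chartCoord σ ε x j = 0

theorem mem_vanishingExc {σ : S.Chart} {ε : Fin n → Bool} {x : RealSpace n} {j : Fin n} :
    j ∈ vanishingExc σ ε x ↔ StrictlyPositive (σ.1 j) ∧ chartCoord σ ε x j = 0 := by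
  simp [vanishingExc]

theorem coord_eq_zero_of_mem_vanishingExc {σ : S.Chart} {ε : Fin n → Bool} {x : RealSpace n}
    {j : Fin n} (hj : j ∈ vanishingExc σ ε x) : x (j, factorIndex (ε j)) = 0 := by
  rw [← realFactor_eq ε x j]
  exact (chartCoord_exc_eq_zero_iff (mem_vanishingExc.1 hj).1 ε x).1 (mem_vanishingExc.1 hj).2

/-- The factorization of `f ∘ Φ` near a point over the origin, for a set of vanishing exceptional
coordinates. -/
theorem eventually_eq_prod_mul_quotientSeries (hf : HasMixedExpansion f c) {σ : S.Chart}
    {ε : Fin n → Bool} {x₀ : RealSpace n} {J : Finset (Fin n)} (hne : J.Nonempty)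
    (hJ : J ⊆ vanishingExc σ ε x₀)
    (h0 : S.resolutionMap (S.parametrization σ ε x₀) = 0) :
    ∀ᶠ x in 𝓝 x₀, AnalyticAt ℝ (quotientSeries c σ J ε) x ∧
      f (S.resolutionMap (S.parametrization σ ε x)) =
        (∏ j ∈ J, (x (j, factorIndex (ε j)) : ℂ) ^ radialDegree c (σ.1 j)) *
          quotientSeries c σ J ε x := by
  have hJs : ∀ j ∈ J, StrictlyPositive (σ.1 j) := fun j hj => (mem_vanishingExc.1 (hJ hj)).1
  have h1 : AnalyticAt ℝ (quotientSeries c σ J ε) x₀ := analyticAt_quotientSeries hf hne hJs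
    fun j hj => by
      rw [realFactor_eq]
      exact coord_eq_zero_of_mem_vanishingExc (hJ hj)
  have h2 : ∀ᶠ x in 𝓝 x₀, HasSum (fun p : (Fin n → ℕ) × (Fin n → ℕ) => c p.1 p.2 *
      mixedMonomial p.1 p.2 (S.resolutionMap (S.parametrization σ ε x)))
      (f (S.resolutionMap (S.parametrization σ ε x))) := by
    have h3 := (continuous_resolutionMap_parametrization σ ε).tendsto x₀
    rw [h0] at h3
    exact h3.eventually hf
  filter_upwards [h1.eventually_analyticAt, h2] with x hx1 hx2
  refine ⟨hx1, ?_⟩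
  have h4 := eq_prod_mul_quotientSeries hJs (ε := ε) (x := x) hx2
  simp only [realFactor_eq] at h4
  exact h4

theorem eventually_vanishingExc_subset (σ : S.Chart) (ε : Fin n → Bool) (x₀ : RealSpace n) :
    ∀ᶠ x in 𝓝 x₀, vanishingExc σ ε x ⊆ vanishingExc σ ε x₀ := by
  have h : ∀ j, ∀ᶠ x in 𝓝 x₀, j ∈ vanishingExc σ ε x → j ∈ vanishingExc σ ε x₀ := by
    intro j
    by_cases hj : j ∈ vanishingExc σ ε x₀
    · exact Eventually.of_forall fun _ _ => hj
    · by_cases hs : StrictlyPositive (σ.1 j)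
      · have h1 : chartCoord σ ε x₀ j ≠ 0 := fun h => hj (mem_vanishingExc.2 ⟨hs, h⟩)
        filter_upwards [(analyticAt_chartCoord σ ε j x₀).continuousAt.eventually_ne h1] with x hx h
        exact absurd (mem_vanishingExc.1 h).2 hx
      · exact Eventually.of_forall fun x h => absurd (mem_vanishingExc.1 h).1 hs
  filter_upwards [eventually_all.2 h] with x hx j hj using hx j hj

/-- The quotient series vanishes on the strict transform. -/
theorem quotientSeries_eq_zero_of_mem_strictTransform {σ : S.Chart} {ε : Fin n → Bool}
    {J : Finset (Fin n)} {N : Set (RealSpace n)} (hN : IsOpen N)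
    (hF : ∀ x ∈ N, AnalyticAt ℝ (quotientSeries c σ J ε) x)
    (hfac : ∀ x ∈ N, f (S.resolutionMap (S.parametrization σ ε x)) =
        (∏ j ∈ J, (x (j, factorIndex (ε j)) : ℂ) ^ radialDegree c (σ.1 j)) *
          quotientSeries c σ J ε x)
    (hzero : ∀ x ∈ N, S.resolutionMap (S.parametrization σ ε x) = 0 ↔
      ∃ j ∈ J, x (j, factorIndex (ε j)) = 0) {x : RealSpace n} (hx : x ∈ N)
    (hs : S.parametrization σ ε x ∈ strictTransform f S.resolutionMap) :
    quotientSeries c σ J ε x = 0 := by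
  by_contra h0
  have h1 : ∀ᶠ y in 𝓝 x, quotientSeries c σ J ε y ≠ 0 := (hF x hx).continuousAt.eventually_ne h0
  obtain ⟨M, hM, hMo, hxM⟩ := eventually_nhds_iff.1 h1
  obtain ⟨q, ⟨y, hy, rfl⟩, hq⟩ := mem_closure_iff.1 hs (S.parametrization σ ε '' (M ∩ N))
    (isOpenMap_parametrization σ ε _ (hMo.inter hN)) ⟨x, ⟨hxM, hx⟩, rfl⟩
  have h2 : ¬ ∃ j ∈ J, y (j, factorIndex (ε j)) = 0 := fun h => hq.2 ((hzero y hy.2).2 h)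
  have h3 := hfac y hy.2
  rw [show f (S.resolutionMap (S.parametrization σ ε y)) = 0 from hq.1] at h3
  refine (mul_ne_zero (Finset.prod_ne_zero_iff.2 fun j hj => pow_ne_zero _ ?_) (hM y hy.1)) h3.symm
  exact_mod_cast fun h => h2 ⟨j, hj, h⟩

/-- Near a point over the origin: the factorization of `f ∘ Φ` and the exceptional divisors. -/
theorem exists_nhds_factorization (hf : HasMixedExpansion f c) {σ : S.Chart}
    (hexc : ∀ K : Finset (Fin n), StrictlyPositive (faceWeight σ K) →
      ∃ j ∈ K, StrictlyPositive (σ.1 j))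
    {ε : Fin n → Bool} {x₀ : RealSpace n}
    (h0 : S.resolutionMap (S.parametrization σ ε x₀) = 0) :
    ∃ N : Set (RealSpace n), IsOpen N ∧ x₀ ∈ N ∧
      (∀ x ∈ N, AnalyticAt ℝ (quotientSeries c σ (vanishingExc σ ε x₀) ε) x) ∧
      (∀ x ∈ N, f (S.resolutionMap (S.parametrization σ ε x)) =
        (∏ j ∈ vanishingExc σ ε x₀, (x (j, factorIndex (ε j)) : ℂ) ^ radialDegree c (σ.1 j)) *
          quotientSeries c σ (vanishingExc σ ε x₀) ε x) ∧
      (∀ x ∈ N, vanishingExc σ ε x ⊆ vanishingExc σ ε x₀) ∧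
      (∀ x ∈ N, S.resolutionMap (S.parametrization σ ε x) = 0 ↔
        ∃ j ∈ vanishingExc σ ε x₀, x (j, factorIndex (ε j)) = 0) := by
  have hne : (vanishingExc σ ε x₀).Nonempty := by
    obtain ⟨j, hj⟩ := (monomialMap_mat_eq_zero_iff hexc).1 h0
    exact ⟨j, mem_vanishingExc.2 hj⟩
  have h1 := eventually_eq_prod_mul_quotientSeries hf hne Subset.rfl h0
  obtain ⟨N, hN, hNo, hxN⟩ := eventually_nhds_iff.1
    (h1.and (eventually_vanishingExc_subset σ ε x₀))
  refine ⟨N, hNo, hxN, fun x hx => (hN x hx).1.1, fun x hx => (hN x hx).1.2,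
    fun x hx => (hN x hx).2, fun x hx => ?_⟩
  rw [resolutionMap_parametrization, monomialMap_mat_eq_zero_iff hexc]
  constructor
  · rintro ⟨j, hj⟩
    have h2 := mem_vanishingExc.2 hj
    exact ⟨j, (hN x hx).2 h2, coord_eq_zero_of_mem_vanishingExc h2⟩
  · rintro ⟨j, hj, hj0⟩
    have hs := (mem_vanishingExc.1 hj).1
    refine ⟨j, hs, (chartCoord_exc_eq_zero_iff hs ε x).2 ?_⟩
    rw [realFactor_eq, hj0]

/-- Real analytic coordinates at a point over the origin on the strict transform, in which
`f ∘ Φ` is the product of a monomial in the exceptional coordinates and of `x_a + i x_b`. -/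
theorem exists_adapted_chart (hf : HasMixedExpansion f c) (hnd : IsNonDegenerate c)
    (hax : ∀ i, ∃ ν μ, c ν μ ≠ 0 ∧ ∀ k, k ≠ i → (ν + μ) k = 0) (hadm : S.IsAdmissible c)
    (hvert : ∀ P ∈ S.vertices, StrictlyPositive P ∨ ∃ i, P = Pi.single i 1) {σ : S.Chart}
    (hexc : ∀ K : Finset (Fin n), StrictlyPositive (faceWeight σ K) →
      ∃ j ∈ K, StrictlyPositive (σ.1 j))
    {ε : Fin n → Bool} {x₀ : RealSpace n}
    (h0 : S.resolutionMap (S.parametrization σ ε x₀) = 0)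
    (hs : S.parametrization σ ε x₀ ∈ strictTransform f S.resolutionMap) :
    ∃ χ ∈ analyticCharts n S.RealBlowup, S.parametrization σ ε x₀ ∈ χ.source ∧
      χ (S.parametrization σ ε x₀) = 0 ∧ ∃ a b, a ≠ b ∧
      (∀ j ∈ vanishingExc σ ε x₀, a ≠ (j, factorIndex (ε j)) ∧ b ≠ (j, factorIndex (ε j))) ∧
      (∀ q ∈ χ.source, f (S.resolutionMap q) =
        (∏ j ∈ vanishingExc σ ε x₀, (χ q (j, factorIndex (ε j)) : ℂ) ^ radialDegree c (σ.1 j)) *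
          ((χ q a : ℂ) + Complex.I * (χ q b : ℂ))) ∧
      (∀ q ∈ χ.source, ∀ P : S.positiveVertices, q ∈ S.exceptionalDivisor P ↔
        ∃ j ∈ vanishingExc σ ε x₀, σ.1 j = P.1 ∧ χ q (j, factorIndex (ε j)) = 0) ∧
      (∀ q ∈ χ.source, q ∈ strictTransform f S.resolutionMap ↔ χ q a = 0 ∧ χ q b = 0) := by
  obtain ⟨N, hNo, hxN, hF, hfac, hsub, hzero⟩ := exists_nhds_factorization hf hexc h0
  set J := vanishingExc σ ε x₀ with hJ
  have hne : J.Nonempty := by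
    obtain ⟨j, hj, -⟩ := (hzero x₀ hxN).1 h0
    exact ⟨j, hj⟩
  have hF0 := quotientSeries_eq_zero_of_mem_strictTransform hNo hF hfac hzero hxN hs
  set T : Set (Fin n × Fin 2) := {k | ∃ j ∈ J, k = (j, factorIndex (ε j))} with hT
  obtain ⟨a, b, ha, hb, hab⟩ := exists_pair_of_surjective
    (fderiv ℝ (quotientSeries c σ J ε) x₀) T fun y => by
      obtain ⟨v, hv, hvy⟩ := surjective_fderiv_quotientSeries hf hnd hax hadm hvert hne
        (fun j => mem_vanishingExc) hF0 y
      refine ⟨v, ?_, hvy⟩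
      rintro _ ⟨j, hj, rfl⟩
      exact hv j hj
  have hne_ab : a ≠ b := by
    rintro rfl
    apply hab
    rw [← Complex.normSq_eq_conj_mul_self, Complex.ofReal_im]
  have hTa : ∀ j ∈ J, (j, factorIndex (ε j)) ≠ a := fun j hj h => ha ⟨j, hj, h.symm⟩
  have hTb : ∀ j ∈ J, (j, factorIndex (ε j)) ≠ b := fun j hj h => hb ⟨j, hj, h.symm⟩
  have hx₀ := stdChart_parametrization σ ε x₀
  obtain ⟨χ, hχ, hpχ, hχs, hχN, hχe⟩ := exists_chart_adaptedCoord
    (stdChart_mem_analyticCharts σ ε) (parametrization_mem_source σ ε x₀)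
    (F := quotientSeries c σ J ε) (a := a) (b := b) (N := N) (by rw [hx₀]; exact hF _ hxN)
    (by rw [hx₀]; exact hab) (by rw [hx₀]; exact hNo.mem_nhds hxN)
  rw [hx₀] at hχe
  -- every point of the source is `param x` with `x ∈ N`
  have hpar : ∀ q ∈ χ.source, ∃ x ∈ N, S.parametrization σ ε x = q ∧ stdChart σ ε q = x := by
    intro q hq
    have h1 := hχs hq
    rw [stdChart_source] at h1
    obtain ⟨x, rfl⟩ := h1
    have h2 := hχN _ hq
    rw [stdChart_parametrization] at h2
    exact ⟨x, h2, rfl, stdChart_parametrization σ ε x⟩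
  have hcJ : ∀ x, S.parametrization σ ε x ∈ χ.source → ∀ j ∈ J,
      χ (S.parametrization σ ε x) (j, factorIndex (ε j)) = x (j, factorIndex (ε j)) := by
    intro x hx j hj
    rw [hχe _ hx, stdChart_parametrization, adaptedCoord, if_neg (hTa j hj), if_neg (hTb j hj),
      coord_eq_zero_of_mem_vanishingExc hj, sub_zero]
  have hca : ∀ x, S.parametrization σ ε x ∈ χ.source →
      χ (S.parametrization σ ε x) a = (quotientSeries c σ J ε x).re := by
    intro x hx
    rw [hχe _ hx, stdChart_parametrization, adaptedCoord, if_pos rfl]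
  have hcb : ∀ x, S.parametrization σ ε x ∈ χ.source →
      χ (S.parametrization σ ε x) b = (quotientSeries c σ J ε x).im := by
    intro x hx
    rw [hχe _ hx, stdChart_parametrization, adaptedCoord, if_neg hne_ab.symm, if_pos rfl]
  refine ⟨χ, hχ, hpχ, ?_, a, b, hne_ab, fun j hj => ⟨(hTa j hj).symm, (hTb j hj).symm⟩,
    ?_, ?_, ?_⟩
  · funext k
    rw [hχe _ hpχ, hx₀, adaptedCoord, hF0]
    split_ifs <;> simp
  · intro q hq
    obtain ⟨x, hx, rfl, -⟩ := hpar q hq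
    rw [hfac x hx, hca x hq, hcb x hq]
    congr 1
    · exact Finset.prod_congr rfl fun j hj => by rw [hcJ x hq j hj]
    · rw [mul_comm, Complex.re_add_im]
  · intro q hq P
    obtain ⟨x, hx, rfl, -⟩ := hpar q hq
    rw [parametrization_mem_exceptionalDivisor_iff]
    constructor
    · rintro ⟨j, hj, hj0⟩
      have hjJ : j ∈ J := by
        have hsj : StrictlyPositive (σ.1 j) := by rw [hj]; exact P.2.2
        refine hsub x hx (mem_vanishingExc.2 ⟨hsj, (chartCoord_exc_eq_zero_iff hsj ε x).2 ?_⟩)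
        rw [realFactor_eq, hj0]
      exact ⟨j, hjJ, hj, (hcJ x hq j hjJ).trans hj0⟩
    · rintro ⟨j, hjJ, hj, hj0⟩
      exact ⟨j, hj, (hcJ x hq j hjJ).symm.trans hj0⟩
  · intro q hq
    constructor
    · intro h
      obtain ⟨x, hx, rfl, -⟩ := hpar q hq
      have h1 := quotientSeries_eq_zero_of_mem_strictTransform hNo hF hfac hzero hx h
      rw [hca x hq, hcb x hq, h1]
      exact ⟨rfl, rfl⟩
    · rintro ⟨h1, h2⟩
      classical
      -- move the exceptional coordinates away from zero
      set e : RealSpace n := fun k => if k ∈ T then 1 else 0 with he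
      have hcont : Tendsto (fun t : ℝ => χ.symm (χ q + t • e)) (𝓝[≠] 0) (𝓝 q) := by
        have h3 : Tendsto (fun t : ℝ => χ q + t • e) (𝓝 0) (𝓝 (χ q)) := by
          have : Continuous fun t : ℝ => χ q + t • e := by fun_prop
          simpa using this.tendsto 0
        have h4 := (χ.continuousAt_symm (χ.map_source hq)).tendsto
        rw [χ.left_inv hq] at h4
        exact (h4.comp h3).mono_left nhdsWithin_le_nhds
      have htar : ∀ᶠ t : ℝ in 𝓝[≠] 0, χ q + t • e ∈ χ.target := by
        have : Continuous fun t : ℝ => χ q + t • e := by fun_prop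
        have h3 := this.tendsto 0
        rw [zero_smul, add_zero] at h3
        exact (h3.mono_left nhdsWithin_le_nhds).eventually
          (χ.open_target.mem_nhds (χ.map_source hq))
      have hnz : ∀ᶠ t : ℝ in 𝓝[≠] 0, ∀ j ∈ J, χ q (j, factorIndex (ε j)) + t ≠ 0 := by
        rw [Filter.eventually_all_finset]
        intro j _
        by_cases h3 : χ q (j, factorIndex (ε j)) = 0
        · filter_upwards [self_mem_nhdsWithin] with t ht
          rw [h3, zero_add]
          exact ht
        · have h4 : ContinuousAt (fun t : ℝ => χ q (j, factorIndex (ε j)) + t) 0 := by fun_prop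
          exact (h4.eventually_ne (by simpa using h3)).filter_mono nhdsWithin_le_nhds
      refine mem_closure_of_tendsto hcont ?_
      filter_upwards [htar, hnz] with t ht1 ht2
      have hy := χ.map_target ht1
      have hχy := χ.right_inv ht1
      obtain ⟨x, hx, hxy, -⟩ := hpar _ hy
      rw [← hxy] at hy hχy ⊢
      have h3 : quotientSeries c σ J ε x = 0 := by
        refine Complex.ext ?_ ?_
        · rw [← hca x hy, hχy]
          simp [he, h1, ha]
        · rw [← hcb x hy, hχy]
          simp [he, h2, hb]
      refine ⟨?_, ?_⟩
      · change f _ = 0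
        rw [hfac x hx, h3, mul_zero]
      · intro h4
        obtain ⟨j, hj, hj0⟩ := (hzero x hx).1 h4
        rw [← hcJ x hy j hj, hχy] at hj0
        refine ht2 j hj ?_
        have hmem : (j, factorIndex (ε j)) ∈ T := ⟨j, hj, rfl⟩
        simpa [he, hmem] using hj0

/-! ### Exceptional divisors, strict transform and multiplicities -/

/-- The vertex `σ_j` as a strictly positive vertex of the fan. -/
def Chart.positiveVertex (σ : S.Chart) {j : Fin n} (hj : StrictlyPositive (σ.1 j)) :
    S.positiveVertices := ⟨σ.1 j, σ.mem_vertices j, hj⟩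

theorem iUnion_exceptionalDivisor (hexc : ∀ (σ : S.Chart) (K : Finset (Fin n)),
      StrictlyPositive (faceWeight σ K) → ∃ j ∈ K, StrictlyPositive (σ.1 j)) :
    ⋃ P, S.exceptionalDivisor P = S.resolutionMap ⁻¹' {0} := by
  ext q
  obtain ⟨σ, ε, x, rfl⟩ := exists_parametrization_eq q
  rw [mem_iUnion, mem_preimage, mem_singleton_iff, resolutionMap_parametrization,
    monomialMap_mat_eq_zero_iff (hexc σ)]
  simp only [parametrization_mem_exceptionalDivisor_iff]
  constructor
  · rintro ⟨P, j, hj, hj0⟩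
    have hs : StrictlyPositive (σ.1 j) := hj ▸ P.2.2
    refine ⟨j, hs, (chartCoord_exc_eq_zero_iff hs ε x).2 ?_⟩
    rw [realFactor_eq, hj0]
  · rintro ⟨j, hs, hj0⟩
    refine ⟨σ.positiveVertex hs, j, rfl, ?_⟩
    exact coord_eq_zero_of_mem_vanishingExc (mem_vanishingExc.2 ⟨hs, hj0⟩)

theorem smooth_exceptionalDivisor (P : S.positiveVertices) {p : S.RealBlowup}
    (hp : p ∈ S.exceptionalDivisor P) : IsSubmanifoldAt n (S.exceptionalDivisor P) 1 p := by
  obtain ⟨σ, ε, x, rfl⟩ := exists_parametrization_eq p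
  obtain ⟨j, hj, -⟩ := parametrization_mem_exceptionalDivisor_iff.1 hp
  refine ⟨stdChart σ ε, stdChart_mem_analyticCharts σ ε, parametrization_mem_source σ ε x,
    {(j, factorIndex (ε j))}, Finset.card_singleton _, fun q hq => ?_⟩
  rw [stdChart_source] at hq
  obtain ⟨y, rfl⟩ := hq
  rw [stdChart_parametrization, parametrization_mem_exceptionalDivisor_iff]
  simp only [Finset.mem_singleton, forall_eq]
  constructor
  · rintro ⟨k, hk, hk0⟩
    rwa [σ.injective (hj.trans hk.symm)]
  · exact fun h => ⟨j, hj, h⟩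

/-- The normal form of `f ∘ Φ` at the points of the strict transform over the origin. -/
theorem exists_normal_form (hf : HasMixedExpansion f c) (hnd : IsNonDegenerate c)
    (hax : ∀ i, ∃ ν μ, c ν μ ≠ 0 ∧ ∀ k, k ≠ i → (ν + μ) k = 0) (hadm : S.IsAdmissible c)
    (hvert : ∀ P ∈ S.vertices, StrictlyPositive P ∨ ∃ i, P = Pi.single i 1)
    (hexc : ∀ (σ : S.Chart) (K : Finset (Fin n)),
      StrictlyPositive (faceWeight σ K) → ∃ j ∈ K, StrictlyPositive (σ.1 j))
    {p : S.RealBlowup} (hp : p ∈ strictTransform f S.resolutionMap)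
    (I : Finset S.positiveVertices) (hI : I.Nonempty)
    (hIp : ∀ k, k ∈ I ↔ p ∈ S.exceptionalDivisor k) :
    ∃ χ ∈ analyticCharts n S.RealBlowup, p ∈ χ.source ∧ χ p = 0 ∧
      ∃ (m : I → ℕ) (e : I ⊕ Fin 2 → Fin n × Fin 2), Function.Injective e ∧
        (∀ q ∈ χ.source, f (S.resolutionMap q) = (∏ k : I, (χ q (e (.inl k)) : ℂ) ^ m k) *
          ((χ q (e (.inr 0)) : ℂ) + Complex.I * (χ q (e (.inr 1)) : ℂ))) ∧
        (∀ q ∈ χ.source, ∀ k : I, q ∈ S.exceptionalDivisor k ↔ χ q (e (.inl k)) = 0) ∧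
        (∀ q ∈ χ.source, q ∈ strictTransform f S.resolutionMap ↔
          (χ q (e (.inr 0)) : ℂ) + Complex.I * (χ q (e (.inr 1)) : ℂ) = 0) := by
  obtain ⟨σ, ε, x₀, rfl⟩ := exists_parametrization_eq p
  have h0 : S.resolutionMap (S.parametrization σ ε x₀) = 0 := by
    obtain ⟨k, hk⟩ := hI
    have : S.parametrization σ ε x₀ ∈ ⋃ P, S.exceptionalDivisor P :=
      mem_iUnion.2 ⟨k, (hIp k).1 hk⟩
    rw [iUnion_exceptionalDivisor hexc] at this
    exact this
  obtain ⟨χ, hχ, hpχ, hχ0, a, b, hab, habJ, hfac, hE, hst⟩ :=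
    exists_adapted_chart hf hnd hax hadm hvert (hexc σ) h0 hp
  have hIJ : ∀ k : I, ∃ j ∈ vanishingExc σ ε x₀, σ.1 j = k.1.1 := by
    intro k
    obtain ⟨j, hj, hjk, -⟩ := (hE _ hpχ k).1 ((hIp k).1 k.2)
    exact ⟨j, hj, hjk⟩
  choose jj hjJ hjk using hIJ
  have hinj : Function.Injective jj := fun k l h => by
    refine Subtype.ext (Subtype.ext ?_)
    rw [← hjk k, ← hjk l, h]
  have hsurj : ∀ j ∈ vanishingExc σ ε x₀, ∃ k : I, jj k = j := by
    intro j hj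
    have hs := (mem_vanishingExc.1 hj).1
    have hmem : σ.positiveVertex hs ∈ I := by
      rw [hIp, hE _ hpχ]
      exact ⟨j, hj, rfl, by rw [hχ0]; rfl⟩
    exact ⟨⟨_, hmem⟩, σ.injective (hjk ⟨_, hmem⟩)⟩
  refine ⟨χ, hχ, hpχ, hχ0, fun k => radialDegree c (σ.1 (jj k)),
    Sum.elim (fun k => (jj k, factorIndex (ε (jj k)))) ![a, b], ?_, ?_, ?_, ?_⟩
  · refine Function.Injective.sumElim ?_ ?_ ?_
    · exact fun k l h => hinj (congrArg Prod.fst h)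
    · intro s t h
      fin_cases s <;> fin_cases t <;> simp_all
    · intro k t h
      fin_cases t
      · exact (habJ _ (hjJ k)).1 h.symm
      · exact (habJ _ (hjJ k)).2 h.symm
  · intro q hq
    rw [hfac q hq]
    congr 1
    symm
    refine Finset.prod_bij (fun k _ => jj k) (fun k _ => hjJ k) (fun k _ l _ h => hinj h) ?_ ?_
    · intro j hj
      obtain ⟨k, hk⟩ := hsurj j hj
      exact ⟨k, Finset.mem_univ k, hk⟩
    · exact fun k _ => rfl
  · intro q hq k
    rw [hE q hq]
    constructor
    · rintro ⟨j, hj, hjk', hj0⟩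
      rw [← σ.injective ((hjk k).trans hjk'.symm)] at hj0
      exact hj0
    · exact fun h => ⟨jj k, hjJ k, hjk k, h⟩
  · intro q hq
    rw [hst q hq, Complex.ext_iff]
    simp

/-- The strict transform is smooth of codimension two near the points over the origin. -/
theorem strict_smooth_nhds (hf : HasMixedExpansion f c) (hnd : IsNonDegenerate c)
    (hax : ∀ i, ∃ ν μ, c ν μ ≠ 0 ∧ ∀ k, k ≠ i → (ν + μ) k = 0) (hadm : S.IsAdmissible c)
    (hvert : ∀ P ∈ S.vertices, StrictlyPositive P ∨ ∃ i, P = Pi.single i 1)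
    (hexc : ∀ (σ : S.Chart) (K : Finset (Fin n)),
      StrictlyPositive (faceWeight σ K) → ∃ j ∈ K, StrictlyPositive (σ.1 j)) :
    ∃ W : Set S.RealBlowup, IsOpen W ∧ S.resolutionMap ⁻¹' {0} ⊆ W ∧
      ∀ p ∈ strictTransform f S.resolutionMap ∩ W,
        IsSubmanifoldAt n (strictTransform f S.resolutionMap) 2 p := by
  refine ⟨interior {q | q ∈ strictTransform f S.resolutionMap →
    IsSubmanifoldAt n (strictTransform f S.resolutionMap) 2 q}, isOpen_interior, ?_,
    fun p hp => interior_subset hp.2 hp.1⟩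
  intro p h0
  rw [mem_interior_iff_mem_nhds]
  by_cases hp : p ∈ strictTransform f S.resolutionMap
  · obtain ⟨σ, ε, x₀, rfl⟩ := exists_parametrization_eq p
    obtain ⟨χ, hχ, hpχ, hχ0, a, b, hab, -, -, -, hst⟩ :=
      exists_adapted_chart hf hnd hax hadm hvert (hexc σ) h0 hp
    filter_upwards [χ.open_source.mem_nhds hpχ] with q hq _
    refine ⟨χ, hχ, hq, {a, b}, Finset.card_pair hab, fun q' hq' => ?_⟩
    rw [hst q' hq']
    simp
  · filter_upwards [isClosed_closure.isOpen_compl.mem_nhds hp] with q hq h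
    exact absurd h hq

/-- Near a point over the origin, the zeros of `f` outside the origin are regular points. -/
theorem eventually_surjective_fderiv (hf : HasMixedExpansion f c) (hnd : IsNonDegenerate c)
    (hax : ∀ i, ∃ ν μ, c ν μ ≠ 0 ∧ ∀ k, k ≠ i → (ν + μ) k = 0) (hadm : S.IsAdmissible c)
    (hvert : ∀ P ∈ S.vertices, StrictlyPositive P ∨ ∃ i, P = Pi.single i 1)
    (hexc : ∀ (σ : S.Chart) (K : Finset (Fin n)),
      StrictlyPositive (faceWeight σ K) → ∃ j ∈ K, StrictlyPositive (σ.1 j))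
    {p : S.RealBlowup} (hp : S.resolutionMap p = 0) :
    ∀ᶠ q in 𝓝 p, S.resolutionMap q ≠ 0 → f (S.resolutionMap q) = 0 →
      Function.Surjective (fderiv ℝ f (S.resolutionMap q)) := by
  obtain ⟨σ, ε, x₀, rfl⟩ := exists_parametrization_eq p
  obtain ⟨N, hNo, hxN, hF, hfac, -, hzero⟩ := exists_nhds_factorization hf (hexc σ) hp
  set J := vanishingExc σ ε x₀ with hJ
  have hne : J.Nonempty := by
    obtain ⟨j, hj, -⟩ := (hzero x₀ hxN).1 hp
    exact ⟨j, hj⟩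
  have hprod : ∀ x ∈ N, S.resolutionMap (S.parametrization σ ε x) ≠ 0 →
      (∏ j ∈ J, (x (j, factorIndex (ε j)) : ℂ) ^ radialDegree c (σ.1 j)) ≠ 0 := by
    intro x hx hx0
    refine Finset.prod_ne_zero_iff.2 fun j hj => pow_ne_zero _ ?_
    exact_mod_cast fun h => hx0 ((hzero x hx).2 ⟨j, hj, h⟩)
  suffices h : ∀ᶠ x in 𝓝 x₀, S.resolutionMap (S.parametrization σ ε x) ≠ 0 →
      f (S.resolutionMap (S.parametrization σ ε x)) = 0 →
      Function.Surjective (fderiv ℝ f (S.resolutionMap (S.parametrization σ ε x))) by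
    rw [← (isOpenEmbedding_parametrization σ ε).map_nhds_eq]
    exact h
  by_cases hF0 : quotientSeries c σ J ε x₀ = 0
  swap
  · filter_upwards [hNo.mem_nhds hxN, (hF x₀ hxN).continuousAt.eventually_ne hF0]
      with x hx hx1 h1 h2
    rw [hfac x hx] at h2
    exact absurd h2 (mul_ne_zero (hprod x hx h1) hx1)
  obtain ⟨a, b, -, -, hab⟩ := exists_pair_of_surjective
    (fderiv ℝ (quotientSeries c σ J ε) x₀) ∅ fun y => by
      obtain ⟨v, -, hvy⟩ := surjective_fderiv_quotientSeries hf hnd hax hadm hvert hne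
        (fun j => mem_vanishingExc) hF0 y
      exact ⟨v, fun k hk => absurd hk (notMem_empty k), hvy⟩
  have hcont : ContinuousAt (fderiv ℝ (quotientSeries c σ J ε)) x₀ :=
    (hF x₀ hxN).fderiv.continuousAt
  have hcont' : ContinuousAt (fun x => ((starRingEnd ℂ)
      (fderiv ℝ (quotientSeries c σ J ε) x (Pi.single a 1)) *
      fderiv ℝ (quotientSeries c σ J ε) x (Pi.single b 1)).im) x₀ := by
    have h1 : ∀ v, ContinuousAt (fun x => fderiv ℝ (quotientSeries c σ J ε) x v) x₀ :=
      fun v => hcont.clm_apply continuousAt_const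
    exact Complex.continuous_im.continuousAt.comp
      ((Complex.continuous_conj.continuousAt.comp (h1 _)).mul (h1 _))
  have hfan : ∀ᶠ x in 𝓝 x₀, AnalyticAt ℝ f (S.resolutionMap (S.parametrization σ ε x)) := by
    have h1 := (continuous_resolutionMap_parametrization σ ε).tendsto x₀
    rw [hp] at h1
    exact h1.eventually hf.eventually_analyticAt
  filter_upwards [hNo.mem_nhds hxN, hcont'.eventually_ne hab, hfan] with x hx hx1 hx2 h1 h2
  have h3 : quotientSeries c σ J ε x = 0 := by
    have := hfac x hx
    rw [h2] at this
    exact (mul_eq_zero.1 this.symm).resolve_left (hprod x hx h1)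
  set M : RealSpace n → ℂ := fun x =>
    ∏ j ∈ J, (x (j, factorIndex (ε j)) : ℂ) ^ radialDegree c (σ.1 j) with hM
  have hMd : DifferentiableAt ℝ M x := by
    refine (Finset.analyticAt_fun_prod _ fun j _ => ?_).differentiableAt
    exact (analyticAt_ofReal_comp (analyticAt_coord _ _)).pow _
  set g : RealSpace n → Cn n := fun x => S.resolutionMap (S.parametrization σ ε x) with hg
  have hgd : HasFDerivAt g (fderiv ℝ g x) x :=
    (analyticAt_resolutionMap_parametrization σ ε x).differentiableAt.hasFDerivAt
  have hd1 : HasFDerivAt (f ∘ g) ((fderiv ℝ f (g x)).comp (fderiv ℝ g x)) x :=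
    HasFDerivAt.comp x hx2.differentiableAt.hasFDerivAt hgd
  have hd2 : HasFDerivAt (f ∘ g) (M x • fderiv ℝ (quotientSeries c σ J ε) x +
      quotientSeries c σ J ε x • fderiv ℝ M x) x := by
    refine (hMd.hasFDerivAt.mul (hF x hx).differentiableAt.hasFDerivAt).congr_of_eventuallyEq ?_
    filter_upwards [hNo.mem_nhds hx] with y hy
    exact hfac y hy
  have hd : ∀ v, fderiv ℝ f (g x) (fderiv ℝ g x v) =
      M x * fderiv ℝ (quotientSeries c σ J ε) x v := by
    intro v
    refine (DFunLike.congr_fun (hd1.unique hd2) v).trans ?_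
    change M x * _ + quotientSeries c σ J ε x * _ = _
    rw [h3, zero_mul, add_zero]
    rfl
  -- the values on two coordinate vectors are linearly independent over `ℝ`
  intro y
  set A := fderiv ℝ (quotientSeries c σ J ε) x (Pi.single a 1)
  set B := fderiv ℝ (quotientSeries c σ J ε) x (Pi.single b 1)
  set w := y / M x with hw
  set D := ((starRingEnd ℂ) A * B).im with hD
  refine ⟨fderiv ℝ g x ((((starRingEnd ℂ) w * B).im / D) • Pi.single a 1 +
    (((starRingEnd ℂ) A * w).im / D) • Pi.single b 1), ?_⟩
  refine (hd _).trans ?_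
  rw [map_add, map_smul, map_smul]
  change M x * ((((starRingEnd ℂ) w * B).im / D) • A + (((starRingEnd ℂ) A * w).im / D) • B) = y
  have h4 : (((starRingEnd ℂ) w * B).im / D) • A + (((starRingEnd ℂ) A * w).im / D) • B = w := by
    have h5 : ((starRingEnd ℂ) w * B).im • A + ((starRingEnd ℂ) A * w).im • B = D • w := by
      rw [hD]
      apply Complex.ext <;> simp <;> ring
    rw [div_eq_inv_mul, div_eq_inv_mul, mul_smul, mul_smul, ← smul_add, h5, inv_smul_smul₀ hx1]
  rw [h4, hw, mul_div_cancel₀ _ (hprod x hx h1)]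

/-- The multiplicity of `f ∘ Φ` along an exceptional divisor. The cofactor does not vanish
identically on the divisor: otherwise its derivative would vanish, at a point that lies on no other
divisor, on the tangent space of the divisor. -/
theorem hasMultiplicityAlong_exceptionalDivisor (hf : HasMixedExpansion f c)
    (hnd : IsNonDegenerate c)
    (hax : ∀ i, ∃ ν μ, c ν μ ≠ 0 ∧ ∀ k, k ≠ i → (ν + μ) k = 0) (hadm : S.IsAdmissible c)
    (hvert : ∀ P ∈ S.vertices, StrictlyPositive P ∨ ∃ i, P = Pi.single i 1)
    (P : S.positiveVertices) :
    HasMultiplicityAlong n (f ∘ S.resolutionMap) (S.exceptionalDivisor P)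
      (radialDegree c P.1) := by
  intro p hp
  obtain ⟨σ, ε, x₀, rfl⟩ := exists_parametrization_eq p
  obtain ⟨j, hj, hj0⟩ := parametrization_mem_exceptionalDivisor_iff.1 hp
  have hs : StrictlyPositive (σ.1 j) := hj ▸ P.2.2
  have hjv : j ∈ vanishingExc σ ε x₀ := by
    refine mem_vanishingExc.2 ⟨hs, (chartCoord_exc_eq_zero_iff hs ε x₀).2 ?_⟩
    rw [realFactor_eq, hj0]
  have h0 : S.resolutionMap (S.parametrization σ ε x₀) = 0 :=
    monomialMap_mat_eq_zero hs (mem_vanishingExc.1 hjv).2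
  obtain ⟨N, hN, hNo, hxN⟩ := eventually_nhds_iff.1
    ((eventually_eq_prod_mul_quotientSeries hf (Finset.singleton_nonempty j)
      (Finset.singleton_subset_iff.2 hjv) h0).and (eventually_vanishingExc_subset σ ε x₀))
  have hpar : ∀ q ∈ ((stdChart σ ε).trans (OpenPartialHomeomorph.ofSet N hNo)).source,
      ∃ x ∈ N, S.parametrization σ ε x = q := by
    intro q hq
    have h1 : q ∈ (stdChart σ ε).source := hq.1
    rw [stdChart_source] at h1
    obtain ⟨x, rfl⟩ := h1
    have h2 : stdChart σ ε (S.parametrization σ ε x) ∈ N := hq.2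
    rw [stdChart_parametrization] at h2
    exact ⟨x, h2, rfl⟩
  have hE : ∀ x, S.parametrization σ ε x ∈ S.exceptionalDivisor P ↔
      x (j, factorIndex (ε j)) = 0 := by
    intro x
    rw [parametrization_mem_exceptionalDivisor_iff]
    constructor
    · rintro ⟨k, hk, hk0⟩
      rwa [σ.injective (hj.trans hk.symm)]
    · exact fun h => ⟨j, hj, h⟩
  refine ⟨(stdChart σ ε).trans (OpenPartialHomeomorph.ofSet N hNo),
    restrOpen_mem_analyticCharts (stdChart_mem_analyticCharts σ ε) hNo,
    ⟨parametrization_mem_source σ ε x₀, ?_⟩, (j, factorIndex (ε j)), ?_,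
    fun q => quotientSeries c σ {j} ε (stdChart σ ε q), ?_, ?_, ?_⟩
  · change stdChart σ ε (S.parametrization σ ε x₀) ∈ N
    rwa [stdChart_parametrization]
  · intro q hq
    obtain ⟨x, hx, rfl⟩ := hpar q hq
    rw [hE]
    change _ ↔ stdChart σ ε (S.parametrization σ ε x) _ = 0
    rw [stdChart_parametrization]
  · intro q hq
    obtain ⟨x, hx, rfl⟩ := hpar q hq
    have := isManifold_realBlowup S
    have h1 : ContMDiffAt 𝓘(ℝ, RealSpace n) 𝓘(ℝ, RealSpace n) ω (stdChart σ ε)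
        (S.parametrization σ ε x) :=
      contMDiffAt_of_mem_maximalAtlas (stdChart_mem_analyticCharts σ ε)
        (parametrization_mem_source σ ε x)
    have h2 : ContMDiffAt 𝓘(ℝ, RealSpace n) 𝓘(ℝ, ℂ) ω (quotientSeries c σ {j} ε)
        (stdChart σ ε (S.parametrization σ ε x)) := by
      rw [stdChart_parametrization]
      exact (hN x hx).1.1.contDiffAt.contMDiffAt
    exact (h2.comp _ h1).contMDiffWithinAt
  · intro q hq
    obtain ⟨x, hx, rfl⟩ := hpar q hq
    have h1 := (hN x hx).1.2
    rw [Finset.prod_singleton, hj] at h1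
    change f (S.resolutionMap (S.parametrization σ ε x)) =
      (stdChart σ ε (S.parametrization σ ε x) _ : ℂ) ^ _ * quotientSeries c σ {j} ε _
    rw [stdChart_parametrization]
    exact h1
  · intro hcon
    have hcon' : ∀ᶠ x in 𝓝 x₀, x (j, factorIndex (ε j)) = 0 →
        quotientSeries c σ {j} ε x = 0 := by
      rw [eventually_nhdsWithin_iff, ← (isOpenEmbedding_parametrization σ ε).map_nhds_eq] at hcon
      filter_upwards [Filter.eventually_map.1 hcon] with x hx hx0
      have := hx ((hE x).2 hx0)
      rwa [stdChart_parametrization, not_not] at this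
    obtain ⟨M, hM, hMo, hxM⟩ := eventually_nhds_iff.1 hcon'
    classical
    -- a nearby point of the divisor that lies on no other exceptional divisor
    set e : RealSpace n := fun k => if k = (j, factorIndex (ε j)) then 0 else 1 with he
    have hlim : Tendsto (fun t : ℝ => x₀ + t • e) (𝓝[≠] 0) (𝓝 x₀) := by
      have h1 : Continuous fun t : ℝ => x₀ + t • e := by fun_prop
      have h2 := h1.tendsto 0
      rw [zero_smul, add_zero] at h2
      exact h2.mono_left nhdsWithin_le_nhds
    have hMN : ∀ᶠ t : ℝ in 𝓝[≠] 0, x₀ + t • e ∈ M ∩ N :=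
      hlim.eventually ((hMo.inter hNo).mem_nhds ⟨hxM, hxN⟩)
    obtain ⟨t, ⟨htM, htN⟩, ht⟩ := (hMN.and self_mem_nhdsWithin).exists
    set x₁ := x₀ + t • e with hx₁
    have hx₁j : x₁ (j, factorIndex (ε j)) = 0 := by simp [hx₁, he, hj0]
    have hJ : ∀ k, k ∈ ({j} : Finset (Fin n)) ↔
        StrictlyPositive (σ.1 k) ∧ chartCoord σ ε x₁ k = 0 := by
      intro k
      rw [Finset.mem_singleton, ← mem_vanishingExc]
      constructor
      · rintro rfl
        refine mem_vanishingExc.2 ⟨hs, (chartCoord_exc_eq_zero_iff hs ε x₁).2 ?_⟩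
        rw [realFactor_eq, hx₁j]
      · intro hk
        by_contra hkj
        have h1 := coord_eq_zero_of_mem_vanishingExc hk
        have h2 := coord_eq_zero_of_mem_vanishingExc ((hN x₁ htN).2 hk)
        simp [hx₁, he, h2, hkj] at h1
        exact ht h1
    obtain ⟨v, hv, hv1⟩ := surjective_fderiv_quotientSeries hf hnd hax hadm hvert
      (Finset.singleton_nonempty j) hJ (hM x₁ htM hx₁j) 1
    have hvj := hv j (Finset.mem_singleton_self j)
    have hd := ((hN x₁ htN).1.1.differentiableAt.hasFDerivAt).hasLineDerivAt v
    rw [hv1] at hd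
    have hd0 : HasDerivAt (fun s : ℝ => quotientSeries c σ {j} ε (x₁ + s • v)) 0 0 := by
      refine (hasDerivAt_const (0 : ℝ) (0 : ℂ)).congr_of_eventuallyEq ?_
      have h1 : Continuous fun s : ℝ => x₁ + s • v := by fun_prop
      have h2 := h1.tendsto 0
      rw [zero_smul, add_zero] at h2
      filter_upwards [h2.eventually (hMo.mem_nhds htM)] with s hs'
      exact hM _ hs' (by simp [hx₁j, hvj])
    exact one_ne_zero (hd.unique hd0)

end RegularFan

namespace RegularFan

variable {n : ℕ} {S : RegularFan n}

/-! ### The resolution map outside the exceptional divisors -/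

theorem mat_apply_of_eq_single {τ : S.Chart} {l i : Fin n} (h : τ.1 l = Pi.single i 1)
    (k : Fin n) : τ.mat k l = if k = i then 1 else 0 := by
  have h1 : τ.mat k l = ((τ.1 l k : ℕ) : ℤ) := rfl
  rw [h1, h, Pi.single_apply]
  split_ifs <;> rfl

theorem inv_mat_apply_of_eq_single {τ : S.Chart} {l i : Fin n} (h : τ.1 l = Pi.single i 1)
    (k : Fin n) : τ.mat⁻¹ k i = if k = l then 1 else 0 := by
  have h1 := congrFun (congrFun (Matrix.nonsing_inv_mul τ.mat τ.isUnit_det) k) l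
  rw [Matrix.mul_apply, Matrix.one_apply] at h1
  simpa [mat_apply_of_eq_single h] using h1

theorem mat_mul_inv_mat_nonneg {τ : S.Chart} {l i : Fin n} (h : τ.1 l = Pi.single i 1)
    (m k : Fin n) : 0 ≤ τ.mat k l * τ.mat⁻¹ m k := by
  rw [mat_apply_of_eq_single h]
  by_cases hk : k = i
  · subst hk
    rw [inv_mat_apply_of_eq_single h]
    split_ifs <;> simp
  · simp [hk]

theorem inv_mat_mul_mat_nonneg {τ : S.Chart} {l i : Fin n} (h : τ.1 l = Pi.single i 1)
    (m k : Fin n) : 0 ≤ τ.mat⁻¹ k i * τ.mat m k := by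
  rw [inv_mat_apply_of_eq_single h]
  by_cases hk : k = l
  · subst hk
    rw [mat_apply_of_eq_single h]
    split_ifs <;> simp
  · simp [hk]

/-- Outside the exceptional divisors the coordinates of a chart are determined by the image. -/
theorem monomialMap_inv_mat {τ : S.Chart} {w : Cn n}
    (hw : ∀ l, w l = 0 → ∃ i, τ.1 l = Pi.single i 1) :
    monomialMap τ.mat⁻¹ (monomialMap τ.mat w) = w := by
  rw [← monomialMap_mul, Matrix.nonsing_inv_mul _ τ.isUnit_det, monomialMap_one]
  intro l hl m k
  obtain ⟨i, hi⟩ := hw l hl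
  exact mat_mul_inv_mat_nonneg hi m k

theorem exists_eq_single_of_coord_eq_zero
    (hvert : ∀ P ∈ S.vertices, StrictlyPositive P ∨ ∃ i, P = Pi.single i 1) {τ : S.Chart}
    {w : Cn n} (h0 : monomialMap τ.mat w ≠ 0) {l : Fin n} (hl : w l = 0) :
    ∃ i, τ.1 l = Pi.single i 1 :=
  (hvert _ (τ.mem_vertices l)).resolve_left fun h => h0 (monomialMap_mat_eq_zero h hl)

theorem monomialMap_mat_apply_eq_zero_iff
    (hvert : ∀ P ∈ S.vertices, StrictlyPositive P ∨ ∃ i, P = Pi.single i 1) {τ : S.Chart}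
    {w : Cn n} (h0 : monomialMap τ.mat w ≠ 0) {i : Fin n} :
    monomialMap τ.mat w i = 0 ↔ ∃ l, τ.1 l = Pi.single i 1 ∧ w l = 0 := by
  constructor
  · intro h
    obtain ⟨l, -, hl⟩ := Finset.prod_eq_zero_iff.1 h
    have hw : w l = 0 := by
      by_contra h1
      exact zpow_ne_zero _ h1 hl
    obtain ⟨k, hk⟩ := exists_eq_single_of_coord_eq_zero hvert h0 hw
    refine ⟨l, ?_, hw⟩
    rw [mat_apply_of_eq_single hk] at hl
    by_cases hik : i = k
    · rw [hik, hk]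
    · simp [hik] at hl
  · rintro ⟨l, hl, hw⟩
    refine Finset.prod_eq_zero (Finset.mem_univ l) ?_
    rw [hw, mat_apply_of_eq_single hl, if_pos rfl]
    exact zero_zpow _ one_ne_zero

/-- Two points outside the exceptional divisors with the same image are glued: their vanishing
coordinates belong to the same vertices `E_i`, and their lines are spanned by the non-zero
coordinates. -/
theorem resolutionMap_injOn
    (hvert : ∀ P ∈ S.vertices, StrictlyPositive P ∨ ∃ i, P = Pi.single i 1) :
    InjOn S.resolutionMap (S.resolutionMap ⁻¹' {0})ᶜ := by
  intro p hp q hq hpq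
  obtain ⟨σ, ε, x, rfl⟩ := exists_parametrization_eq p
  obtain ⟨τ, δ, y, rfl⟩ := exists_parametrization_eq q
  rw [resolutionMap_parametrization, resolutionMap_parametrization] at hpq
  have hp0 : monomialMap σ.mat (chartCoord σ ε x) ≠ 0 := hp
  have hq0 : monomialMap τ.mat (chartCoord τ δ y) ≠ 0 := hq
  have h1 : ∀ j, chartCoord σ ε x j = 0 → ∃ i l, σ.1 j = Pi.single i 1 ∧ τ.1 l = Pi.single i 1 := by
    intro j hj
    obtain ⟨i, hi⟩ := exists_eq_single_of_coord_eq_zero hvert hp0 hj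
    have h2 : monomialMap τ.mat (chartCoord τ δ y) i = 0 := by
      rw [← hpq]
      exact (monomialMap_mat_apply_eq_zero_iff hvert hp0).2 ⟨j, hi, hj⟩
    obtain ⟨l, hl, -⟩ := (monomialMap_mat_apply_eq_zero_iff hvert hq0).1 h2
    exact ⟨i, l, hi, hl⟩
  have h2 : chartCoord τ δ y = monomialMap (transition σ τ) (chartCoord σ ε x) := by
    rw [← monomialMap_inv_mat fun l hl => exists_eq_single_of_coord_eq_zero hvert hq0 hl, ← hpq,
      transition, monomialMap_mul]
    intro j hj m k
    obtain ⟨i, l, hi, hl⟩ := h1 j hj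
    rw [mat_apply_of_eq_single hi, ← mat_apply_of_eq_single hl]
    exact mat_mul_inv_mat_nonneg hl m k
  refine parametrization_eq_iff.2 ⟨fun j hj => ?_, h2, fun k hk => ?_⟩
  · obtain ⟨i, l, hi, hl⟩ := h1 j hj
    rw [hi, ← hl]
    exact τ.mem_verts l
  · obtain ⟨t, ht⟩ := exists_monomialMap_eq_mul_lineVec (σ := σ) ε x hk
    have hne : chartCoord τ δ y k ≠ 0 := fun h => hq0 (monomialMap_mat_eq_zero hk h)
    rw [← h2] at ht
    have ht0 : (t : ℂ) ≠ 0 := by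
      rintro h
      rw [h, zero_mul] at ht
      exact hne ht
    refine (im_conj_mul_eq_zero_iff ?_).2 ⟨t / realFactor δ y k, ?_⟩
    · rintro h
      rw [h, mul_zero] at ht
      exact hne ht
    · have h3 := chartCoord_exc hk δ y
      have h4 : (realFactor δ y k : ℂ) ≠ 0 := by
        rintro h
        rw [h, zero_mul] at h3
        exact hne h3
      push_cast
      rw [div_mul_eq_mul_div, ← ht, h3, mul_div_cancel_left₀ _ h4]

/-- A chart that contains the vertices `E_i` for the vanishing coordinates of a point `z ≠ 0`. -/
theorem exists_chart_of_ne_zero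
    (hvert : ∀ P ∈ S.vertices, StrictlyPositive P ∨ ∃ i, P = Pi.single i 1) {z : Cn n}
    (hz : z ≠ 0) : ∃ σ : S.Chart, ∀ i, z i = 0 → ∃ j, σ.1 j = Pi.single i 1 := by
  classical
  set x : Fin n → ℝ := fun i => if z i = 0 then 1 else 0 with hx
  have hx0 : ∀ i, 0 ≤ x i := fun i => by
    simp only [hx]
    split_ifs <;> norm_num
  obtain ⟨σ, hσ⟩ := S.exists_chart_mem_cone hx0
  obtain ⟨t, ht, -, hxt⟩ := (σ.mem_cone_iff Subset.rfl).1 hσ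
  obtain ⟨k, hk⟩ := Function.ne_iff.1 hz
  refine ⟨σ, fun i hi => ?_⟩
  have h1 : x i = 1 := by simp [hx, hi]
  have hxk : x k = 0 := by simpa [hx] using hk
  have hsum : ∀ m, x m = ∑ j, t j * (σ.1 j m : ℝ) := fun m => by
    rw [hxt, Finset.sum_apply]
    rfl
  rw [hsum] at h1 hxk
  obtain ⟨j, -, hj⟩ := Finset.exists_ne_zero_of_sum_ne_zero (h1 ▸ one_ne_zero)
  have h2 := (Finset.sum_eq_zero_iff_of_nonneg fun j _ =>
    mul_nonneg (ht j) (Nat.cast_nonneg (σ.1 j k))).1 hxk j (Finset.mem_univ j)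
  have h3 : (σ.1 j k : ℝ) = 0 := (mul_eq_zero.1 h2).resolve_left (left_ne_zero_of_mul hj)
  rcases hvert _ (σ.mem_vertices j) with h4 | ⟨m, h4⟩
  · exact absurd (h4 k) (by
      have : σ.1 j k = 0 := by exact_mod_cast h3
      omega)
  · refine ⟨j, ?_⟩
    by_cases him : i = m
    · rw [him, h4]
    · rw [h4, Pi.single_apply, if_neg him] at hj
      simp at hj

open Classical in
/-- The real coordinates of the point over `z` outside the exceptional divisors. -/
def sectionCoord (σ : S.Chart) (ε : Fin n → Bool) (z : Cn n) : RealSpace n := fun k =>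
  if StrictlyPositive (σ.1 k.1) then
    blowupCoord (ε k.1) (monomialMap σ.mat⁻¹ z k.1) (monomialMap σ.mat⁻¹ z k.1) k.2
  else if k.2 = 0 then (monomialMap σ.mat⁻¹ z k.1).re else (monomialMap σ.mat⁻¹ z k.1).im

theorem chartCoord_sectionCoord {σ : S.Chart} {ε : Fin n → Bool} {z : Cn n}
    (hv : ∀ j, StrictlyPositive (σ.1 j) → Visible (ε j) (monomialMap σ.mat⁻¹ z j)) :
    chartCoord σ ε (sectionCoord σ ε z) = monomialMap σ.mat⁻¹ z := by
  funext j
  by_cases hj : StrictlyPositive (σ.1 j)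
  · have key : (fun i => sectionCoord σ ε z (j, i)) =
        blowupCoord (ε j) (monomialMap σ.mat⁻¹ z j) (monomialMap σ.mat⁻¹ z j) := by
      funext i
      simp only [sectionCoord, if_pos hj]
    obtain ⟨r, hr, h1, h2⟩ := direction_blowupCoord (hv j hj) (monomialMap σ.mat⁻¹ z j)
    rw [chartCoord_exc hj, realFactor, dirVec, key, h2 1 (by simp), one_mul]
    exact h1.symm
  · rw [chartCoord_nonexc hj]
    simp [sectionCoord, hj]

/-- A local real analytic section of the resolution map. -/
theorem exists_local_section
    (hvert : ∀ P ∈ S.vertices, StrictlyPositive P ∨ ∃ i, P = Pi.single i 1) {z₀ : Cn n}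
    (hz₀ : z₀ ≠ 0) : ∃ (σ : S.Chart) (ε : Fin n → Bool) (s : Cn n → RealSpace n),
      AnalyticAt ℝ s z₀ ∧ ∀ᶠ z in 𝓝 z₀, S.resolutionMap (S.parametrization σ ε (s z)) = z := by
  classical
  obtain ⟨σ, hσ⟩ := exists_chart_of_ne_zero hvert hz₀
  have hinv : ∀ z : Cn n, (∀ i, z i = 0 → z₀ i = 0) →
      monomialMap σ.mat (monomialMap σ.mat⁻¹ z) = z := by
    intro z hz
    rw [← monomialMap_mul, Matrix.mul_nonsing_inv _ σ.isUnit_det, monomialMap_one]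
    intro i hi m k
    obtain ⟨j, hj⟩ := hσ i (hz i hi)
    exact inv_mat_mul_mat_nonneg hj m k
  have hne : ∀ j, StrictlyPositive (σ.1 j) → monomialMap σ.mat⁻¹ z₀ j ≠ 0 := fun j hj h =>
    hz₀ ((hinv z₀ fun _ h => h).symm.trans (monomialMap_mat_eq_zero hj h))
  have han : ∀ j, AnalyticAt ℝ (fun z => monomialMap σ.mat⁻¹ z j) z₀ := by
    intro j
    refine analyticAt_prod_zpow _ (fun i _ => ?_) fun i _ hi => ?_
    · exact (ContinuousLinearMap.proj (R := ℝ) (φ := fun _ : Fin n => ℂ) i).analyticAt z₀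
    · obtain ⟨l, hl⟩ := hσ i hi
      rw [inv_mat_apply_of_eq_single hl]
      split_ifs <;> norm_num
  set ε : Fin n → Bool := fun j => decide ((monomialMap σ.mat⁻¹ z₀ j).re = 0) with hε
  have hv : ∀ j, StrictlyPositive (σ.1 j) → Visible (ε j) (monomialMap σ.mat⁻¹ z₀ j) := by
    intro j hj
    by_cases h : (monomialMap σ.mat⁻¹ z₀ j).re = 0
    · have h1 : (monomialMap σ.mat⁻¹ z₀ j).im ≠ 0 := fun h2 => hne j hj (Complex.ext h h2)
      simp [Visible, hε, h, h1]
    · simp [Visible, hε, h]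
  refine ⟨σ, ε, sectionCoord σ ε, ?_, ?_⟩
  · rw [analyticAt_pi_iff]
    rintro ⟨j, i⟩
    unfold sectionCoord
    by_cases hj : StrictlyPositive (σ.1 j)
    · simp only [hj, if_true]
      exact analyticAt_blowupCoord (han j) (han j) (hv j hj) i
    · simp only [hj, if_false]
      split_ifs
      · exact analyticAt_re (han j)
      · exact analyticAt_im (han j)
  · have h1 : ∀ᶠ z in 𝓝 z₀, ∀ j, StrictlyPositive (σ.1 j) →
        Visible (ε j) (monomialMap σ.mat⁻¹ z j) := by
      rw [eventually_all]
      intro j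
      by_cases hj : StrictlyPositive (σ.1 j)
      · filter_upwards [(han j).continuousAt.preimage_mem_nhds
          ((isOpen_visible (ε j)).mem_nhds (hv j hj))] with z hz _
        exact hz
      · exact Eventually.of_forall fun _ h => absurd h hj
    have h2 : ∀ᶠ z in 𝓝 z₀, ∀ i, z i = 0 → z₀ i = 0 := by
      rw [eventually_all]
      intro i
      by_cases hi : z₀ i = 0
      · exact Eventually.of_forall fun _ _ => hi
      · filter_upwards [(continuous_apply i).continuousAt.eventually_ne hi] with z hz h
        exact absurd h hz
    filter_upwards [h1, h2] with z hz1 hz2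
    rw [resolutionMap_parametrization, chartCoord_sectionCoord hz1, hinv z hz2]

theorem exists_resolutionMap_eq
    (hvert : ∀ P ∈ S.vertices, StrictlyPositive P ∨ ∃ i, P = Pi.single i 1) {z : Cn n}
    (hz : z ≠ 0) : ∃ q, S.resolutionMap q = z := by
  obtain ⟨σ, ε, s, -, hs⟩ := exists_local_section hvert hz
  exact ⟨_, hs.self_of_nhds⟩

/-- The resolution map is a real analytic diffeomorphism outside the exceptional divisors. -/
theorem exists_inverse_resolutionMap (hn : 0 < n)
    (hvert : ∀ P ∈ S.vertices, StrictlyPositive P ∨ ∃ i, P = Pi.single i 1) :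
    ∃ g : Cn n → S.RealBlowup, InvOn g S.resolutionMap (S.resolutionMap ⁻¹' {0})ᶜ {0}ᶜ ∧
      MapsTo g {0}ᶜ (S.resolutionMap ⁻¹' {0})ᶜ ∧
      ContMDiffOn 𝓘(ℝ, Cn n) 𝓘(ℝ, RealSpace n) ω g {0}ᶜ := by
  have : Nonempty S.RealBlowup := by
    obtain ⟨q, -⟩ := exists_resolutionMap_eq hvert
      (z := fun _ => (1 : ℂ)) (Function.ne_iff.2 ⟨⟨0, hn⟩, one_ne_zero⟩)
    exact ⟨q⟩
  choose! g hg using fun z : Cn n => exists_resolutionMap_eq (z := z) hvert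
  have hmaps : MapsTo g {0}ᶜ (S.resolutionMap ⁻¹' {0})ᶜ := fun z hz => by
    rw [mem_compl_iff, mem_preimage, hg z hz]
    exact hz
  refine ⟨g, ⟨fun q hq => ?_, fun z hz => hg z hz⟩, hmaps, ?_⟩
  · exact resolutionMap_injOn hvert (hmaps hq) hq (hg _ hq)
  · intro z hz
    obtain ⟨σ, ε, s, hsa, hs⟩ := exists_local_section hvert hz
    have := isManifold_realBlowup S
    have h1 : ContMDiffAt 𝓘(ℝ, RealSpace n) 𝓘(ℝ, RealSpace n) ω (stdChart σ ε).symm (s z) :=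
      contMDiffAt_symm_of_mem_maximalAtlas (stdChart_mem_analyticCharts σ ε) (mem_univ _)
    have h2 : ContMDiffAt 𝓘(ℝ, Cn n) 𝓘(ℝ, RealSpace n) ω s z := hsa.contDiffAt.contMDiffAt
    refine ((h1.comp z h2).congr_of_eventuallyEq ?_).contMDiffWithinAt
    filter_upwards [hs, isOpen_compl_singleton.mem_nhds hz] with y hy hy0
    refine resolutionMap_injOn hvert (hmaps hy0) ?_ ((hg y hy0).trans hy.symm)
    change S.resolutionMap (S.parametrization σ ε (s y)) ≠ 0
    rw [hy]
    exact hy0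

/-! ### Polar coordinates and properness -/

/-- The point of the chart `σ` with coordinates `r_j e^{iθ_j}` and lines spanned by
`e^{iθ_j}`. -/
def polar (σ : S.Chart) (a : (Fin n → ℝ) × (Fin n → ℝ)) : S.RealBlowup :=
  Quot.mk _ ⟨σ, ⟨(fun j => a.1 j * Complex.exp (a.2 j * Complex.I),
    fun j => Projectivization.mk ℝ (Complex.exp (a.2 j * Complex.I)) (Complex.exp_ne_zero _)),
    fun j => by
      rw [Projectivization.submodule_mk, Submodule.mem_span_singleton]
      exact ⟨a.1 j, by simp⟩⟩⟩

theorem continuous_polar (σ : S.Chart) : Continuous (polar σ) := by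
  refine continuous_quot_mk.comp (continuous_sigmaMk.comp (Continuous.subtype_mk ?_ _))
  have h : ∀ j, Continuous fun a : (Fin n → ℝ) × (Fin n → ℝ) =>
      Complex.exp (a.2 j * Complex.I) := fun j => by fun_prop
  refine Continuous.prodMk (continuous_pi fun j => ?_) (continuous_pi fun j => ?_)
  · exact (Complex.continuous_ofReal.comp (by fun_prop)).mul (h j)
  · exact continuous_projectivization_mk (h j) _

theorem resolutionMap_polar (σ : S.Chart) (a : (Fin n → ℝ) × (Fin n → ℝ)) :
    S.resolutionMap (polar σ a) =
      monomialMap σ.mat fun j => a.1 j * Complex.exp (a.2 j * Complex.I) := rfl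

/-- Polar coordinates are onto in each chart. The radius of an exceptional coordinate may be
negative, as its angle is prescribed by the line. -/
theorem exists_polar_eq (σ : S.Chart) (ε : Fin n → Bool) (x : RealSpace n) :
    ∃ a, polar σ a = S.parametrization σ ε x ∧ ∀ j, chartCoord σ ε x j = 0 → a.1 j = 0 := by
  classical
  refine ⟨(fun j => if StrictlyPositive (σ.1 j) then realFactor ε x j * ‖dirVec ε x j‖ else
    ‖chartCoord σ ε x j‖, fun j => if StrictlyPositive (σ.1 j) then (dirVec ε x j).arg else
    (chartCoord σ ε x j).arg), ?_, fun j hj => ?_⟩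
  · refine congrArg (fun p => Quot.mk _ (Sigma.mk σ p)) (Subtype.ext (Prod.ext ?_ ?_))
    · funext j
      change _ = chartCoord σ ε x j
      by_cases hj : StrictlyPositive (σ.1 j)
      · simp only [hj, if_true]
        rw [chartCoord_exc hj, Complex.ofReal_mul, mul_assoc, Complex.norm_mul_exp_arg_mul_I]
      · simp only [hj, if_false]
        exact Complex.norm_mul_exp_arg_mul_I _
    · funext j
      simp only [blowupPoint]
      rw [Projectivization.mk_eq_mk_iff']
      refine ⟨‖dirVec ε x j‖⁻¹, ?_⟩
      simp only [j.2, if_true]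
      change ‖dirVec ε x j‖⁻¹ • dirVec ε x j = _
      refine (inv_smul_eq_iff₀ (norm_ne_zero_iff.2 (dirVec_ne_zero ε x j))).2 ?_
      rw [Complex.real_smul, Complex.norm_mul_exp_arg_mul_I]
  · by_cases hs : StrictlyPositive (σ.1 j)
    · simp only [hs, if_true]
      rw [(chartCoord_exc_eq_zero_iff hs ε x).1 hj, zero_mul]
    · simp only [hs, if_false]
      rw [hj, norm_zero]

/-- The points over the torus are dense: adding a small `t ≠ 0` to all real coordinates makes the
coordinates of the chart non-zero. -/
theorem dense_setOf_resolutionMap_ne_zero (S : RegularFan n) :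
    Dense {q : S.RealBlowup | ∀ i, S.resolutionMap q i ≠ 0} := by
  intro q
  obtain ⟨σ, ε, x, rfl⟩ := exists_parametrization_eq q
  have h1 : Continuous fun t : ℝ => fun k => x k + t := by fun_prop
  have h2 := h1.tendsto 0
  simp only [add_zero] at h2
  have h3 : Tendsto (fun t : ℝ => S.parametrization σ ε fun k => x k + t) (𝓝[≠] 0)
      (𝓝 (S.parametrization σ ε x)) :=
    (((continuous_parametrization σ ε).tendsto x).comp h2).mono_left nhdsWithin_le_nhds
  have h4 : ∀ᶠ t : ℝ in 𝓝[≠] 0, ∀ k, x k + t ≠ 0 := by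
    rw [eventually_all]
    intro k
    by_cases hk : x k = 0
    · filter_upwards [self_mem_nhdsWithin] with t ht
      rw [hk, zero_add]
      exact ht
    · have h5 : ContinuousAt (fun t : ℝ => x k + t) 0 := by fun_prop
      exact (h5.eventually_ne (by simpa using hk)).filter_mono nhdsWithin_le_nhds
  refine mem_closure_of_tendsto h3 ?_
  filter_upwards [h4] with t ht i
  refine monomialMap_ne_zero _ (u := chartCoord σ ε fun k => x k + t) (fun j => ?_) i
  by_cases hj : StrictlyPositive (σ.1 j)
  · rw [Ne, chartCoord_exc_eq_zero_iff hj, realFactor_eq]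
    exact ht _
  · rw [chartCoord_nonexc hj]
    exact fun h => ht (j, 0) (congrArg Complex.re h)

/-- A point with non-zero coordinates of absolute value at most `R` has coordinates bounded in terms
of `R` in the chart whose cone contains `(log R - log ‖z i‖)_i`. -/
theorem exists_norm_monomialMap_inv_mat_le (S : RegularFan n) {R : ℝ} {z : Cn n}
    (hz : ∀ i, z i ≠ 0) (hR : ∀ i, ‖z i‖ ≤ R) :
    ∃ σ : S.Chart, ∀ j, ‖monomialMap σ.mat⁻¹ z j‖ ≤
      Real.exp (∑ i, (σ.mat⁻¹ j i : ℝ) * Real.log R) := by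
  have hpos : ∀ i, 0 < ‖z i‖ := fun i => norm_pos_iff.2 (hz i)
  obtain ⟨σ, hσ⟩ := S.exists_chart_mem_cone (x := fun i => Real.log R - Real.log ‖z i‖)
    fun i => sub_nonneg.2 (Real.log_le_log (hpos i) (hR i))
  obtain ⟨t, ht, -, hxt⟩ := (σ.mem_cone_iff Subset.rfl).1 hσ
  refine ⟨σ, fun j => ?_⟩
  have h1 : ‖monomialMap σ.mat⁻¹ z j‖ = Real.exp (∑ i, (σ.mat⁻¹ j i : ℝ) * Real.log ‖z i‖) := by
    rw [Real.exp_sum, monomialMap, norm_prod]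
    refine Finset.prod_congr rfl fun i _ => ?_
    rw [norm_zpow, ← Real.rpow_intCast, Real.rpow_def_of_pos (hpos i), mul_comm]
  rw [h1, Real.exp_le_exp, ← sub_nonneg, ← Finset.sum_sub_distrib]
  have h2 : ∀ i, Real.log R - Real.log ‖z i‖ = ∑ k, t k * (σ.mat i k : ℝ) := fun i => by
    have := congrFun hxt i
    rw [Finset.sum_apply] at this
    simpa [realWeight, Chart.mat] using this
  have h3 : ∀ k, ∑ i, (σ.mat⁻¹ j i : ℝ) * (σ.mat i k : ℝ) = if j = k then 1 else 0 := by
    intro k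
    have := congrFun (congrFun (Matrix.nonsing_inv_mul σ.mat σ.isUnit_det) j) k
    rw [Matrix.mul_apply, Matrix.one_apply] at this
    exact_mod_cast this
  calc (0 : ℝ) ≤ t j := ht j
    _ = ∑ k, t k * ∑ i, (σ.mat⁻¹ j i : ℝ) * (σ.mat i k : ℝ) := by simp [h3]
    _ = ∑ i, ∑ k, (σ.mat⁻¹ j i : ℝ) * (t k * (σ.mat i k : ℝ)) := by
      rw [Finset.sum_comm]
      refine Finset.sum_congr rfl fun k _ => ?_
      rw [Finset.mul_sum]
      exact Finset.sum_congr rfl fun i _ => by ring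
    _ = _ := by
      refine Finset.sum_congr rfl fun i _ => ?_
      rw [← Finset.mul_sum, ← h2, mul_sub]

/-- The resolution map is proper: over a polydisc, finitely many compact sets of points given by
bounded polar coordinates contain all points over the torus, and these are dense. -/
theorem isProperMap_resolutionMap (hn : 0 < n)
    (hvert : ∀ P ∈ S.vertices, StrictlyPositive P ∨ ∃ i, P = Pi.single i 1) :
    IsProperMap S.resolutionMap := by
  have := t2Space_realBlowup S
  have := S.finite_chart
  rw [isProperMap_iff_isCompact_preimage]
  refine ⟨continuous_resolutionMap S, fun K hK => ?_⟩
  obtain ⟨R, hR⟩ := hK.isBounded.exists_norm_le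
  set M : S.Chart → Fin n → ℝ := fun σ j =>
    Real.exp (∑ i, (σ.mat⁻¹ j i : ℝ) * Real.log (R + 1)) with hM
  set C : Set S.RealBlowup := ⋃ σ : S.Chart, polar σ ''
    (Icc (fun j => -M σ j) (M σ) ×ˢ Icc (fun _ => -Real.pi) (fun _ => Real.pi)) with hC
  have hCc : IsCompact C := isCompact_iUnion fun σ =>
    (isCompact_Icc.prod isCompact_Icc).image (continuous_polar σ)
  refine hCc.of_isClosed_subset (hK.isClosed.preimage (continuous_resolutionMap S)) ?_
  set U : Set S.RealBlowup := S.resolutionMap ⁻¹' {z | ∀ i, ‖z i‖ < R + 1} with hU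
  have hUo : IsOpen U := by
    refine IsOpen.preimage (continuous_resolutionMap S) ?_
    simp only [Set.ofPred_forall]
    exact isOpen_iInter_of_finite fun i =>
      isOpen_lt (continuous_apply i).norm continuous_const
  have hKU : S.resolutionMap ⁻¹' K ⊆ U := fun q hq i =>
    ((norm_le_pi_norm _ i).trans (hR _ hq)).trans_lt (lt_add_one R)
  refine hKU.trans (((dense_setOf_resolutionMap_ne_zero S).open_subset_closure_inter hUo).trans
    (closure_minimal ?_ hCc.isClosed))
  rintro q ⟨hqU, hq⟩
  obtain ⟨σ, hσ⟩ := exists_norm_monomialMap_inv_mat_le S hq fun i => (hqU i).le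
  set u := monomialMap σ.mat⁻¹ (S.resolutionMap q) with hu
  refine mem_iUnion.2 ⟨σ, (fun j => ‖u j‖, fun j => (u j).arg), ⟨⟨fun j => ?_, fun j => hσ j⟩,
    ⟨fun j => (Complex.neg_pi_lt_arg _).le, fun j => Complex.arg_le_pi _⟩⟩, ?_⟩
  · exact (neg_nonpos.2 (Real.exp_pos _).le).trans (norm_nonneg _)
  · have h1 : S.resolutionMap (polar σ (fun j => ‖u j‖, fun j => (u j).arg)) =
        S.resolutionMap q := by
      rw [resolutionMap_polar]
      simp only [Complex.norm_mul_exp_arg_mul_I]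
      rw [hu, ← monomialMap_mul_of_ne_zero _ _ hq, Matrix.mul_nonsing_inv _ σ.isUnit_det,
        monomialMap_one]
    have h2 : S.resolutionMap q ≠ 0 := fun h => hq ⟨0, hn⟩ (congrFun h _)
    exact resolutionMap_injOn hvert (by rw [mem_compl_iff, mem_preimage, h1]; exact h2) h2 h1

/-! ### The exceptional divisors as irreducible components -/

theorem finite_positiveVertices (S : RegularFan n) : Finite S.positiveVertices := by
  refine Set.Finite.to_subtype (Set.Finite.subset ?_ fun P hP => hP.1)
  exact S.cones.finite_toSet.preimage (Finset.singleton_injective.injOn)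

theorem exists_chart_eq_positiveVertex (hn : 0 < n) (P : S.positiveVertices) :
    ∃ (σ : S.Chart) (j : Fin n), σ.1 j = P.1 :=
  exists_chart_of_mem_vertices P.2.1 fun h => by
    have := P.2.2 ⟨0, hn⟩
    simp [h] at this

/-- The coordinates `u_j = 0`, `u_k = 1` for `k ≠ j`, with all lines equal to `ℝ`. -/
def distinguishedCoord (j : Fin n) : RealSpace n := fun k =>
  if k.2 = 0 ∧ k.1 ≠ j then 1 else 0

/-- A point of an exceptional divisor that lies on no other one, and that is the same in all
charts. -/
def distinguishedPoint (σ : S.Chart) (j : Fin n) : S.RealBlowup :=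
  S.parametrization σ (fun _ => false) (distinguishedCoord j)

theorem dirVec_distinguishedCoord (j k : Fin n) :
    dirVec (fun _ => false) (distinguishedCoord j) k = 1 := by
  simp only [dirVec, direction, distinguishedCoord]
  apply Complex.ext <;> simp

theorem chartCoord_distinguishedCoord (σ : S.Chart) (j k : Fin n) :
    chartCoord σ (fun _ => false) (distinguishedCoord j) k = if k = j then 0 else 1 := by
  by_cases hk : StrictlyPositive (σ.1 k)
  · rw [chartCoord_exc hk, dirVec_distinguishedCoord, realFactor, factor]
    by_cases h : k = j <;> simp [distinguishedCoord, h]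
  · rw [chartCoord_nonexc hk]
    apply Complex.ext <;> by_cases h : k = j <;> simp [distinguishedCoord, h]

theorem distinguishedPoint_eq {σ τ : S.Chart} {j k : Fin n} (h : σ.1 j = τ.1 k) :
    distinguishedPoint σ j = distinguishedPoint τ k := by
  refine parametrization_eq_iff.2 ⟨fun i hi => ?_, ?_, fun l _ => ?_⟩
  · rw [chartCoord_distinguishedCoord] at hi
    obtain rfl : i = j := by
      by_contra h'
      simp [h'] at hi
    exact h ▸ τ.mem_verts k
  · funext l
    rw [chartCoord_distinguishedCoord]
    symm
    refine (Finset.prod_eq_single j (fun i _ hi => ?_) (by simp)).trans ?_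
    · rw [chartCoord_distinguishedCoord, if_neg hi, one_zpow]
    · rw [chartCoord_distinguishedCoord, if_pos rfl, transition_apply_of_eq h]
      by_cases hl : l = k <;> simp [hl]
  · have h1 : lineVec σ τ (fun _ => false) (distinguishedCoord j) l = 1 := by
      refine Finset.prod_eq_one fun i _ => ?_
      by_cases hi : σ.1 i = τ.1 l
      · rw [if_pos hi, dirVec_distinguishedCoord]
      · refine (if_neg hi).trans ?_
        rw [chartCoord_distinguishedCoord]
        by_cases hij : i = j
        · subst hij
          have hlk : l ≠ k := by
            rintro rfl
            exact hi h
          rw [transition_apply_of_eq h, if_neg hlk, zpow_zero]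
        · rw [if_neg hij, one_zpow]
    rw [h1, dirVec_distinguishedCoord]
    simp

theorem distinguishedPoint_mem_iff {P : S.positiveVertices} {σ : S.Chart} {j : Fin n} :
    distinguishedPoint σ j ∈ S.exceptionalDivisor P ↔ σ.1 j = P.1 := by
  refine parametrization_mem_exceptionalDivisor_iff.trans ⟨?_, fun h => ⟨j, h, ?_⟩⟩
  · rintro ⟨k, hk, hk0⟩
    by_cases hkj : k = j
    · rwa [← hkj]
    · simp [distinguishedCoord, factorIndex, hkj] at hk0
  · simp [distinguishedCoord]

theorem not_exceptionalDivisor_subset (hn : 0 < n) {P Q : S.positiveVertices} (h : P ≠ Q) :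
    ¬ S.exceptionalDivisor P ⊆ S.exceptionalDivisor Q := by
  intro hs
  obtain ⟨σ, j, hj⟩ := exists_chart_eq_positiveVertex hn P
  exact h (Subtype.ext (hj.symm.trans
    (distinguishedPoint_mem_iff.1 (hs (distinguishedPoint_mem_iff.2 hj)))))

/-- An exceptional divisor is connected: in each chart it is the image, under polar coordinates, of
a linear subspace, and these images share the distinguished point. -/
theorem isPreconnected_exceptionalDivisor (P : S.positiveVertices) :
    IsPreconnected (S.exceptionalDivisor P) := by
  set A : {σj : S.Chart × Fin n // σj.1.1 σj.2 = P.1} → Set S.RealBlowup := fun σj =>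
    polar σj.1.1 '' {a | a.1 σj.1.2 = 0} with hA
  have hmem : ∀ (σ : S.Chart) (j : Fin n) (hj : σ.1 j = P.1) (ε : Fin n → Bool)
      (x : RealSpace n), x (j, factorIndex (ε j)) = 0 →
      S.parametrization σ ε x ∈ A ⟨(σ, j), hj⟩ := by
    intro σ j hj ε x hx
    obtain ⟨a, ha, ha0⟩ := exists_polar_eq σ ε x
    refine ⟨a, ha0 j ?_, ha⟩
    have hs : StrictlyPositive (σ.1 j) := hj ▸ P.2.2
    rw [chartCoord_exc_eq_zero_iff hs, realFactor_eq, hx]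
  have hE : S.exceptionalDivisor P = ⋃ σj, A σj := by
    ext q
    rw [mem_iUnion]
    constructor
    · intro hq
      obtain ⟨σ, ε, x, rfl⟩ := exists_parametrization_eq q
      obtain ⟨j, hj, hj0⟩ := parametrization_mem_exceptionalDivisor_iff.1 hq
      exact ⟨⟨(σ, j), hj⟩, hmem σ j hj ε x hj0⟩
    · rintro ⟨⟨⟨σ, j⟩, hj⟩, a, ha, rfl⟩
      refine mk_mem_exceptionalDivisor_iff.2 ⟨j, hj, ?_⟩
      have ha' : a.1 j = 0 := ha
      change (a.1 j : ℂ) * _ = 0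
      rw [ha', Complex.ofReal_zero, zero_mul]
  rw [hE]
  rcases isEmpty_or_nonempty {σj : S.Chart × Fin n // σj.1.1 σj.2 = P.1} with h | ⟨⟨⟨σ, j⟩, hj⟩⟩
  · rw [iUnion_of_empty]
    exact isPreconnected_empty
  refine isPreconnected_iUnion ⟨distinguishedPoint σ j, mem_iInter.2 ?_⟩ ?_
  · rintro ⟨⟨τ, k⟩, hk⟩
    rw [distinguishedPoint_eq (hj.trans hk.symm)]
    exact hmem τ k hk _ _ (by simp [distinguishedCoord])
  · rintro ⟨⟨τ, k⟩, hk⟩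
    refine IsPreconnected.image ?_ _ (continuous_polar τ).continuousOn
    refine Convex.isPreconnected ?_
    intro a ha b hb s t _ _ _
    have ha' : a.1 k = 0 := ha
    have hb' : b.1 k = 0 := hb
    change s * a.1 k + t * b.1 k = 0
    rw [ha', hb', mul_zero, mul_zero, add_zero]

theorem isAnalyticSubset_exceptionalDivisor (P : S.positiveVertices) :
    IsAnalyticSubset n (S.exceptionalDivisor P) := by
  intro p
  obtain ⟨σ, ε, x, rfl⟩ := exists_parametrization_eq p
  refine ⟨(stdChart σ ε).source, (stdChart σ ε).open_source, parametrization_mem_source σ ε x, ?_⟩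
  have := isManifold_realBlowup S
  by_cases h : ∃ j, σ.1 j = P.1
  · obtain ⟨j, hj⟩ := h
    refine ⟨fun q => stdChart σ ε q (j, factorIndex (ε j)), ?_, fun q hq => ?_⟩
    · have h1 := contMDiffOn_of_mem_maximalAtlas (stdChart_mem_analyticCharts σ ε)
      exact ContMDiff.comp_contMDiffOn (ContinuousLinearMap.contMDiff
        (ContinuousLinearMap.proj (R := ℝ) (φ := fun _ : Fin n × Fin 2 => ℝ)
          (j, factorIndex (ε j)))) h1
    · rw [stdChart_source] at hq
      obtain ⟨y, rfl⟩ := hq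
      beta_reduce
      rw [stdChart_parametrization, parametrization_mem_exceptionalDivisor_iff]
      constructor
      · rintro ⟨k, hk, hk0⟩
        rwa [σ.injective (hj.trans hk.symm)]
      · exact fun h => ⟨j, hj, h⟩
  · refine ⟨fun _ => 1, contMDiffOn_const, fun q hq => ?_⟩
    rw [stdChart_source] at hq
    obtain ⟨y, rfl⟩ := hq
    rw [parametrization_mem_exceptionalDivisor_iff]
    refine iff_of_false ?_ one_ne_zero
    rintro ⟨j, hj, -⟩
    exact h ⟨j, hj⟩

end RegularFan

theorem IsAnalyticSubset.isClosed {n : ℕ} {Y : Type*} [TopologicalSpace Y]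
    [ChartedSpace (RealSpace n) Y] {A : Set Y} (hA : IsAnalyticSubset n A) : IsClosed A := by
  rw [← isOpen_compl_iff, isOpen_iff_mem_nhds]
  intro p hp
  obtain ⟨U, hU, hpU, g, hg, hgA⟩ := hA p
  have h1 : ContinuousAt g p := hg.continuousOn.continuousAt (hU.mem_nhds hpU)
  filter_upwards [h1.eventually_ne fun h => hp ((hgA p hpU).2 h), hU.mem_nhds hpU] with q hq hqU hqA
  exact hq ((hgA q hqU).1 hqA)

namespace RegularFan

variable {n : ℕ} {S : RegularFan n}

/-- The identity theorem along an exceptional divisor: an analytic subset that contains the divisor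
near one of its points contains it. -/
theorem exceptionalDivisor_subset_of_eventually (P : S.positiveVertices) {B : Set S.RealBlowup}
    (hB : IsAnalyticSubset n B) {p : S.RealBlowup} (hp : p ∈ S.exceptionalDivisor P)
    (hpB : ∀ᶠ q in 𝓝 p, q ∈ S.exceptionalDivisor P → q ∈ B) : S.exceptionalDivisor P ⊆ B := by
  classical
  have hman := isManifold_realBlowup S
  set V : Set (S.exceptionalDivisor P) :=
    {q | ∀ᶠ q' in 𝓝 q.1, q' ∈ S.exceptionalDivisor P → q' ∈ B} with hV
  have hpre : PreconnectedSpace (S.exceptionalDivisor P) :=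
    Subtype.preconnectedSpace (isPreconnected_exceptionalDivisor P)
  have hopen : IsOpen V := by
    rw [isOpen_iff_mem_nhds]
    intro q hq
    exact continuous_subtype_val.continuousAt.eventually (eventually_eventually_nhds.2 hq)
  have hclosed : IsClosed V := by
    refine isClosed_of_closure_subset fun q hq => ?_
    obtain ⟨q, hqE⟩ := q
    obtain ⟨U, hU, hqU, g, hg, hgB⟩ := hB q
    obtain ⟨σ, ε, x₀, rfl⟩ := exists_parametrization_eq q
    obtain ⟨j, hj, hj0⟩ := parametrization_mem_exceptionalDivisor_iff.1 hqE
    have hE : ∀ x, S.parametrization σ ε x ∈ S.exceptionalDivisor P ↔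
        x (j, factorIndex (ε j)) = 0 := by
      intro x
      rw [parametrization_mem_exceptionalDivisor_iff]
      constructor
      · rintro ⟨k, hk, hk0⟩
        rwa [σ.injective (hj.trans hk.symm)]
      · exact fun h => ⟨j, hj, h⟩
    obtain ⟨r, hr, hrU⟩ := Metric.mem_nhds_iff.1
      ((continuous_parametrization σ ε).continuousAt.preimage_mem_nhds (hU.mem_nhds hqU))
    -- the projection to the coordinate hyperplane
    set π : RealSpace n → RealSpace n := fun x k =>
      if k = (j, factorIndex (ε j)) then 0 else x k with hπ
    have hπa : ∀ x, AnalyticAt ℝ π x := by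
      intro x
      rw [analyticAt_pi_iff]
      intro k
      change AnalyticAt ℝ (fun x : RealSpace n => if k = (j, factorIndex (ε j)) then 0 else x k) x
      split_ifs
      · exact analyticAt_const
      · exact analyticAt_coord k x
    have hπball : ∀ x ∈ Metric.ball x₀ r, π x ∈ Metric.ball x₀ r := by
      intro x hx
      refine lt_of_le_of_lt ((dist_pi_le_iff dist_nonneg).2 fun k => ?_) hx
      by_cases hk : k = (j, factorIndex (ε j))
      · subst hk
        simp only [hπ, if_true, hj0, dist_self]
        exact dist_nonneg
      · simp only [hπ, hk, if_false]
        exact dist_le_pi_dist x x₀ k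
    have hπid : ∀ x : RealSpace n, x (j, factorIndex (ε j)) = 0 → π x = x := by
      intro x hx
      funext k
      by_cases hk : k = (j, factorIndex (ε j))
      · subst hk
        simp [hπ, hx]
      · simp [hπ, hk]
    have hπ0 : ∀ x, π x (j, factorIndex (ε j)) = 0 := fun x => by simp [hπ]
    have hga : ∀ x ∈ Metric.ball x₀ r,
        AnalyticAt ℝ (fun x => g (S.parametrization σ ε x)) x := by
      intro x hx
      have h1 : ContMDiffAt 𝓘(ℝ, RealSpace n) 𝓘(ℝ, RealSpace n) ω (stdChart σ ε).symm x :=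
        contMDiffAt_symm_of_mem_maximalAtlas (stdChart_mem_analyticCharts σ ε) (mem_univ _)
      have h2 : ContMDiffAt 𝓘(ℝ, RealSpace n) 𝓘(ℝ, ℝ) ω g ((stdChart σ ε).symm x) :=
        hg.contMDiffAt (hU.mem_nhds (hrU hx))
      exact (contMDiffAt_iff_contDiffAt.1 (h2.comp x h1)).analyticAt
    have hha : AnalyticOnNhd ℝ (fun x => g (S.parametrization σ ε (π x))) (Metric.ball x₀ r) :=
      fun x hx => (hga _ (hπball x hx)).comp (hπa x)
    -- a nearby point of the divisor near which `B` contains the divisor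
    have hnear : ∃ y ∈ Metric.ball x₀ r, y (j, factorIndex (ε j)) = 0 ∧
        ∀ᶠ q' in 𝓝 (S.parametrization σ ε y), q' ∈ S.exceptionalDivisor P → q' ∈ B := by
      obtain ⟨⟨q', hq'E⟩, hq'o, hq'V⟩ := mem_closure_iff.1 hq
        (Subtype.val ⁻¹' (S.parametrization σ ε '' Metric.ball x₀ r))
        ((isOpenMap_parametrization σ ε _ Metric.isOpen_ball).preimage continuous_subtype_val)
        ⟨x₀, Metric.mem_ball_self hr, rfl⟩
      obtain ⟨y, hy, rfl⟩ := hq'o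
      exact ⟨y, hy, (hE y).1 hq'E, hq'V⟩
    obtain ⟨y, hy, hy0, hyB⟩ := hnear
    have hzero : (fun x => g (S.parametrization σ ε (π x))) =ᶠ[𝓝 y] 0 := by
      have h1 : Tendsto (fun x => S.parametrization σ ε (π x)) (𝓝 y)
          (𝓝 (S.parametrization σ ε y)) := by
        have := ((continuous_parametrization σ ε).continuousAt.comp (hπa y).continuousAt).tendsto
        rwa [Function.comp_apply, hπid y hy0] at this
      filter_upwards [h1.eventually hyB, Metric.isOpen_ball.mem_nhds hy] with x hx hxb
      exact (hgB _ (hrU (hπball x hxb))).1 (hx ((hE _).2 (hπ0 x)))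
    have heq := hha.eqOn_zero_of_preconnected_of_eventuallyEq_zero
      (convex_ball x₀ r).isPreconnected hy hzero
    change ∀ᶠ q' in 𝓝 (S.parametrization σ ε x₀), q' ∈ S.exceptionalDivisor P → q' ∈ B
    rw [← (isOpenEmbedding_parametrization σ ε).map_nhds_eq, eventually_map]
    filter_upwards [Metric.ball_mem_nhds x₀ hr] with x hx hxE
    have h1 := heq hx
    simp only [hπid x ((hE x).1 hxE), Pi.zero_apply] at h1
    exact (hgB _ (hrU hx)).2 h1
  have huniv : V = univ := IsClopen.eq_univ ⟨hclosed, hopen⟩ ⟨⟨p, hp⟩, hpB⟩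
  intro q hq
  have h1 : (⟨q, hq⟩ : S.exceptionalDivisor P) ∈ V := huniv ▸ mem_univ _
  exact (show ∀ᶠ q' in 𝓝 q, q' ∈ S.exceptionalDivisor P → q' ∈ B from h1).self_of_nhds hq

theorem isIrreducibleSubset_exceptionalDivisor (hn : 0 < n) (P : S.positiveVertices) :
    IsIrreducibleSubset n (S.exceptionalDivisor P) := by
  refine ⟨?_, isAnalyticSubset_exceptionalDivisor P, fun A B hA hB hAB => ?_⟩
  · obtain ⟨σ, j, hj⟩ := exists_chart_eq_positiveVertex hn P
    exact ⟨_, distinguishedPoint_mem_iff.2 hj⟩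
  · by_cases h : S.exceptionalDivisor P ⊆ A
    · exact Or.inl (h.antisymm (hAB ▸ subset_union_left))
    · right
      obtain ⟨p, hp, hpA⟩ := not_subset.1 h
      refine (exceptionalDivisor_subset_of_eventually P hB hp ?_).antisymm
        (hAB ▸ subset_union_right)
      filter_upwards [hA.isClosed.isOpen_compl.mem_nhds hpA] with q hq hqE
      rw [hAB] at hqE
      exact hqE.resolve_left hq

variable {c : (Fin n → ℕ) → (Fin n → ℕ) → ℂ} {f : Cn n → ℂ}

/-! ### The good resolution -/

/-- The zeros of `f` near the origin are regular points: as `Φ` is closed and onto outside the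
origin, it suffices to know this near every point of `Φ⁻¹(0)`. -/
theorem eventually_surjective_fderiv_nhds (hn : 0 < n) (hf : HasMixedExpansion f c)
    (hnd : IsNonDegenerate c)
    (hax : ∀ i, ∃ ν μ, c ν μ ≠ 0 ∧ ∀ k, k ≠ i → (ν + μ) k = 0) (hadm : S.IsAdmissible c)
    (hvert : ∀ P ∈ S.vertices, StrictlyPositive P ∨ ∃ i, P = Pi.single i 1)
    (hexc : ∀ (σ : S.Chart) (K : Finset (Fin n)),
      StrictlyPositive (faceWeight σ K) → ∃ j ∈ K, StrictlyPositive (σ.1 j)) :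
    ∀ᶠ z in 𝓝[≠] (0 : Cn n), f z = 0 → Function.Surjective (fderiv ℝ f z) := by
  set O : Set S.RealBlowup := interior {q | S.resolutionMap q ≠ 0 → f (S.resolutionMap q) = 0 →
    Function.Surjective (fderiv ℝ f (S.resolutionMap q))} with hO
  have h1 : IsClosed (S.resolutionMap '' Oᶜ) :=
    (isProperMap_resolutionMap hn hvert).isClosedMap _ isOpen_interior.isClosed_compl
  have h2 : (0 : Cn n) ∉ S.resolutionMap '' Oᶜ := by
    rintro ⟨q, hq, hq0⟩
    exact hq (mem_interior_iff_mem_nhds.2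
      (eventually_surjective_fderiv hf hnd hax hadm hvert hexc hq0))
  rw [eventually_nhdsWithin_iff]
  filter_upwards [h1.isOpen_compl.mem_nhds h2] with z hz hz0 hfz
  obtain ⟨q, rfl⟩ := exists_resolutionMap_eq hvert hz0
  have hq : q ∈ O := by
    by_contra h
    exact hz ⟨q, h, rfl⟩
  exact interior_subset hq hz0 hfz

end RegularFan

end Mixed

end

theorem theorem24 {n : ℕ} (hn : 0 < n)
    (f : Mixed.Cn n → ℂ) (c : (Fin n → ℕ) → (Fin n → ℕ) → ℂ)
    (hf : Mixed.HasMixedExpansion f c) (hc : c 0 0 = 0)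
    (hconv : Mixed.IsConvenient f) (hnd : Mixed.IsNonDegenerate c)
    (S : Mixed.RegularFan n) (hadm : S.IsAdmissible c)
    (hvert : ∀ P ∈ S.vertices, Mixed.StrictlyPositive P ∨ ∃ i, P = Pi.single i 1) :
    ∃ _structure : ChartedSpace (Mixed.RealSpace n) S.RealBlowup,
      S.IsStandardStructure ∧
      Mixed.IsGoodResolutionOfRealType f S.resolutionMap S.exceptionalDivisor ∧
      ∀ P : S.positiveVertices,
        Mixed.HasMultiplicityAlong n (f ∘ S.resolutionMap) (S.exceptionalDivisor P)
          (Mixed.radialDegree c P.1) := by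
  have hax := fun i => hconv.exists_coeff_ne_zero hn hf i
  have hexc : ∀ (σ : S.Chart) (K : Finset (Fin n)),
      Mixed.StrictlyPositive (Mixed.RegularFan.faceWeight σ K) →
        ∃ j ∈ K, Mixed.StrictlyPositive (σ.1 j) := fun σ K hK =>
    Mixed.RegularFan.exists_strictlyPositive_of_faceWeight hc hax hadm hvert hn hK
  exact ⟨inferInstance, Mixed.RegularFan.isStandardStructure_realBlowup S,
    { isolated := Mixed.RegularFan.eventually_surjective_fderiv_nhds hn hf hnd hax hadm hvert hexc
      isManifold := Mixed.RegularFan.isManifold_realBlowup S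
      t2 := Mixed.RegularFan.t2Space_realBlowup S
      secondCountable := Mixed.RegularFan.secondCountable_realBlowup S
      isProper := Mixed.RegularFan.isProperMap_resolutionMap hn hvert
      isAnalytic := Mixed.RegularFan.contMDiff_resolutionMap S
      finite := Mixed.RegularFan.finite_positiveVertices S
      iUnion_eq := Mixed.RegularFan.iUnion_exceptionalDivisor hexc
      irreducible := Mixed.RegularFan.isIrreducibleSubset_exceptionalDivisor hn
      not_subset := fun _ _ h => Mixed.RegularFan.not_exceptionalDivisor_subset hn h
      smooth := fun P _ hp => Mixed.RegularFan.smooth_exceptionalDivisor P hp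
      diffeo := Mixed.RegularFan.exists_inverse_resolutionMap hn hvert
      strict_smooth := Mixed.RegularFan.strict_smooth_nhds hf hnd hax hadm hvert hexc
      normal_form := fun _ hp I hI hIp =>
        Mixed.RegularFan.exists_normal_form hf hnd hax hadm hvert hexc hp I hI hIp },
    fun P => Mixed.RegularFan.hasMultiplicityAlong_exceptionalDivisor hf hnd hax hadm hvert P⟩
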